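/- For $f\in L^2(\mathbb R)$ put $\widehat f(\xi)=\int_{\mathbb R}e^{-ix\xi}f(x)\,dx$ (Plancherel transform) and, for $(t,x)\in\mathbb R^2$, \[ [\widetilde E_5]f(t,x)=\frac1{2\pi}\int_{\mathbb R}|\xi+\xi^3|^{1/6}e^{ix\xi+it(\xi^3+\xi^5)}\widehat f(\xi)\,d\xi,\qquad [e^{it\Delta}]f(x)=\frac1{2\pi}\int_{\mathbb R}e^{ix\xi-it\xi^2}\widehat f(\xi)\,d\xi, \] where each integral over $\mathbb R$ is the limit in $L^6_{t,x}=L^6(\mathbb R^2)$ of the integrals over $\{|\xi|\le R\}$ as $R\to\infty$. Let $g_1,g_2\in L^2(\mathbb R)$ and, for $N\in\mathbb R$, let $\widetilde g_N(x)=e^{ixN}g_1(x)+e^{-ixN}g_2(x)$. Then $[\widetilde E_5]\widetilde g_N$ (for every $N$), $[e^{it\Delta}]g_1$ and $[e^{it\Delta}]g_2$ are well defined elements of $L^6_{t,x}$, the limit $\lim_{N\to\infty}\|[\widetilde E_5]\widetilde g_N\|_{L^6_{t,x}}$ exists and is finite, and \[ \lim_{N\to\infty}\big\|[\widetilde E_5]\widetilde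 g_N\big\|_{L^6_{t,x}}\le 4^{-1/6}\Big(\big\|[e^{it\Delta}]g_1\big\|_{L^6_{t,x}}^2+\big\|[e^{it\Delta}]g_2\big\|_{L^6_{t,x}}^2\Big)^{1/2}. \] Equality holds if and only if $\big|[e^{it\Delta}]g_1(x)\big|=\big|[e^{-it\Delta}]g_2(x)\big|$ for almost every $(t,x)\in\mathbb R^2$. -/

import Mathlib

open MeasureTheory Filter Topology
open scoped FourierTransform ENNReal

noncomputable section

/-- The space `L²(ℝ)` of complex-valued functions. -/
abbrev L2R : Type := Lp ℂ 2 (volume : Measure ℝ)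

/-- The `L²` Fourier transform in the normalization `f̂(ξ) = ∫ e^{-ixξ} f(x) dx`
(Mathlib's Plancherel transform is `∫ e^{-2πixξ} f(x) dx`, whence the rescaling). -/
def fourierHat (f : L2R) (ξ : ℝ) : ℂ :=
  (𝓕 f : L2R) (ξ / (2 * Real.pi))

/-- The absolutely convergent integral
`(1/2π) ∫_{|ξ| ≤ R} m(ξ) e^{ixξ + itφ(ξ)} f̂(ξ) dξ` at the point `p = (t, x)`. -/
def truncExtension (m φ : ℝ → ℝ) (f : L2R) (R : ℝ) (p : ℝ × ℝ) : ℂ :=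
  (1 / (2 * Real.pi) : ℂ) * ∫ ξ in Set.Icc (-R) R,
    (m ξ : ℂ) * Complex.exp (Complex.I * ((p.2 * ξ + p.1 * φ ξ : ℝ) : ℂ)) * fourierHat f ξ

/-- `u(t, x) = (1/2π) ∫_ℝ m(ξ) e^{ixξ + itφ(ξ)} f̂(ξ) dξ`, where the integral over `ℝ` is the limit
in `L⁶(ℝ²)` of the integrals over `|ξ| ≤ R` as `R → ∞`. Such a `u` is unique up to null sets. -/
def IsExtension (m φ : ℝ → ℝ) (f : L2R) (u : ℝ × ℝ → ℂ) : Prop :=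
  MemLp u 6 volume ∧
    Tendsto (fun R : ℝ => eLpNorm (fun p => truncExtension m φ f R p - u p) 6 volume)
      atTop (𝓝 0)

open scoped Classical in
/-- The extension operator with weight `m` and phase `φ`, as a function of `p = (t, x)`. -/
def extension (m φ : ℝ → ℝ) (f : L2R) : ℝ × ℝ → ℂ :=
  if h : ∃ u, IsExtension m φ f u then h.choose else 0

/-- The weight `1` of the Schrödinger propagator. -/
def schrodingerWeight (_ : ℝ) : ℝ := 1

/-- The phase of `e^{itΔ}`, the propagator of `i v_t + Δ v = 0`: `Δ` has symbol `-ξ²`. -/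
def schrodingerPhase (ξ : ℝ) : ℝ := -ξ ^ 2

/-- `(t, x) ↦ e^{itΔ} f (x)`. -/
def schrodinger (f : L2R) : ℝ × ℝ → ℂ :=
  extension schrodingerWeight schrodingerPhase f

/-- The weight `|ξ + ξ³|^{1/6}`. -/
def weight35 (ξ : ℝ) : ℝ := |ξ + ξ ^ 3| ^ (1 / 6 : ℝ)

/-- The phase `ξ³ + ξ⁵`. -/
def phase35 (ξ : ℝ) : ℝ := ξ ^ 3 + ξ ^ 5

/-- `Ẽ₅ f (t, x) = (1/2π) ∫ |ξ + ξ³|^{1/6} e^{ixξ + it(ξ³ + ξ⁵)} f̂(ξ) dξ`. -/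
def extension35 (f : L2R) : ℝ × ℝ → ℂ :=
  extension weight35 phase35 f

/-- The `L⁶` norm over `(t, x) ∈ ℝ²`. -/
def normL6 (u : ℝ × ℝ → ℂ) : ℝ := (eLpNorm u 6 volume).toReal

theorem memLp_modulate (N : ℝ) (g : L2R) :
    MemLp (fun x : ℝ => Complex.exp (Complex.I * ((x * N : ℝ) : ℂ)) * g x) 2 volume := by
  refine (Lp.memLp g).of_le ?_ (Eventually.of_forall fun x => ?_)
  · exact (Continuous.aestronglyMeasurable (by fun_prop)).mul (Lp.aestronglyMeasurable g)
  · rw [norm_mul, mul_comm Complex.I, Complex.norm_exp_ofReal_mul_I, one_mul]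

/-- `x ↦ e^{ixN} g(x)` as an element of `L²(ℝ)`. -/
def modulate (N : ℝ) (g : L2R) : L2R := (memLp_modulate N g).toLp _

/-- `g̃_N(x) = e^{ixN} g₁(x) + e^{-ixN} g₂(x)`. -/
def twoProfile (g₁ g₂ : L2R) (N : ℝ) : L2R := modulate N g₁ + modulate (-N) g₂

end

/-!
The cube of `∫ a(ξ) e^{ixξ + itφ(ξ)} dξ` is an oscillatory integral over `ℝ³`. Fixing the sum of the
three frequencies, taking polar coordinates around the diagonal and the phase as radial variable,
Plancherel in `(t, x)` bounds its `L²` norm; the Jacobian is controlled by the curvature of `φ`.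
This gives the `L² → L⁶` bounds for both extension operators.

Near the frequency `±N` the phase `ξ³ + ξ⁵` is, after a Galilean boost, `±ξ²` up to an error that
vanishes as `N → ∞`. In the boosted frame, with the amplitude divided by `√N`, `Ẽ₅ g̃_N` is thus
asymptotic in `L⁶` to `e^{iω} A + e^{-iω} B`, where `A` and `B` are the forward evolution of `g₁`
and the backward evolution of `g₂`, and `ω` is linear with coefficients tending to infinity. Expand
the cube of this sum: its terms are asymptotically orthogonal by Riemann–Lebesgue, so the sixth
power of the norm tends to `∫ |A|⁶ + 9 |A|⁴|B|² + 9 |A|²|B|⁴ + |B|⁶`. Hölder's inequality and an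
inequality for cubes conclude, with equality exactly when `|A| = |B|` almost everywhere.
-/

open scoped SchwartzMap ContDiff NNReal

noncomputable section

local notation "cis(" x ")" => Complex.exp (Complex.I * ((x : ℝ) : ℂ))

theorem norm_cis (x : ℝ) : ‖cis(x)‖ = 1 := by
  rw [mul_comm, Complex.norm_exp_ofReal_mul_I]

theorem cis_add (x y : ℝ) : cis(x + y) = cis(x) * cis(y) := by
  rw [← Complex.exp_add, ← mul_add, Complex.ofReal_add]

theorem integrable_mul_cis {α : Type*} [MeasurableSpace α] {μ : Measure α} {a : α → ℂ}
    (ha : Integrable a μ) {τ : α → ℝ} (hτ : Measurable τ) :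
    Integrable (fun x => a x * cis(τ x)) μ :=
  ha.mul_bdd (by fun_prop) (Eventually.of_forall fun x => (norm_cis (τ x)).le)

section LpNorm

variable {α E : Type*} [MeasurableSpace α] {μ : Measure α} [NormedAddCommGroup E]

theorem eLpNorm_natCast_pow (f : α → E) {n : ℕ} (hn : n ≠ 0) :
    eLpNorm f (n : ℝ≥0∞) μ ^ n = ∫⁻ x, ‖f x‖ₑ ^ n ∂μ := by
  have h := eLpNorm_nnreal_pow_eq_lintegral (f := f) (μ := μ) (p := (n : NNReal))
    (Nat.cast_ne_zero.2 hn)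
  simpa only [NNReal.coe_natCast, ENNReal.rpow_natCast, ENNReal.coe_natCast] using h

theorem eLpNorm_two_sq (f : α → E) : eLpNorm f 2 μ ^ 2 = ∫⁻ x, ‖f x‖ₑ ^ 2 ∂μ :=
  eLpNorm_natCast_pow f two_ne_zero

theorem eLpNorm_six_pow (f : α → E) : eLpNorm f 6 μ ^ 6 = ∫⁻ x, ‖f x‖ₑ ^ 6 ∂μ :=
  eLpNorm_natCast_pow f (by norm_num)

theorem tendsto_eLpNorm_zero_of_lintegral {ι : Type*} {l : Filter ι} {f : ι → α → E} {n : ℕ}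
    (hn : n ≠ 0) (h : Tendsto (fun i => ∫⁻ x, ‖f i x‖ₑ ^ n ∂μ) l (𝓝 0)) :
    Tendsto (fun i => eLpNorm (f i) n μ) l (𝓝 0) := by
  have hroot : ∀ i, (∫⁻ x, ‖f i x‖ₑ ^ n ∂μ) ^ (n⁻¹ : ℝ) = eLpNorm (f i) n μ := fun i => by
    rw [← eLpNorm_natCast_pow _ hn, ← ENNReal.rpow_natCast,
      ENNReal.rpow_rpow_inv (Nat.cast_ne_zero.2 hn)]
  have hpos : (0 : ℝ) < (n : ℝ)⁻¹ := by positivity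
  simpa only [hroot, ENNReal.zero_rpow_of_pos hpos] using h.ennrpow_const (n : ℝ)⁻¹

end LpNorm

theorem lintegral_comp_mul_left_real {c : ℝ} (hc : c ≠ 0) (f : ℝ → ℝ≥0∞) :
    ∫⁻ x, f (c * x) = ENNReal.ofReal |c⁻¹| * ∫⁻ x, f x := by
  have h := lintegral_map_equiv (μ := (volume : Measure ℝ)) f (MeasurableEquiv.mulLeft₀ c hc)
  rw [MeasurableEquiv.coe_mulLeft₀, Real.map_volume_mul_left hc, lintegral_smul_measure] at h
  simpa using h.symm

theorem integral_schwartz_smul_fourier_L2 (f : L2R) (ψ : 𝓢(ℝ, ℂ)) :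
    ∫ x, ψ x • (𝓕 f : L2R) x = ∫ x, (𝓕 ψ) x • f x := by
  have h := congrArg (fun T => T ψ) (Lp.fourier_toTemperedDistribution_eq f)
  simp only [TemperedDistribution.fourier_apply, Lp.toTemperedDistribution_apply] at h
  exact h.symm

theorem ae_eq_of_integral_schwartz_smul_eq {f g : ℝ → ℂ} (hf : LocallyIntegrable f)
    (hg : LocallyIntegrable g) (h : ∀ ψ : 𝓢(ℝ, ℂ), ∫ x, ψ x • f x = ∫ x, ψ x • g x) :
    f =ᵐ[volume] g := by
  refine ae_eq_of_integral_contDiff_smul_eq hf hg fun χ hχ hχs => ?_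
  have hs : HasCompactSupport (fun x => (χ x : ℂ)) := hχs.comp_left Complex.ofReal_zero
  have hd : ContDiff ℝ (⊤ : ℕ∞) (fun x => (χ x : ℂ)) := Complex.ofRealCLM.contDiff.comp hχ
  simpa using h (hs.toSchwartzMap hd)

theorem fourier_toLp_ae_eq {h : ℝ → ℂ} (h₁ : Integrable h) (h₂ : MemLp h 2) :
    ((𝓕 (h₂.toLp h) : L2R) : ℝ → ℂ) =ᵐ[volume] 𝓕 h := by
  refine ae_eq_of_integral_schwartz_smul_eq
    ((Lp.memLp (𝓕 (h₂.toLp h) : L2R)).locallyIntegrable (by norm_num))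
    (VectorFourier.fourierIntegral_continuous Real.continuous_fourierChar continuous_inner
      h₁).locallyIntegrable fun ψ => ?_
  have hcoe : ∫ x, (𝓕 ψ) x • (h₂.toLp h) x = ∫ x, (𝓕 ψ) x • h x :=
    integral_congr_ae (h₂.coeFn_toLp.mono fun x hx => by simp only [hx])
  rw [integral_schwartz_smul_fourier_L2, hcoe, SchwartzMap.fourier_coe]
  simpa using! VectorFourier.integral_fourierIntegral_smul_eq_flip (L := innerₗ ℝ)
    (μ := volume) (ν := volume) Real.continuous_fourierChar continuous_inner ψ.integrable h₁

theorem eLpNorm_fourier_le {h : ℝ → ℂ} (h₁ : Integrable h) :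
    eLpNorm (𝓕 h) 2 volume ≤ eLpNorm h 2 volume := by
  by_cases h₂ : MemLp h 2
  · have hnorm : ‖(𝓕 (h₂.toLp h) : L2R)‖ = ‖h₂.toLp h‖ := Lp.norm_fourier_eq _
    rw [← eLpNorm_congr_ae (fourier_toLp_ae_eq h₁ h₂), ← Lp.enorm_def, ← ofReal_norm, hnorm,
      ofReal_norm, Lp.enorm_toLp]
  · have htop : eLpNorm h 2 volume = ⊤ := by
      by_contra hne
      exact h₂ ⟨h₁.1, lt_top_iff_ne_top.2 hne⟩
    exact htop ▸ le_top

theorem lintegral_enorm_sq_integral_mul_cis_le {a : ℝ → ℂ} (ha : Integrable a) :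
    ∫⁻ x, ‖∫ ξ, a ξ * cis(x * ξ)‖ₑ ^ 2
      ≤ ENNReal.ofReal (2 * Real.pi) * ∫⁻ ξ, ‖a ξ‖ₑ ^ 2 := by
  have hfourier : ∀ x : ℝ, ∫ ξ, a ξ * cis(x * ξ) = 𝓕 a (-(2 * Real.pi)⁻¹ * x) := fun x => by
    rw [Real.fourier_real_eq_integral_exp_smul]
    refine integral_congr_ae (Eventually.of_forall fun ξ => ?_)
    have hpi : (Real.pi : ℂ) ≠ 0 := Complex.ofReal_ne_zero.2 Real.pi_ne_zero
    simp only [smul_eq_mul]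
    rw [mul_comm]
    congr 2
    push_cast
    field_simp
  simp_rw [hfourier]
  rw [lintegral_comp_mul_left_real (neg_ne_zero.2 (inv_ne_zero Real.two_pi_pos.ne'))
    (fun w => ‖𝓕 a w‖ₑ ^ 2), inv_neg, inv_inv, abs_neg, abs_of_pos Real.two_pi_pos,
    ← eLpNorm_two_sq, ← eLpNorm_two_sq]
  gcongr
  exact eLpNorm_fourier_le ha

theorem fourier_schwartz_comp_add_const (ψ : 𝓢(ℝ, ℂ)) (c x : ℝ) :
    (𝓕 (ψ.compSubConstCLM ℂ (-c))) x = cis(2 * Real.pi * (x * c)) * (𝓕 ψ) x := by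
  have hcoe : ⇑(ψ.compSubConstCLM ℂ (-c)) = ψ ∘ fun v => v + c := by
    ext v; simp
  rw [SchwartzMap.fourier_coe, SchwartzMap.fourier_coe, hcoe]
  refine (congrFun (VectorFourier.fourierIntegral_comp_add_right 𝐞 volume (innerₗ ℝ) ψ c) x).trans
    ?_
  rw [Circle.smul_def, Real.fourierChar_apply, smul_eq_mul, innerₗ_apply_apply, mul_comm Complex.I]
  congr 4

theorem fourier_modulate_ae_eq (N : ℝ) (g : L2R) :
    ((𝓕 (modulate N g) : L2R) : ℝ → ℂ) =ᵐ[volume]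
      fun ξ => (𝓕 g : L2R) (ξ - N / (2 * Real.pi)) := by
  set c := N / (2 * Real.pi) with hc
  have hshift : MemLp (fun ξ => (𝓕 g : L2R) (ξ - c)) 2 volume :=
    (Lp.memLp (𝓕 g : L2R)).comp_measurePreserving (measurePreserving_sub_right volume c)
  refine ae_eq_of_integral_schwartz_smul_eq
    ((Lp.memLp (𝓕 (modulate N g) : L2R)).locallyIntegrable (by norm_num))
    (hshift.locallyIntegrable (by norm_num)) fun ψ => ?_
  have htransfer : ∀ᵐ x, (𝓕 ψ) x • (modulate N g) x
      = (𝓕 (ψ.compSubConstCLM ℂ (-c))) x • g x := by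
    filter_upwards [(memLp_modulate N g).coeFn_toLp] with x hx
    have hphase : 2 * Real.pi * (x * c) = x * N := by
      rw [hc]; field_simp [Real.pi_ne_zero]
    rw [modulate, hx, fourier_schwartz_comp_add_const, hphase, smul_eq_mul, smul_eq_mul]
    ring
  rw [integral_schwartz_smul_fourier_L2, integral_congr_ae htransfer,
    ← integral_schwartz_smul_fourier_L2, ← integral_sub_right_eq_self _ c]
  simp

theorem quasiMeasurePreserving_div_two_pi :
    Measure.QuasiMeasurePreserving (fun ξ : ℝ => ξ / (2 * Real.pi)) volume volume := by
  refine ⟨by fun_prop, ?_⟩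
  simp only [div_eq_mul_inv]
  rw [Real.map_volume_mul_right (inv_ne_zero Real.two_pi_pos.ne')]
  exact Measure.smul_absolutelyContinuous

theorem measurable_fourierHat (f : L2R) : Measurable (fourierHat f) :=
  (Lp.stronglyMeasurable (𝓕 f : L2R)).measurable.comp (measurable_id.div_const _)

theorem memLp_fourierHat (f : L2R) : MemLp (fourierHat f) 2 volume := by
  refine ⟨(measurable_fourierHat f).aestronglyMeasurable, ?_⟩
  have hsq : eLpNorm (fourierHat f) 2 volume ^ 2 < ⊤ := by
    simp only [eLpNorm_two_sq, fourierHat, div_eq_inv_mul]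
    rw [lintegral_comp_mul_left_real (inv_ne_zero Real.two_pi_pos.ne')
      (fun w => ‖(𝓕 f : L2R) w‖ₑ ^ 2), ← eLpNorm_two_sq]
    exact ENNReal.mul_lt_top ENNReal.ofReal_lt_top (ENNReal.pow_lt_top (Lp.memLp (𝓕 f : L2R)).2)
  exact (ENNReal.pow_lt_top_iff.1 hsq).resolve_right two_ne_zero

theorem fourierHat_modulate_ae_eq (N : ℝ) (g : L2R) :
    fourierHat (modulate N g) =ᵐ[volume] fun ξ => fourierHat g (ξ - N) := by
  filter_upwards [quasiMeasurePreserving_div_two_pi.ae (fourier_modulate_ae_eq N g)] with ξ hξ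
  simp only [fourierHat, hξ, sub_div]

theorem fourierHat_add_ae_eq (f g : L2R) :
    fourierHat (f + g) =ᵐ[volume] fun ξ => fourierHat f ξ + fourierHat g ξ := by
  have hadd : ((𝓕 (f + g) : L2R) : ℝ → ℂ) =ᵐ[volume] (𝓕 f : L2R) + (𝓕 g : L2R) := by
    rw [FourierTransform.fourier_add]
    exact Lp.coeFn_add _ _
  filter_upwards [quasiMeasurePreserving_div_two_pi.ae hadd] with ξ hξ
  exact hξ

section MonotonePhase

theorem injOn_of_hasDerivAt_ne_zero {J : Set ℝ} (hJ : J.OrdConnected) {τ τ' : ℝ → ℝ}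
    (hτ : ∀ r ∈ J, HasDerivAt τ (τ' r) r) (hne : ∀ r ∈ J, τ' r ≠ 0) : Set.InjOn τ J := by
  have hlt : ∀ a ∈ J, ∀ b ∈ J, a < b → τ a ≠ τ b := fun a ha b hb hab heq => by
    have hsub : Set.Icc a b ⊆ J := hJ.out ha hb
    obtain ⟨c, hc, hc0⟩ := exists_hasDerivAt_eq_zero hab
      (fun r hr => (hτ r (hsub hr)).continuousAt.continuousWithinAt) heq
      fun r hr => hτ r (hsub (Set.Ioo_subset_Icc_self hr))
    exact hne c (hsub (Set.Ioo_subset_Icc_self hc)) hc0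
  intro a ha b hb heq
  rcases lt_trichotomy a b with hab | hab | hab
  · exact absurd heq (hlt a ha b hb hab)
  · exact hab
  · exact absurd heq.symm (hlt b hb a ha hab)

variable {J : Set ℝ} {τ τ' : ℝ → ℝ} {h : ℝ → ℂ}

theorem exists_abs_deriv_smul_comp_eq (hinj : Set.InjOn τ J) (hne : ∀ r ∈ J, τ' r ≠ 0)
    (h : ℝ → ℂ) : ∃ k : ℝ → ℂ, ∀ r ∈ J, |τ' r| • k (τ r) = h r := by
  refine ⟨fun w => |τ' (Function.invFunOn τ J w)|⁻¹ • h (Function.invFunOn τ J w),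
    fun r hr => ?_⟩
  simp only [show Function.invFunOn τ J (τ r) = r from hinj.leftInvOn_invFunOn hr]
  exact smul_inv_smul₀ (abs_ne_zero.2 (hne r hr)) _

theorem exists_integrable_integral_cis_comp (hJ : MeasurableSet J)
    (hτ : ∀ r ∈ J, HasDerivAt τ (τ' r) r) (hinj : Set.InjOn τ J) (hne : ∀ r ∈ J, τ' r ≠ 0)
    (hh : IntegrableOn h J) :
    ∃ g : ℝ → ℂ, Integrable g ∧ (∀ t, ∫ r in J, h r * cis(t * τ r) = ∫ w, g w * cis(t * w)) ∧
      ∫⁻ w, ‖g w‖ₑ ^ 2 = ∫⁻ r in J, ‖h r‖ₑ ^ 2 / ENNReal.ofReal |τ' r| := by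
  obtain ⟨k, hk⟩ := exists_abs_deriv_smul_comp_eq hinj hne h
  have hder : ∀ r ∈ J, HasDerivWithinAt τ (τ' r) J r := fun r hr => (hτ r hr).hasDerivWithinAt
  have himg : MeasurableSet (τ '' J) :=
    hJ.image_of_continuousOn_injOn (fun r hr => (hder r hr).continuousWithinAt) hinj
  refine ⟨(τ '' J).indicator k, (integrable_indicator_iff himg).2 ?_, fun t => ?_, ?_⟩
  · rw [integrableOn_image_iff_integrableOn_abs_deriv_smul hJ hder hinj]
    exact hh.congr_fun (fun r hr => (hk r hr).symm) hJ
  · simp_rw [← Set.indicator_mul_left (τ '' J) k fun w => cis(t * w)]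
    rw [integral_indicator himg, integral_image_eq_integral_abs_deriv_smul hJ hder hinj]
    refine setIntegral_congr_fun hJ fun r hr => ?_
    rw [← smul_mul_assoc, hk r hr]
  · have hsq : (fun w => ‖(τ '' J).indicator k w‖ₑ ^ 2)
        = (τ '' J).indicator fun w => ‖k w‖ₑ ^ 2 := by
      ext w; by_cases hw : w ∈ τ '' J <;> simp [hw]
    rw [hsq, lintegral_indicator himg, lintegral_image_eq_lintegral_abs_deriv_mul hJ hder hinj]
    refine setLIntegral_congr_fun hJ fun r hr => ?_
    have hpos : ENNReal.ofReal |τ' r| ≠ 0 := by simpa using hne r hr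
    rw [← hk r hr, enorm_smul, Real.enorm_eq_ofReal (abs_nonneg _),
      ENNReal.eq_div_iff hpos ENNReal.ofReal_ne_top]
    ring

theorem lintegral_enorm_sq_integral_cis_comp_le (hJ : MeasurableSet J) (hJc : J.OrdConnected)
    (hτ : ∀ r ∈ J, HasDerivAt τ (τ' r) r) (hne : ∀ r ∈ J, τ' r ≠ 0) (hh : IntegrableOn h J) :
    ∫⁻ t, ‖∫ r in J, h r * cis(t * τ r)‖ₑ ^ 2
      ≤ ENNReal.ofReal (2 * Real.pi) * ∫⁻ r in J, ‖h r‖ₑ ^ 2 / ENNReal.ofReal |τ' r| := by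
  obtain ⟨g, hg, hcomp, hsq⟩ :=
    exists_integrable_integral_cis_comp hJ hτ (injOn_of_hasDerivAt_ne_zero hJc hτ hne) hne hh
  simp_rw [hcomp, ← hsq]
  exact lintegral_enorm_sq_integral_mul_cis_le hg

end MonotonePhase

theorem enorm_integral_sq_le {α : Type*} [MeasurableSpace α] {μ : Measure α} (f : α → ℂ) :
    ‖∫ x, f x ∂μ‖ₑ ^ 2 ≤ μ Set.univ * ∫⁻ x, ‖f x‖ₑ ^ 2 ∂μ := by
  by_cases hf : AEStronglyMeasurable f μ
  · calc ‖∫ x, f x ∂μ‖ₑ ^ 2 ≤ (eLpNorm f 2 μ * μ Set.univ ^ (1 / 2 : ℝ)) ^ 2 := by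
          gcongr
          refine (enorm_integral_le_lintegral_enorm f).trans ?_
          rw [← eLpNorm_one_eq_lintegral_enorm]
          refine (eLpNorm_le_eLpNorm_mul_rpow_measure_univ one_le_two hf).trans_eq ?_
          norm_num
      _ = μ Set.univ * ∫⁻ x, ‖f x‖ₑ ^ 2 ∂μ := by
          rw [mul_pow, eLpNorm_two_sq, ← ENNReal.rpow_natCast, ← ENNReal.rpow_mul, mul_comm]
          norm_num
  · rw [integral_undef fun h => hf h.1]
    simp

section Polar

theorem volume_restrict_polarCoord_target :
    (volume : Measure (ℝ × ℝ)).restrict polarCoord.target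
      = (volume.restrict (Set.Ioi 0)).prod (volume.restrict (Set.Ioo (-Real.pi) Real.pi)) := by
  rw [Measure.prod_restrict]; rfl

theorem lintegral_eq_lintegral_polarCoord {f : ℝ × ℝ → ℝ≥0∞} (hf : Measurable f) :
    ∫⁻ y, f y = ∫⁻ α in Set.Ioo (-Real.pi) Real.pi, ∫⁻ r in Set.Ioi 0,
      ENNReal.ofReal r * f (polarCoord.symm (r, α)) := by
  rw [← lintegral_comp_polarCoord_symm, volume_restrict_polarCoord_target, lintegral_prod_symm]
  · rfl
  · simp only [polarCoord_symm_apply]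
    exact Measurable.aemeasurable (by fun_prop)

theorem integrable_polarCoord {f : ℝ × ℝ → ℂ} (hf : Measurable f) (hfi : Integrable f) :
    Integrable (fun z : ℝ × ℝ => z.1 • f (polarCoord.symm z))
      ((volume.restrict (Set.Ioi 0)).prod (volume.restrict (Set.Ioo (-Real.pi) Real.pi))) := by
  rw [← volume_restrict_polarCoord_target]
  refine ⟨?_, ?_⟩
  · simp only [polarCoord_symm_apply]
    exact Measurable.aestronglyMeasurable (by fun_prop)
  · refine lt_of_eq_of_lt ?_ hfi.2
    rw [← lintegral_comp_polarCoord_symm]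
    refine setLIntegral_congr_fun polarCoord.open_target.measurableSet fun z hz => ?_
    rw [enorm_smul, Real.enorm_eq_ofReal hz.1.le, smul_eq_mul]

theorem integral_eq_integral_polarCoord {f : ℝ × ℝ → ℂ} (hf : Measurable f) (hfi : Integrable f) :
    ∫ y, f y = ∫ α in Set.Ioo (-Real.pi) Real.pi, ∫ r in Set.Ioi 0,
      r • f (polarCoord.symm (r, α)) := by
  rw [← integral_comp_polarCoord_symm, volume_restrict_polarCoord_target,
    integral_prod_symm _ (integrable_polarCoord hf hfi)]

variable {S : Set (ℝ × ℝ)} {Θ D : ℝ × ℝ → ℝ} {h : ℝ × ℝ → ℂ}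

theorem polarCoord_symm_eq_smul (r α : ℝ) :
    polarCoord.symm (r, α) = r • (Real.cos α, Real.sin α) := rfl

theorem hasDerivAt_comp_polarCoord (hΘ : ∀ y ∈ S, HasDerivAt (fun r : ℝ => Θ (r • y)) (D y) 1)
    {r α : ℝ} (hr : 0 < r) (hS : polarCoord.symm (r, α) ∈ S) :
    HasDerivAt (fun ρ => Θ (polarCoord.symm (ρ, α))) (D (polarCoord.symm (r, α)) / r) r := by
  have hscale : HasDerivAt (fun ρ : ℝ => ρ / r) r⁻¹ r := by
    simpa using (hasDerivAt_id r).div_const r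
  have hcomp := HasDerivAt.comp r (h₂ := fun ρ : ℝ => Θ (ρ • polarCoord.symm (r, α)))
    (by rw [div_self hr.ne']; exact hΘ _ hS) hscale
  rw [← div_eq_mul_inv] at hcomp
  refine hcomp.congr_of_eventuallyEq (Eventually.of_forall fun ρ => ?_)
  change Θ (polarCoord.symm (ρ, α)) = Θ ((ρ / r) • polarCoord.symm (r, α))
  rw [polarCoord_symm_eq_smul, polarCoord_symm_eq_smul, smul_smul,
    div_mul_cancel₀ _ hr.ne']

theorem ordConnected_polarCoord_ray (hS : Convex ℝ S) (α : ℝ) :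
    (Set.Ioi 0 ∩ {r : ℝ | polarCoord.symm (r, α) ∈ S}).OrdConnected :=
  Set.ordConnected_Ioi.inter
    (hS.linear_preimage
      (LinearMap.toSpanSingleton ℝ (ℝ × ℝ) (Real.cos α, Real.sin α))).ordConnected

theorem polarCoord_symm_ne_zero {r : ℝ} (hr : r ≠ 0) (α : ℝ) : polarCoord.symm (r, α) ≠ 0 := by
  rw [polarCoord_symm_eq_smul, smul_ne_zero_iff]
  refine ⟨hr, fun h0 => ?_⟩
  have hcos : Real.cos α = 0 := congrArg Prod.fst h0
  have hsin : Real.sin α = 0 := congrArg Prod.snd h0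
  simpa [hcos, hsin] using Real.sin_sq_add_cos_sq α

theorem lintegral_enorm_sq_integral_ray_le (hSm : MeasurableSet S) (hS : Convex ℝ S)
    (hΘ : ∀ y ∈ S, HasDerivAt (fun r : ℝ => Θ (r • y)) (D y) 1) (hD : ∀ y ∈ S, y ≠ 0 → D y ≠ 0)
    (hsupp : Function.support h ⊆ S) {α : ℝ}
    (hh : IntegrableOn (fun r : ℝ => r • h (polarCoord.symm (r, α))) (Set.Ioi 0)) :
    ∫⁻ t, ‖∫ r in Set.Ioi 0, r • (h (polarCoord.symm (r, α)) *
        cis(t * Θ (polarCoord.symm (r, α))))‖ₑ ^ 2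
      ≤ ENNReal.ofReal (2 * Real.pi) * ∫⁻ r in Set.Ioi 0, ENNReal.ofReal r *
        (‖h (polarCoord.symm (r, α))‖ₑ ^ 2 * ENNReal.ofReal (r ^ 2 /
          |D (polarCoord.symm (r, α))|)) := by
  set J : Set ℝ := Set.Ioi 0 ∩ {r | polarCoord.symm (r, α) ∈ S}
  have hJ : MeasurableSet J := measurableSet_Ioi.inter
    (hSm.preimage (by simp only [polarCoord_symm_apply]; fun_prop))
  have hDne : ∀ r ∈ J, D (polarCoord.symm (r, α)) / r ≠ 0 := fun r hr => by
    have hr0 : r ≠ 0 := ne_of_gt hr.1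
    exact div_ne_zero (hD _ hr.2 (polarCoord_symm_ne_zero hr0 α)) hr0
  have hrestrict : ∀ t, ∫ r in Set.Ioi 0, r • (h (polarCoord.symm (r, α)) *
        cis(t * Θ (polarCoord.symm (r, α))))
      = ∫ r in J, r • h (polarCoord.symm (r, α)) * cis(t * Θ (polarCoord.symm (r, α))) :=
      fun t => by
    simp only [← smul_mul_assoc]
    refine setIntegral_eq_of_subset_of_forall_sdiff_eq_zero measurableSet_Ioi
      Set.inter_subset_left fun r hr => ?_
    have hvanish : h (polarCoord.symm (r, α)) = 0 := by_contra fun h0 => hr.2 ⟨hr.1, hsupp h0⟩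
    rw [hvanish, smul_zero, zero_mul]
  simp_rw [hrestrict]
  refine (lintegral_enorm_sq_integral_cis_comp_le hJ (ordConnected_polarCoord_ray hS α)
    (fun r hr => hasDerivAt_comp_polarCoord hΘ hr.1 hr.2) hDne
    (hh.mono_set Set.inter_subset_left)).trans ?_
  gcongr ENNReal.ofReal _ * ?_
  refine le_trans (setLIntegral_mono' hJ fun r hr => ?_) (lintegral_mono_set Set.inter_subset_left)
  have hr0 : (0 : ℝ) < r := hr.1
  rw [ENNReal.div_eq_inv_mul, ← ENNReal.ofReal_inv_of_pos (abs_pos.2 (hDne r hr)), enorm_smul,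
    mul_pow, Real.enorm_eq_ofReal hr0.le, abs_div, abs_of_pos hr0, inv_div, div_eq_mul_inv,
    div_eq_mul_inv, ENNReal.ofReal_mul hr0.le, ENNReal.ofReal_mul (sq_nonneg r),
    ENNReal.ofReal_pow hr0.le]
  exact le_of_eq (by ring)

end Polar

section Radial

variable {S : Set (ℝ × ℝ)} {Θ D : ℝ × ℝ → ℝ} {h : ℝ × ℝ → ℂ}

theorem measurable_integral_ray (hΘ : Measurable Θ) (hh : Measurable h) :
    Measurable fun z : ℝ × ℝ => ∫ r in Set.Ioi 0, r • (h (polarCoord.symm (r, z.2)) *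
      cis(z.1 * Θ (polarCoord.symm (r, z.2)))) := by
  refine (StronglyMeasurable.integral_prod_right (f := fun (z : ℝ × ℝ) (r : ℝ) =>
    r • (h (polarCoord.symm (r, z.2)) * cis(z.1 * Θ (polarCoord.symm (r, z.2))))) ?_).measurable
  simp only [polarCoord_symm_apply]
  exact Measurable.stronglyMeasurable (by fun_prop)

theorem polarCoord_symm_fst_sq_add_snd_sq (r α : ℝ) :
    (polarCoord.symm (r, α)).1 ^ 2 + (polarCoord.symm (r, α)).2 ^ 2 = r ^ 2 := by
  rw [polarCoord_symm_apply]
  linear_combination r ^ 2 * Real.sin_sq_add_cos_sq α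

theorem lintegral_enorm_sq_integral_radial_le (hSm : MeasurableSet S) (hS : Convex ℝ S)
    (hΘm : Measurable Θ) (hΘ : ∀ y ∈ S, HasDerivAt (fun r : ℝ => Θ (r • y)) (D y) 1)
    (hDm : Measurable D) (hD : ∀ y ∈ S, y ≠ 0 → D y ≠ 0)
    (hsupp : Function.support h ⊆ S) (hhm : Measurable h) (hh : Integrable h) :
    ∫⁻ t, ‖∫ y, h y * cis(t * Θ y)‖ₑ ^ 2
      ≤ ENNReal.ofReal (2 * Real.pi) ^ 2 *
        ∫⁻ y, ‖h y‖ₑ ^ 2 * ENNReal.ofReal ((y.1 ^ 2 + y.2 ^ 2) / |D y|) := by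
  set A : Set ℝ := Set.Ioo (-Real.pi) Real.pi with hA
  set ray : ℝ → ℝ → ℂ := fun t α => ∫ r in Set.Ioi 0, r • (h (polarCoord.symm (r, α)) *
    cis(t * Θ (polarCoord.symm (r, α))))
  have hpolar : ∀ t, ∫ y, h y * cis(t * Θ y) = ∫ α in A, ray t α := fun t =>
    integral_eq_integral_polarCoord (by fun_prop) (integrable_mul_cis hh (by fun_prop))
  have hvol : (volume.restrict A) Set.univ = ENNReal.ofReal (2 * Real.pi) := by
    rw [Measure.restrict_apply_univ, hA, Real.volume_Ioo]
    ring_nf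
  have hrays : ∀ᵐ α ∂volume.restrict A, ∫⁻ t, ‖ray t α‖ₑ ^ 2 ≤ ENNReal.ofReal (2 * Real.pi) *
      ∫⁻ r in Set.Ioi 0, ENNReal.ofReal r * (‖h (polarCoord.symm (r, α))‖ₑ ^ 2 *
        ENNReal.ofReal (r ^ 2 / |D (polarCoord.symm (r, α))|)) :=
    (integrable_polarCoord hhm hh).prod_left_ae.mono fun α hα =>
      lintegral_enorm_sq_integral_ray_le hSm hS hΘ hD hsupp hα
  calc ∫⁻ t, ‖∫ y, h y * cis(t * Θ y)‖ₑ ^ 2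
      ≤ ∫⁻ t, ENNReal.ofReal (2 * Real.pi) * ∫⁻ α in A, ‖ray t α‖ₑ ^ 2 := by
        refine lintegral_mono fun t => ?_
        rw [hpolar, ← hvol]
        exact enorm_integral_sq_le _
    _ = ENNReal.ofReal (2 * Real.pi) * ∫⁻ α in A, ∫⁻ t, ‖ray t α‖ₑ ^ 2 := by
        rw [lintegral_const_mul' _ _ ENNReal.ofReal_ne_top, lintegral_lintegral_swap]
        exact ((measurable_integral_ray hΘm hhm).enorm.pow_const 2).aemeasurable
    _ ≤ ENNReal.ofReal (2 * Real.pi) * (ENNReal.ofReal (2 * Real.pi) *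
          ∫⁻ y, ‖h y‖ₑ ^ 2 * ENNReal.ofReal ((y.1 ^ 2 + y.2 ^ 2) / |D y|)) := by
        gcongr ENNReal.ofReal _ * ?_
        refine (lintegral_mono_ae hrays).trans_eq ?_
        rw [lintegral_const_mul' _ _ ENNReal.ofReal_ne_top,
          lintegral_eq_lintegral_polarCoord (by fun_prop)]
        simp_rw [polarCoord_symm_fst_sq_add_snd_sq, hA]
    _ = _ := by rw [← mul_assoc, sq]

end Radial

section FirstVariable

variable {β : Type*} [MeasurableSpace β] {ν : Measure β} [SFinite ν]

theorem lintegral_enorm_sq_integral_prod_le {Θ : ℝ × β → ℝ} (hΘ : Measurable Θ) {h : ℝ × β → ℂ}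
    (hhm : Measurable h) (hh : Integrable h ((volume : Measure ℝ).prod ν)) :
    ∫⁻ p : ℝ × ℝ, ‖∫ z, h z * cis(p.2 * z.1 + p.1 * Θ z) ∂(volume : Measure ℝ).prod ν‖ₑ ^ 2
      ≤ ENNReal.ofReal (2 * Real.pi) *
        ∫⁻ s, ∫⁻ t, ‖∫ b, h (s, b) * cis(t * Θ (s, b)) ∂ν‖ₑ ^ 2 := by
  set fib : ℝ → ℝ → ℂ := fun t s => ∫ b, h (s, b) * cis(t * Θ (s, b)) ∂ν
  have hfibm : Measurable (Function.uncurry fib) :=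
    (StronglyMeasurable.integral_prod_right (f := fun (w : ℝ × ℝ) (b : β) =>
      h (w.2, b) * cis(w.1 * Θ (w.2, b))) (Measurable.stronglyMeasurable (by fun_prop))).measurable
  have hfint : ∀ t, Integrable (fun z => h z * cis(t * Θ z)) ((volume : Measure ℝ).prod ν) :=
    fun t => integrable_mul_cis hh (by fun_prop)
  have hfubini : ∀ t x : ℝ, ∫ z, h z * cis(x * z.1 + t * Θ z) ∂(volume : Measure ℝ).prod ν
      = ∫ s, fib t s * cis(x * s) := fun t x => by
    rw [integral_prod _ (integrable_mul_cis hh (by fun_prop))]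
    refine integral_congr_ae (Eventually.of_forall fun s => ?_)
    simp only [fib, ← integral_mul_const, cis_add]
    exact integral_congr_ae (Eventually.of_forall fun b => by ring)
  rw [Measure.volume_eq_prod, lintegral_prod]
  · calc _ ≤ ∫⁻ t, ENNReal.ofReal (2 * Real.pi) * ∫⁻ s, ‖fib t s‖ₑ ^ 2 := by
          refine lintegral_mono fun t => ?_
          simp only [hfubini]
          exact lintegral_enorm_sq_integral_mul_cis_le (hfint t).integral_prod_left
      _ = _ := by
          rw [lintegral_const_mul' _ _ ENNReal.ofReal_ne_top, lintegral_lintegral_swap]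
          exact (hfibm.enorm.pow_const 2).aemeasurable
  · simp only [hfubini]
    have hm := (StronglyMeasurable.integral_prod_right (ν := (volume : Measure ℝ))
      (f := fun (p : ℝ × ℝ) (s : ℝ) => fib p.1 s * cis(p.2 * s))
      (Measurable.stronglyMeasurable
        ((hfibm.comp (by fun_prop : Measurable fun q : (ℝ × ℝ) × ℝ => (q.1.1, q.2))).mul
          (by fun_prop)))).measurable
    exact (hm.enorm.pow_const 2).aemeasurable

end FirstVariable

section TripleCoordinates

/-- Coordinates on `ℝ³` adapted to the diagonal, as a function of `(s, (p, q))`: the three entries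
sum to `s`, and `p`, `q` are the deviations of the last two from the mean `s / 3`. -/
def sumMeanCoords : (ℝ × ℝ × ℝ) ≃ᵐ (ℝ × ℝ × ℝ) where
  toFun z := (z.1 / 3 - z.2.1 - z.2.2, z.1 / 3 + z.2.1, z.1 / 3 + z.2.2)
  invFun w := (w.1 + w.2.1 + w.2.2, w.2.1 - (w.1 + w.2.1 + w.2.2) / 3,
    w.2.2 - (w.1 + w.2.1 + w.2.2) / 3)
  left_inv z := by ext <;> simp only <;> ring
  right_inv w := by ext <;> simp only <;> ring
  measurable_toFun := by dsimp only [Equiv.coe_fn_mk]; fun_prop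
  measurable_invFun := by dsimp only [Equiv.coe_fn_symm_mk]; fun_prop

theorem sumMeanCoords_apply (s p q : ℝ) :
    sumMeanCoords (s, p, q) = (s / 3 - p - q, s / 3 + p, s / 3 + q) := rfl

theorem measurePreserving_sumMeanCoords : MeasurePreserving sumMeanCoords := by
  have hshift : MeasurePreserving
      (fun z : ℝ × ℝ × ℝ => (z.1, z.2 + (z.1 / 3, z.1 / 3))) := by
    refine (MeasurePreserving.id volume).skew_product (g := fun s v => v + (s / 3, s / 3))
      (by fun_prop) (Eventually.of_forall fun s => (measurePreserving_add_right _ _).map_eq)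
  have hshear : MeasurePreserving (fun v : (ℝ × ℝ) × ℝ => (v.1, v.2 + -(v.1.1 + v.1.2))) :=
    (MeasurePreserving.id volume).skew_product (g := fun (v : ℝ × ℝ) (s : ℝ) => s + -(v.1 + v.2))
      (by fun_prop) (Eventually.of_forall fun v => (measurePreserving_add_right _ _).map_eq)
  have hcomp := Measure.measurePreserving_swap.comp
    (hshear.comp ((Measure.measurePreserving_swap (μ := (volume : Measure ℝ))
      (ν := (volume : Measure (ℝ × ℝ)))).comp hshift))
  refine (congrArg (MeasurePreserving · volume volume) ?_).mp hcomp
  ext z <;> simp [sumMeanCoords] <;> ring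

end TripleCoordinates

/-- The oscillatory integral `(t, x) ↦ ∫ a(ξ) e^{ixξ + itφ(ξ)} dξ`. -/
def oscIntegral (φ : ℝ → ℝ) (a : ℝ → ℂ) (p : ℝ × ℝ) : ℂ :=
  ∫ ξ, a ξ * cis(p.2 * ξ + p.1 * φ ξ)

/-- `∑ φ(ξᵢ)` at `w = (ξ₁, ξ₂, ξ₃)`: the phase of the cube of an oscillatory integral. -/
def tripleSum (φ : ℝ → ℝ) (w : ℝ × ℝ × ℝ) : ℝ := φ w.1 + φ w.2.1 + φ w.2.2

/-- `∏ a(ξᵢ)` at `w = (ξ₁, ξ₂, ξ₃)`: the amplitude of the cube of an oscillatory integral. -/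
def tripleProd {R : Type*} [Mul R] (a : ℝ → R) (w : ℝ × ℝ × ℝ) : R := a w.1 * a w.2.1 * a w.2.2

/-- `∑ (ξᵢ - c)²` with `c` the mean of the `ξᵢ`. -/
def deviationSq (w : ℝ × ℝ × ℝ) : ℝ := tripleSum (fun ξ => (ξ - tripleSum id w / 3) ^ 2) w

/-- `∑ (ξᵢ - c) φ'(ξᵢ)` with `c` the mean of the `ξᵢ`: the derivative of `∑ φ(ξᵢ)` along the ray
from the diagonal point `(c, c, c)` through `w`. -/
def deviationDeriv (φ' : ℝ → ℝ) (w : ℝ × ℝ × ℝ) : ℝ :=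
  tripleSum (fun ξ => (ξ - tripleSum id w / 3) * φ' ξ) w

/-- The weight `m` is dominated on `S` by the curvature of a phase with derivative `φ'`; this is
what makes the trilinear form of the `L⁶` estimate bounded on functions supported in `S`. -/
def CurvatureBound (m φ' : ℝ → ℝ) (S : Set ℝ) (δ : ℝ) : Prop :=
  ∀ w ∈ S ×ˢ S ×ˢ S, δ * tripleProd m w ^ 2 * deviationSq w ≤ |deviationDeriv φ' w|

section TripleProduct

variable {φ φ' m : ℝ → ℝ} {S : Set ℝ} {δ : ℝ} {a F : ℝ → ℂ}

theorem oscIntegral_pow_three (φ : ℝ → ℝ) (a : ℝ → ℂ) (p : ℝ × ℝ) :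
    oscIntegral φ a p ^ 3
      = ∫ w, tripleProd a w * cis(p.2 * tripleSum id w + p.1 * tripleSum φ w) := by
  set e : ℝ → ℂ := fun ξ => a ξ * cis(p.2 * ξ + p.1 * φ ξ)
  have hsplit : ∀ w : ℝ × ℝ × ℝ, tripleProd a w * cis(p.2 * tripleSum id w + p.1 * tripleSum φ w)
      = e w.1 * (e w.2.1 * e w.2.2) := fun w => by
    have hphase : p.2 * tripleSum id w + p.1 * tripleSum φ w = (p.2 * w.1 + p.1 * φ w.1) +
        (p.2 * w.2.1 + p.1 * φ w.2.1) + (p.2 * w.2.2 + p.1 * φ w.2.2) := by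
      simp only [tripleSum, id_eq]; ring
    rw [hphase, cis_add, cis_add, tripleProd]
    ring
  simp_rw [hsplit]
  rw [Measure.volume_eq_prod, integral_prod_mul e (fun y : ℝ × ℝ => e y.1 * e y.2),
    Measure.volume_eq_prod, integral_prod_mul e e, oscIntegral]
  ring

theorem measurable_tripleSum (hφ : Measurable φ) : Measurable (tripleSum φ) := by
  unfold tripleSum; fun_prop

theorem measurable_tripleProd (ha : Measurable a) : Measurable (tripleProd a) := by
  unfold tripleProd; fun_prop

theorem measurable_deviationDeriv (hφ' : Measurable φ') : Measurable (deviationDeriv φ') := by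
  unfold deviationDeriv tripleSum; fun_prop

theorem integrable_tripleProd (ha : Integrable a) : Integrable (tripleProd a) := by
  have hprod : Integrable fun w : ℝ × ℝ × ℝ => a w.1 * (a w.2.1 * a w.2.2) :=
    ha.mul_prod (ha.mul_prod ha)
  exact hprod.congr (Eventually.of_forall fun w => (mul_assoc _ _ _).symm)

theorem lintegral_tripleProd (hF : Measurable F) :
    ∫⁻ w, ‖tripleProd F w‖ₑ ^ 2 = (∫⁻ ξ, ‖F ξ‖ₑ ^ 2) ^ 3 := by
  set e : ℝ → ℝ≥0∞ := fun ξ => ‖F ξ‖ₑ ^ 2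
  have he : Measurable e := hF.enorm.pow_const 2
  have hsplit : ∀ w : ℝ × ℝ × ℝ, ‖tripleProd F w‖ₑ ^ 2 = e w.1 * (e w.2.1 * e w.2.2) := fun w => by
    rw [tripleProd, enorm_mul, enorm_mul]
    ring
  simp_rw [hsplit]
  rw [Measure.volume_eq_prod, lintegral_prod_mul (g := fun y : ℝ × ℝ => e y.1 * e y.2)
    he.aemeasurable (by fun_prop), Measure.volume_eq_prod,
    lintegral_prod_mul he.aemeasurable he.aemeasurable]
  ring

theorem lintegral_lintegral_sumMeanCoords {g : ℝ × ℝ × ℝ → ℝ≥0∞} (hg : Measurable g) :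
    ∫⁻ s, ∫⁻ y : ℝ × ℝ, g (sumMeanCoords (s, y)) = ∫⁻ w, g w :=
  (lintegral_prod _ (hg.comp sumMeanCoords.measurable).aemeasurable).symm.trans
    (measurePreserving_sumMeanCoords.lintegral_comp hg)

theorem tripleSum_id_sumMeanCoords (z : ℝ × ℝ × ℝ) :
    tripleSum id (sumMeanCoords z) = z.1 := by
  obtain ⟨s, p, q⟩ := z
  simp only [tripleSum, sumMeanCoords_apply, id_eq]; ring

theorem deviationDeriv_sumMeanCoords (φ' : ℝ → ℝ) (s p q : ℝ) :
    deviationDeriv φ' (sumMeanCoords (s, p, q))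
      = (-p - q) * φ' (s / 3 - p - q) + p * φ' (s / 3 + p) + q * φ' (s / 3 + q) := by
  rw [deviationDeriv, tripleSum_id_sumMeanCoords, sumMeanCoords_apply, tripleSum]
  ring

theorem deviationSq_sumMeanCoords (s p q : ℝ) :
    deviationSq (sumMeanCoords (s, p, q)) = (p + q) ^ 2 + p ^ 2 + q ^ 2 := by
  rw [deviationSq, tripleSum_id_sumMeanCoords, sumMeanCoords_apply, tripleSum]
  ring

theorem hasDerivAt_tripleSum_sumMeanCoords (hφ : ∀ ξ, HasDerivAt φ (φ' ξ) ξ) (s : ℝ) (y : ℝ × ℝ) :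
    HasDerivAt (fun r : ℝ => tripleSum φ (sumMeanCoords (s, r • y)))
      (deviationDeriv φ' (sumMeanCoords (s, y))) 1 := by
  obtain ⟨p, q⟩ := y
  have hcomp : ∀ k : ℝ, HasDerivAt (fun r : ℝ => φ (s / 3 + r * k)) (φ' (s / 3 + k) * k) 1 :=
    fun k => by
      have hlin : HasDerivAt (fun r : ℝ => s / 3 + r * k) k 1 := by
        simpa using ((hasDerivAt_id (1 : ℝ)).mul_const k).const_add (s / 3)
      exact (hφ _).comp_of_eq 1 hlin (by rw [one_mul])
  have hsum := ((hcomp (-p - q)).add (hcomp p)).add (hcomp q)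
  rw [deviationDeriv_sumMeanCoords]
  refine (hsum.congr_of_eventuallyEq (Eventually.of_forall fun r => ?_)).congr_deriv ?_
  · simp only [tripleSum, sumMeanCoords_apply, Prod.smul_mk, smul_eq_mul, Pi.add_apply]
    ring_nf
  · rw [show s / 3 + (-p - q) = s / 3 - p - q by ring]
    ring

theorem convex_sumMeanCoords_slice (hS : Convex ℝ S) (s : ℝ) :
    Convex ℝ {y : ℝ × ℝ | sumMeanCoords (s, y) ∈ S ×ˢ S ×ˢ S} := by
  rintro ⟨p, q⟩ ⟨h₁, h₂, h₃⟩ ⟨p', q'⟩ ⟨h₁', h₂', h₃'⟩ u v hu hv huv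
  refine ⟨?_, ?_, ?_⟩
  · convert hS h₁ h₁' hu hv huv using 1
    simp only [sumMeanCoords_apply, Prod.smul_mk, Prod.mk_add_mk, smul_eq_mul]
    linear_combination -(s / 3) * huv
  · convert hS h₂ h₂' hu hv huv using 1
    simp only [sumMeanCoords_apply, Prod.smul_mk, Prod.mk_add_mk, smul_eq_mul]
    linear_combination -(s / 3) * huv
  · convert hS h₃ h₃' hu hv huv using 1
    simp only [sumMeanCoords_apply, Prod.smul_mk, Prod.mk_add_mk, smul_eq_mul]
    linear_combination -(s / 3) * huv

theorem deviationDeriv_ne_zero (hδ : 0 < δ) (hm : ∀ ξ ∈ S, m ξ ≠ 0)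
    (hD : CurvatureBound m φ' S δ) {s : ℝ} {y : ℝ × ℝ}
    (hy : sumMeanCoords (s, y) ∈ S ×ˢ S ×ˢ S) (hy0 : y ≠ 0) :
    deviationDeriv φ' (sumMeanCoords (s, y)) ≠ 0 := by
  obtain ⟨p, q⟩ := y
  have hdev : 0 < deviationSq (sumMeanCoords (s, p, q)) := by
    rw [deviationSq_sumMeanCoords]
    have hpq : p ≠ 0 ∨ q ≠ 0 := by
      by_contra! h0
      exact hy0 (Prod.ext h0.1 h0.2)
    rcases hpq with hp | hq <;> positivity
  have hprod : tripleProd m (sumMeanCoords (s, p, q)) ≠ 0 :=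
    mul_ne_zero (mul_ne_zero (hm _ hy.1) (hm _ hy.2.1)) (hm _ hy.2.2)
  exact abs_pos.1 (lt_of_lt_of_le (by positivity) (hD _ hy))

theorem sq_tripleProd_mul_div_le (hδ : 0 < δ) (hD : CurvatureBound m φ' S δ) {s p q : ℝ}
    (hw : sumMeanCoords (s, p, q) ∈ S ×ˢ S ×ˢ S) :
    tripleProd m (sumMeanCoords (s, p, q)) ^ 2 *
      ((p ^ 2 + q ^ 2) / |deviationDeriv φ' (sumMeanCoords (s, p, q))|) ≤ δ⁻¹ := by
  have hcurv := hD _ hw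
  rw [deviationSq_sumMeanCoords] at hcurv
  rw [← mul_div_assoc]
  refine div_le_of_le_mul₀ (abs_nonneg _) (by positivity) ?_
  rw [inv_mul_eq_div, le_div_iff₀ hδ]
  refine le_trans ?_ hcurv
  nlinarith [mul_nonneg (mul_nonneg hδ.le (sq_nonneg (tripleProd m (sumMeanCoords (s, p, q)))))
    (sq_nonneg (p + q))]

theorem enorm_sq_tripleProd_mul_div_le (hδ : 0 < δ) (hD : CurvatureBound m φ' S δ)
    (hFS : Function.support F ⊆ S) (s : ℝ) (y : ℝ × ℝ) :
    ‖tripleProd (fun ξ => m ξ * F ξ) (sumMeanCoords (s, y))‖ₑ ^ 2 *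
        ENNReal.ofReal ((y.1 ^ 2 + y.2 ^ 2) / |deviationDeriv φ' (sumMeanCoords (s, y))|)
      ≤ ENNReal.ofReal δ⁻¹ * ‖tripleProd F (sumMeanCoords (s, y))‖ₑ ^ 2 := by
  set w := sumMeanCoords (s, y)
  have hsplit : tripleProd (fun ξ => (m ξ : ℂ) * F ξ) w
      = ((tripleProd m w : ℝ) : ℂ) * tripleProd F w := by
    simp only [tripleProd]
    push_cast
    ring
  by_cases hF : tripleProd F w = 0
  · rw [hsplit, hF]
    simp
  · have hmem : w ∈ S ×ˢ S ×ˢ S := by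
      simp only [tripleProd, mul_ne_zero_iff] at hF
      exact ⟨hFS hF.1.1, hFS hF.1.2, hFS hF.2⟩
    rw [hsplit, enorm_mul, mul_pow, mul_right_comm]
    gcongr
    rw [← ofReal_norm, Complex.norm_real, ← ENNReal.ofReal_pow (norm_nonneg _),
      ← ENNReal.ofReal_mul (by positivity), Real.norm_eq_abs, sq_abs]
    exact ENNReal.ofReal_le_ofReal (sq_tripleProd_mul_div_le hδ hD hmem)

theorem support_tripleProd_subset (ha : Function.support a ⊆ S) :
    Function.support (tripleProd a) ⊆ S ×ˢ S ×ˢ S := fun w hw => by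
  simp only [Function.mem_support, tripleProd, mul_ne_zero_iff] at hw
  exact ⟨ha hw.1.1, ha hw.1.2, ha hw.2⟩

theorem lintegral_enorm_sq_integral_slice_le (hφ : ∀ ξ, HasDerivAt φ (φ' ξ) ξ)
    (hSm : MeasurableSet S) (hS : Convex ℝ S) (hδ : 0 < δ) (hm : ∀ ξ ∈ S, m ξ ≠ 0)
    (hD : CurvatureBound m φ' S δ) (ham : Measurable a) (haS : Function.support a ⊆ S) {s : ℝ}
    (hs : Integrable fun y => tripleProd a (sumMeanCoords (s, y))) :
    ∫⁻ t, ‖∫ y, tripleProd a (sumMeanCoords (s, y)) *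
        cis(t * tripleSum φ (sumMeanCoords (s, y)))‖ₑ ^ 2
      ≤ ENNReal.ofReal (2 * Real.pi) ^ 2 * ∫⁻ y, ‖tripleProd a (sumMeanCoords (s, y))‖ₑ ^ 2 *
        ENNReal.ofReal ((y.1 ^ 2 + y.2 ^ 2) / |deviationDeriv φ' (sumMeanCoords (s, y))|) := by
  have hφm : Measurable φ :=
    (continuous_iff_continuousAt.2 fun ξ => (hφ ξ).continuousAt).measurable
  have hφ'm : Measurable φ' := by
    rw [← funext fun ξ => (hφ ξ).deriv]
    exact measurable_deriv φ
  have hslice : Measurable fun y => sumMeanCoords (s, y) :=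
    sumMeanCoords.measurable.comp measurable_prodMk_left
  refine lintegral_enorm_sq_integral_radial_le (hslice (hSm.prod (hSm.prod hSm)))
    (convex_sumMeanCoords_slice hS s) ?_
    (fun y _ => hasDerivAt_tripleSum_sumMeanCoords hφ s y) ?_
    (fun y hy hy0 => deviationDeriv_ne_zero hδ hm hD hy hy0)
    (fun y hy => support_tripleProd_subset haS hy) ?_ hs
  · exact (measurable_tripleSum hφm).comp hslice
  · exact (measurable_deviationDeriv hφ'm).comp hslice
  · exact (measurable_tripleProd ham).comp hslice

theorem integrable_tripleProd_sumMeanCoords (ha : Integrable a) :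
    Integrable fun z => tripleProd a (sumMeanCoords z) :=
  measurePreserving_sumMeanCoords.integrable_comp_of_integrable (integrable_tripleProd ha)

theorem enorm_oscIntegral_pow_six (φ : ℝ → ℝ) (a : ℝ → ℂ) (p : ℝ × ℝ) :
    ‖oscIntegral φ a p‖ₑ ^ 6 = ‖∫ z, tripleProd a (sumMeanCoords z) *
      cis(p.2 * z.1 + p.1 * tripleSum φ (sumMeanCoords z))‖ₑ ^ 2 := by
  rw [show 6 = 3 * 2 from rfl, pow_mul, ← enorm_pow, oscIntegral_pow_three,
    ← measurePreserving_sumMeanCoords.integral_comp']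
  simp only [tripleSum_id_sumMeanCoords]

theorem lintegral_oscIntegral_pow_six_le_lintegral_slice (hφ : Measurable φ) (ham : Measurable a)
    (hai : Integrable a) :
    ∫⁻ p, ‖oscIntegral φ a p‖ₑ ^ 6 ≤ ENNReal.ofReal (2 * Real.pi) *
      ∫⁻ s, ∫⁻ t, ‖∫ y, tripleProd a (sumMeanCoords (s, y)) *
        cis(t * tripleSum φ (sumMeanCoords (s, y)))‖ₑ ^ 2 := by
  simp_rw [enorm_oscIntegral_pow_six]
  exact lintegral_enorm_sq_integral_prod_le
    ((measurable_tripleSum hφ).comp sumMeanCoords.measurable)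
    ((measurable_tripleProd ham).comp sumMeanCoords.measurable)
    (integrable_tripleProd_sumMeanCoords hai)

theorem lintegral_oscIntegral_pow_six_le (hφ : ∀ ξ, HasDerivAt φ (φ' ξ) ξ)
    (hSm : MeasurableSet S) (hS : Convex ℝ S) (hδ : 0 < δ) (hmm : Measurable m)
    (hm : ∀ ξ ∈ S, m ξ ≠ 0) (hD : CurvatureBound m φ' S δ) (hF : Measurable F)
    (hFS : Function.support F ⊆ S) (hmF : Integrable fun ξ => (m ξ : ℂ) * F ξ) :
    ∫⁻ p, ‖oscIntegral φ (fun ξ => m ξ * F ξ) p‖ₑ ^ 6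
      ≤ ENNReal.ofReal ((2 * Real.pi) ^ 3 / δ) * (∫⁻ ξ, ‖F ξ‖ₑ ^ 2) ^ 3 := by
  set a : ℝ → ℂ := fun ξ => m ξ * F ξ
  have ham : Measurable a := by fun_prop
  have haS : Function.support a ⊆ S := fun ξ hξ => hFS (right_ne_zero_of_mul hξ)
  have hφm : Measurable φ :=
    (continuous_iff_continuousAt.2 fun ξ => (hφ ξ).continuousAt).measurable
  have hslices : ∀ᵐ s, ∫⁻ t, ‖∫ y : ℝ × ℝ, tripleProd a (sumMeanCoords (s, y)) *
      cis(t * tripleSum φ (sumMeanCoords (s, y)))‖ₑ ^ 2 ≤ ENNReal.ofReal (2 * Real.pi) ^ 2 *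
        ∫⁻ y, ENNReal.ofReal δ⁻¹ * ‖tripleProd F (sumMeanCoords (s, y))‖ₑ ^ 2 :=
    (integrable_tripleProd_sumMeanCoords hmF).prod_right_ae.mono fun s hs =>
      (lintegral_enorm_sq_integral_slice_le hφ hSm hS hδ hm hD ham haS hs).trans <| by
        gcongr ENNReal.ofReal _ ^ 2 * ?_
        exact lintegral_mono fun y => enorm_sq_tripleProd_mul_div_le hδ hD hFS s y
  have hFm := measurable_tripleProd hF
  calc ∫⁻ p, ‖oscIntegral φ a p‖ₑ ^ 6
      ≤ ENNReal.ofReal (2 * Real.pi) * ∫⁻ s, ∫⁻ t, ‖∫ y : ℝ × ℝ,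
          tripleProd a (sumMeanCoords (s, y)) *
            cis(t * tripleSum φ (sumMeanCoords (s, y)))‖ₑ ^ 2 :=
        lintegral_oscIntegral_pow_six_le_lintegral_slice hφm ham hmF
    _ ≤ ENNReal.ofReal (2 * Real.pi) * (ENNReal.ofReal (2 * Real.pi) ^ 2 *
          (ENNReal.ofReal δ⁻¹ * ∫⁻ w, ‖tripleProd F w‖ₑ ^ 2)) := by
        gcongr ENNReal.ofReal _ * ?_
        refine (lintegral_mono_ae hslices).trans_eq ?_
        rw [lintegral_const_mul' _ _ (by finiteness)]
        simp_rw [lintegral_const_mul' _ _ ENNReal.ofReal_ne_top]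
        rw [lintegral_lintegral_sumMeanCoords (hFm.enorm.pow_const 2)]
    _ = _ := by
        rw [lintegral_tripleProd hF, div_eq_mul_inv,
          ENNReal.ofReal_mul (p := (2 * Real.pi) ^ 3) (by positivity),
          ENNReal.ofReal_pow (by positivity)]
        ring

end TripleProduct

section WeightedExtension

variable {m φ φ' : ℝ → ℝ} {S T : Set ℝ} {δ : ℝ} {C C₁ C₂ : ℝ≥0} {F G : ℝ → ℂ} {f g : L2R}

/-- `(1/2π) ∫ m(ξ) e^{ixξ + itφ(ξ)} F(ξ) dξ`, the extension operator with weight `m` and phase `φ`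
acting on an integrable frequency profile `F`. -/
def freqExtension (m φ : ℝ → ℝ) (F : ℝ → ℂ) (p : ℝ × ℝ) : ℂ :=
  (1 / (2 * Real.pi) : ℂ) * oscIntegral φ (fun ξ => m ξ * F ξ) p

/-- The `L² → L⁶` bound for the extension operator with weight `m` and phase `φ`, on frequency
profiles supported in `S`. -/
def HasExtensionBound (m φ : ℝ → ℝ) (S : Set ℝ) (C : ℝ≥0) : Prop :=
  ∀ F : ℝ → ℂ, Measurable F → Function.support F ⊆ S → Integrable (fun ξ => (m ξ : ℂ) * F ξ) →
    eLpNorm (freqExtension m φ F) 6 ≤ C * eLpNorm F 2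

theorem oscIntegral_congr_ae {a b : ℝ → ℂ} (h : a =ᵐ[volume] b) :
    oscIntegral φ a = oscIntegral φ b :=
  funext fun _ => integral_congr_ae (h.mono fun ξ hξ => by simp only [hξ])

theorem oscIntegral_add (hφ : Measurable φ) {a b : ℝ → ℂ} (ha : Integrable a)
    (hb : Integrable b) (p : ℝ × ℝ) :
    oscIntegral φ (fun ξ => a ξ + b ξ) p = oscIntegral φ a p + oscIntegral φ b p := by
  simp only [oscIntegral, add_mul]
  exact integral_add (integrable_mul_cis ha (by fun_prop)) (integrable_mul_cis hb (by fun_prop))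

theorem oscIntegral_sub (hφ : Measurable φ) {a b : ℝ → ℂ} (ha : Integrable a)
    (hb : Integrable b) (p : ℝ × ℝ) :
    oscIntegral φ (fun ξ => a ξ - b ξ) p = oscIntegral φ a p - oscIntegral φ b p := by
  simp only [oscIntegral, sub_mul]
  exact integral_sub (integrable_mul_cis ha (by fun_prop)) (integrable_mul_cis hb (by fun_prop))

theorem stronglyMeasurable_oscIntegral (hφ : Measurable φ) {a : ℝ → ℂ} (ha : Measurable a) :
    StronglyMeasurable (oscIntegral φ a) :=
  StronglyMeasurable.integral_prod_right' (f := fun q : (ℝ × ℝ) × ℝ =>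
    a q.2 * cis(q.1.2 * q.2 + q.1.1 * φ q.2)) (Measurable.stronglyMeasurable (by fun_prop))

theorem freqExtension_congr_ae (h : F =ᵐ[volume] G) : freqExtension m φ F = freqExtension m φ G :=
  funext fun p => by
    have hmul : (fun ξ => (m ξ : ℂ) * F ξ) =ᵐ[volume] fun ξ => (m ξ : ℂ) * G ξ :=
      h.mono fun ξ hξ => by simp only [hξ]
    rw [freqExtension, freqExtension, oscIntegral_congr_ae hmul]

theorem freqExtension_add (hφ : Measurable φ) (hF : Integrable fun ξ => (m ξ : ℂ) * F ξ)
    (hG : Integrable fun ξ => (m ξ : ℂ) * G ξ) :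
    freqExtension m φ (F + G) = freqExtension m φ F + freqExtension m φ G := by
  ext p
  simp only [freqExtension, Pi.add_apply, mul_add, oscIntegral_add hφ hF hG]

theorem freqExtension_sub (hφ : Measurable φ) (hF : Integrable fun ξ => (m ξ : ℂ) * F ξ)
    (hG : Integrable fun ξ => (m ξ : ℂ) * G ξ) :
    freqExtension m φ (F - G) = freqExtension m φ F - freqExtension m φ G := by
  ext p
  simp only [freqExtension, Pi.sub_apply, mul_sub, oscIntegral_sub hφ hF hG]

theorem aestronglyMeasurable_freqExtension (hm : Measurable m) (hφ : Measurable φ)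
    (hF : Measurable F) : AEStronglyMeasurable (freqExtension m φ F) :=
  (stronglyMeasurable_const.mul
    (stronglyMeasurable_oscIntegral hφ (by fun_prop))).aestronglyMeasurable

theorem enorm_one_div_two_pi_le : ‖(1 / (2 * Real.pi) : ℂ)‖ₑ ≤ 1 := by
  have hnorm : ‖(1 / (2 * Real.pi) : ℂ)‖ ≤ 1 := by
    rw [norm_div, norm_mul, norm_one, Complex.norm_real, Real.norm_of_nonneg Real.pi_pos.le,
      Complex.norm_ofNat, div_le_one (by positivity)]
    linarith [Real.pi_gt_three]
  rw [← ofReal_norm]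
  exact ENNReal.ofReal_le_one.2 hnorm

theorem exists_hasExtensionBound_of_curvatureBound (hφ : ∀ ξ, HasDerivAt φ (φ' ξ) ξ)
    (hSm : MeasurableSet S) (hS : Convex ℝ S) (hδ : 0 < δ) (hmm : Measurable m)
    (hm : ∀ ξ ∈ S, m ξ ≠ 0) (hD : CurvatureBound m φ' S δ) : ∃ C, HasExtensionBound m φ S C := by
  obtain ⟨C, hC⟩ : ∃ C : ℝ≥0, C ^ 6 = Real.toNNReal ((2 * Real.pi) ^ 3 / δ) :=
    ⟨_, NNReal.rpow_inv_natCast_pow _ (n := 6) (by norm_num)⟩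
  refine ⟨C, fun F hF hFS hmF => ?_⟩
  have hsix := lintegral_oscIntegral_pow_six_le hφ hSm hS hδ hmm hm hD hF hFS hmF
  rw [← eLpNorm_six_pow, ← eLpNorm_two_sq, ← pow_mul, ENNReal.ofReal, ← hC, ENNReal.coe_pow,
    ← mul_pow] at hsix
  have hosc : eLpNorm (oscIntegral φ fun ξ => m ξ * F ξ) 6 ≤ C * eLpNorm F 2 :=
    (ENNReal.pow_le_pow_left_iff (by norm_num)).1 hsix
  have hsmul : freqExtension m φ F =
      (1 / (2 * Real.pi) : ℂ) • oscIntegral φ fun ξ => m ξ * F ξ := rfl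
  rw [hsmul, eLpNorm_const_smul]
  exact (mul_le_mul' enorm_one_div_two_pi_le hosc).trans_eq (one_mul _)

theorem integrable_mul_indicator (hF : Integrable fun ξ => (m ξ : ℂ) * F ξ)
    (hS : MeasurableSet S) : Integrable fun ξ => (m ξ : ℂ) * S.indicator F ξ :=
  (hF.indicator hS).congr (Eventually.of_forall fun _ => Set.indicator_mul_right S _ _)

theorem HasExtensionBound.union (h₁ : HasExtensionBound m φ S C₁)
    (h₂ : HasExtensionBound m φ T C₂) (hm : Measurable m) (hφ : Measurable φ)
    (hS : MeasurableSet S) : HasExtensionBound m φ (S ∪ T) (C₁ + C₂) := fun F hF hFS hmF => by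
  have hsplit : F = S.indicator F + Sᶜ.indicator F := (Set.indicator_self_add_compl S F).symm
  have hcompl : Function.support (Sᶜ.indicator F) ⊆ T := fun ξ hξ => by
    rw [Set.support_indicator] at hξ
    exact (hFS hξ.2).resolve_left hξ.1
  have hbound : ∀ {A : Set ℝ} {B : Set ℝ} {K : ℝ≥0}, HasExtensionBound m φ B K → MeasurableSet A →
      Function.support (A.indicator F) ⊆ B →
      eLpNorm (freqExtension m φ (A.indicator F)) 6 ≤ K * eLpNorm F 2 := fun h hA hAB =>
    (h _ (hF.indicator hA) hAB (integrable_mul_indicator hmF hA)).trans <| by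
      gcongr
      exact eLpNorm_indicator_le _
  calc eLpNorm (freqExtension m φ F) 6 volume
      = eLpNorm (freqExtension m φ (S.indicator F) + freqExtension m φ (Sᶜ.indicator F)) 6
          volume := by
        rw [← freqExtension_add hφ (integrable_mul_indicator hmF hS)
          (integrable_mul_indicator hmF hS.compl), ← hsplit]
    _ ≤ C₁ * eLpNorm F 2 volume + C₂ * eLpNorm F 2 volume :=
        (eLpNorm_add_le (aestronglyMeasurable_freqExtension hm hφ (hF.indicator hS))
          (aestronglyMeasurable_freqExtension hm hφ (hF.indicator hS.compl)) (by norm_num)).trans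
          (add_le_add (hbound h₁ hS Set.support_indicator_subset)
            (hbound h₂ hS.compl hcompl))
    _ = _ := by rw [ENNReal.coe_add, add_mul]

theorem HasExtensionBound.of_ae_mem (h : HasExtensionBound m φ S C) (hS : MeasurableSet S)
    (hae : ∀ᵐ ξ, ξ ∈ S) : HasExtensionBound m φ Set.univ C := fun F hF _ hmF => by
  have hFS : S.indicator F =ᵐ[volume] F := hae.mono fun ξ hξ => Set.indicator_of_mem hξ F
  rw [← freqExtension_congr_ae hFS, ← eLpNorm_congr_ae hFS]
  exact h _ (hF.indicator hS) Set.support_indicator_subset (integrable_mul_indicator hmF hS)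

theorem HasExtensionBound.eLpNorm_sub_le (hC : HasExtensionBound m φ Set.univ C)
    (hφ : Measurable φ) (hF : Measurable F) (hG : Measurable G)
    (hmF : Integrable fun ξ => (m ξ : ℂ) * F ξ) (hmG : Integrable fun ξ => (m ξ : ℂ) * G ξ) :
    eLpNorm (freqExtension m φ F - freqExtension m φ G) 6 ≤ C * eLpNorm (F - G) 2 := by
  rw [← freqExtension_sub hφ hmF hmG]
  refine hC _ (hF.sub hG) (Set.subset_univ _) ?_
  simpa only [Pi.sub_apply, mul_sub] using! hmF.sub hmG

theorem tendsto_eLpNorm_indicator_Icc_sub (hF : MemLp F 2) :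
    Tendsto (fun R : ℝ => eLpNorm ((Set.Icc (-R) R).indicator F - F) 2) atTop (𝓝 0) := by
  refine tendsto_eLpNorm_zero_of_lintegral two_ne_zero ?_
  rw [← lintegral_zero (μ := (volume : Measure ℝ))]
  refine tendsto_lintegral_filter_of_dominated_convergence' (fun ξ => ‖F ξ‖ₑ ^ 2)
    (Eventually.of_forall fun R => ?_) (Eventually.of_forall fun R => ?_) ?_ ?_
  · exact ((hF.1.indicator measurableSet_Icc).sub hF.1).enorm.pow_const 2
  · refine Eventually.of_forall fun ξ => ?_
    by_cases hξ : ξ ∈ Set.Icc (-R) R <;> simp [hξ]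
  · rw [← eLpNorm_two_sq]
    exact ENNReal.pow_ne_top hF.2.ne
  · refine Eventually.of_forall fun ξ => tendsto_const_nhds.congr' ?_
    filter_upwards [eventually_ge_atTop |ξ|] with R hR
    have hξ : ξ ∈ Set.Icc (-R) R := abs_le.1 hR
    simp [hξ]

theorem integrable_mul_indicator_Icc (hm : Continuous m) (hF : MemLp F 2) (R : ℝ) :
    Integrable fun ξ => (m ξ : ℂ) * (Set.Icc (-R) R).indicator F ξ := by
  have hFR : IntegrableOn F (Set.Icc (-R) R) :=
    (hF.locallyIntegrable (by norm_num)).integrableOn_isCompact isCompact_Icc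
  have hmFR : IntegrableOn (fun ξ => (m ξ : ℂ) * F ξ) (Set.Icc (-R) R) :=
    hFR.continuousOn_mul (by fun_prop) isCompact_Icc
  exact ((integrable_indicator_iff measurableSet_Icc).2 hmFR).congr
    (Eventually.of_forall fun _ => Set.indicator_mul_right _ _ _)

theorem truncExtension_eq_freqExtension (m φ : ℝ → ℝ) (f : L2R) (R : ℝ) :
    truncExtension m φ f R = freqExtension m φ ((Set.Icc (-R) R).indicator (fourierHat f)) := by
  ext p
  rw [truncExtension, freqExtension, oscIntegral, ← integral_indicator measurableSet_Icc]
  congr 2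
  ext ξ
  by_cases hξ : ξ ∈ Set.Icc (-R) R
  · simp only [Set.indicator_of_mem hξ]
    ring
  · simp only [Set.indicator_of_notMem hξ, mul_zero, zero_mul]

theorem measurable_indicator_Icc_fourierHat (f : L2R) (R : ℝ) :
    Measurable ((Set.Icc (-R) R).indicator (fourierHat f)) :=
  (measurable_fourierHat f).indicator measurableSet_Icc

theorem aestronglyMeasurable_truncExtension (hm : Measurable m) (hφ : Measurable φ) (f : L2R)
    (R : ℝ) : AEStronglyMeasurable (truncExtension m φ f R) := by
  rw [truncExtension_eq_freqExtension]
  exact aestronglyMeasurable_freqExtension hm hφ (measurable_indicator_Icc_fourierHat f R)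

theorem memLp_truncExtension (hC : HasExtensionBound m φ Set.univ C) (hm : Continuous m)
    (hφ : Measurable φ) (f : L2R) (R : ℝ) : MemLp (truncExtension m φ f R) 6 := by
  refine ⟨aestronglyMeasurable_truncExtension hm.measurable hφ f R, ?_⟩
  rw [truncExtension_eq_freqExtension]
  refine (hC _ (measurable_indicator_Icc_fourierHat f R) (Set.subset_univ _)
    (integrable_mul_indicator_Icc hm (memLp_fourierHat f) R)).trans_lt ?_
  exact ENNReal.mul_lt_top ENNReal.coe_lt_top
    ((memLp_fourierHat f).indicator measurableSet_Icc).2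

theorem exists_isExtension (hC : HasExtensionBound m φ Set.univ C) (hm : Continuous m)
    (hφ : Measurable φ) (f : L2R) : ∃ u, IsExtension m φ f u := by
  have : Fact ((1 : ℝ≥0∞) ≤ 6) := ⟨by norm_num⟩
  have hmem := memLp_truncExtension hC hm hφ f
  have hind : ∀ R : ℝ, MemLp ((Set.Icc (-R) R).indicator (fourierHat f)) 2 := fun R =>
    (memLp_fourierHat f).indicator measurableSet_Icc
  set U : ℝ → Lp ℂ 6 (volume : Measure (ℝ × ℝ)) := fun R => (hmem R).toLp _
  set V : ℝ → L2R := fun R => (hind R).toLp _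
  have hV : CauchySeq V := by
    refine Tendsto.cauchySeq (x := (memLp_fourierHat f).toLp _) ?_
    rw [Lp.tendsto_Lp_iff_tendsto_eLpNorm'']
    exact tendsto_eLpNorm_indicator_Icc_sub (memLp_fourierHat f)
  have hUV : ∀ R R', edist (U R) (U R') ≤ C * edist (V R) (V R') := fun R R' => by
    rw [Lp.edist_toLp_toLp, Lp.edist_toLp_toLp, truncExtension_eq_freqExtension,
      truncExtension_eq_freqExtension]
    exact hC.eLpNorm_sub_le hφ (measurable_indicator_Icc_fourierHat f R)
      (measurable_indicator_Icc_fourierHat f R')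
      (integrable_mul_indicator_Icc hm (memLp_fourierHat f) R)
      (integrable_mul_indicator_Icc hm (memLp_fourierHat f) R')
  have hU : CauchySeq U := by
    obtain ⟨b, hb, hb0⟩ := EMetric.cauchySeq_iff_le_tendsto_0.1 hV
    refine EMetric.cauchySeq_iff_le_tendsto_0.2 ⟨fun N => C * b N, fun R R' N hR hR' =>
      (hUV R R').trans (mul_le_mul_right (hb R R' N hR hR') _), ?_⟩
    simpa using ENNReal.Tendsto.const_mul hb0 (Or.inr (ENNReal.coe_ne_top (r := C)))
  obtain ⟨u, hu⟩ := cauchySeq_tendsto_of_complete hU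
  refine ⟨u, Lp.memLp u, ?_⟩
  rw [Lp.tendsto_Lp_iff_tendsto_eLpNorm'] at hu
  refine hu.congr fun R => eLpNorm_congr_ae ?_
  filter_upwards [(hmem R).coeFn_toLp] with p hp
  simp only [Pi.sub_apply, U, hp]

theorem isExtension_extension (hC : HasExtensionBound m φ Set.univ C) (hm : Continuous m)
    (hφ : Measurable φ) (f : L2R) : IsExtension m φ f (extension m φ f) := by
  have hex := exists_isExtension hC hm hφ f
  rw [extension, dif_pos hex]
  exact hex.choose_spec

theorem IsExtension.eLpNorm_sub_freqExtension_le {u : ℝ × ℝ → ℂ} (hu : IsExtension m φ f u)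
    (hC : HasExtensionBound m φ Set.univ C) (hm : Continuous m) (hφ : Measurable φ)
    (hF : Measurable F) (hmF : Integrable fun ξ => (m ξ : ℂ) * F ξ) :
    eLpNorm (u - freqExtension m φ F) 6 ≤ C * eLpNorm (fourierHat f - F) 2 := by
  have hlim : Tendsto (fun R : ℝ => eLpNorm (truncExtension m φ f R - u) 6 +
      C * (eLpNorm ((Set.Icc (-R) R).indicator (fourierHat f) - fourierHat f) 2
        + eLpNorm (fourierHat f - F) 2)) atTop (𝓝 (C * eLpNorm (fourierHat f - F) 2)) := by
    simpa using! hu.2.add (ENNReal.Tendsto.const_mul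
      ((tendsto_eLpNorm_indicator_Icc_sub (memLp_fourierHat f)).add_const _)
      (Or.inr (ENNReal.coe_ne_top (r := C))))
  refine ge_of_tendsto' hlim fun R => ?_
  have htrunc := aestronglyMeasurable_truncExtension hm.measurable hφ f R
  have hind := measurable_indicator_Icc_fourierHat f R
  have hf := measurable_fourierHat f
  calc eLpNorm (u - freqExtension m φ F) 6 volume
      ≤ eLpNorm (u - truncExtension m φ f R) 6 volume
        + eLpNorm (truncExtension m φ f R - freqExtension m φ F) 6 volume := by
        rw [← sub_add_sub_cancel u (truncExtension m φ f R)]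
        exact eLpNorm_add_le (hu.1.1.sub htrunc)
          (htrunc.sub (aestronglyMeasurable_freqExtension hm.measurable hφ hF)) (by norm_num)
    _ ≤ eLpNorm (truncExtension m φ f R - u) 6 volume
        + C * eLpNorm ((Set.Icc (-R) R).indicator (fourierHat f) - F) 2 volume := by
        rw [eLpNorm_sub_comm, truncExtension_eq_freqExtension]
        gcongr
        exact hC.eLpNorm_sub_le hφ hind hF
          (integrable_mul_indicator_Icc hm (memLp_fourierHat f) R) hmF
    _ ≤ _ := by
        gcongr
        rw [← sub_add_sub_cancel _ (fourierHat f)]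
        exact eLpNorm_add_le (hind.sub hf).aestronglyMeasurable
          (hf.sub hF).aestronglyMeasurable (by norm_num)

theorem truncExtension_add (hm : Continuous m) (hφ : Measurable φ) (f g : L2R) (R : ℝ) :
    truncExtension m φ (f + g) R = truncExtension m φ f R + truncExtension m φ g R := by
  simp only [truncExtension_eq_freqExtension]
  rw [← freqExtension_add hφ (integrable_mul_indicator_Icc hm (memLp_fourierHat f) R)
    (integrable_mul_indicator_Icc hm (memLp_fourierHat g) R), ← Set.indicator_add']
  exact freqExtension_congr_ae ((fourierHat_add_ae_eq f g).mono fun ξ hξ => by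
    simp only [Set.indicator_apply, Pi.add_apply, hξ])

theorem IsExtension.ae_eq_add {u v w : ℝ × ℝ → ℂ} (hw : IsExtension m φ (f + g) w)
    (hu : IsExtension m φ f u) (hv : IsExtension m φ g v) (hm : Continuous m)
    (hφ : Measurable φ) : w =ᵐ[volume] u + v := by
  have htrunc := aestronglyMeasurable_truncExtension hm.measurable hφ
  have hlim : Tendsto (fun R : ℝ => eLpNorm (truncExtension m φ (f + g) R - w) 6 +
      (eLpNorm (truncExtension m φ f R - u) 6 + eLpNorm (truncExtension m φ g R - v) 6)) atTop
      (𝓝 0) := by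
    simpa using! hw.2.add (hu.2.add hv.2)
  have hzero : eLpNorm (w - (u + v)) 6 = 0 := by
    refine le_antisymm (ge_of_tendsto' hlim fun R => ?_) zero_le
    have hsplit : w - (u + v) = (w - truncExtension m φ (f + g) R) +
        ((truncExtension m φ f R - u) + (truncExtension m φ g R - v)) := by
      rw [truncExtension_add hm hφ]
      abel
    have hf := (htrunc f R).sub hu.1.1
    have hg := (htrunc g R).sub hv.1.1
    rw [hsplit, eLpNorm_sub_comm (truncExtension m φ (f + g) R)]
    refine (eLpNorm_add_le (hw.1.1.sub (htrunc _ R)) (hf.add hg) (by norm_num)).trans ?_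
    gcongr
    exact eLpNorm_add_le hf hg (by norm_num)
  rw [eLpNorm_eq_zero_iff (hw.1.1.sub (hu.1.1.add hv.1.1)) (by norm_num)] at hzero
  exact hzero.mono fun p hp => sub_eq_zero.1 hp

end WeightedExtension

section ConcreteWeights

variable {m φ' : ℝ → ℝ} {S : Set ℝ} {δ : ℝ}

theorem deviationDeriv_eq_tripleSum_sub (φ' : ℝ → ℝ) (w : ℝ × ℝ × ℝ) :
    deviationDeriv φ' w = tripleSum (fun ξ =>
      (ξ - tripleSum id w / 3) * (φ' ξ - φ' (tripleSum id w / 3))) w := by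
  simp only [deviationDeriv, tripleSum, id]
  ring

theorem mul_deviationSq_le_deviationDeriv {κ : ℝ} {w : ℝ × ℝ × ℝ} (hw : w ∈ S ×ˢ S ×ˢ S)
    (h : ∀ ξ ∈ S, κ * (ξ - tripleSum id w / 3) ^ 2 ≤
      (ξ - tripleSum id w / 3) * (φ' ξ - φ' (tripleSum id w / 3))) :
    κ * deviationSq w ≤ deviationDeriv φ' w := by
  rw [deviationDeriv_eq_tripleSum_sub, deviationSq, tripleSum, tripleSum, mul_add, mul_add]
  exact add_le_add (add_le_add (h _ hw.1) (h _ hw.2.1)) (h _ hw.2.2)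

theorem CurvatureBound.neg (h : CurvatureBound m φ' S δ) (hm : ∀ ξ, m (-ξ) = m ξ)
    (hφ' : ∀ ξ, φ' (-ξ) = φ' ξ) : CurvatureBound m φ' (-S) δ := fun w hw => by
  have hmean : tripleSum id (-w) / 3 = -(tripleSum id w / 3) := by
    simp only [tripleSum, id, Prod.fst_neg, Prod.snd_neg]
    ring
  have hprod : tripleProd m (-w) = tripleProd m w := by
    simp only [tripleProd, Prod.fst_neg, Prod.snd_neg, hm]
  have hsq : deviationSq (-w) = deviationSq w := by
    simp only [deviationSq, hmean]
    simp only [tripleSum, Prod.fst_neg, Prod.snd_neg]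
    ring
  have hderiv : deviationDeriv φ' (-w) = -deviationDeriv φ' w := by
    simp only [deviationDeriv, hmean]
    simp only [tripleSum, Prod.fst_neg, Prod.snd_neg, hφ']
    ring
  simpa only [hprod, hsq, hderiv, abs_neg] using h (-w) hw

theorem hasDerivAt_schrodingerPhase (ξ : ℝ) : HasDerivAt schrodingerPhase (-(2 * ξ)) ξ := by
  simpa [schrodingerPhase] using! (hasDerivAt_pow 2 ξ).neg

theorem hasDerivAt_phase35 (ξ : ℝ) : HasDerivAt phase35 (3 * ξ ^ 2 + 5 * ξ ^ 4) ξ := by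
  simpa [phase35] using! (hasDerivAt_pow 3 ξ).add (hasDerivAt_pow 5 ξ)

theorem measurable_schrodingerPhase : Measurable schrodingerPhase := by
  unfold schrodingerPhase
  fun_prop

theorem measurable_phase35 : Measurable phase35 := by
  unfold phase35
  fun_prop

theorem continuous_schrodingerWeight : Continuous schrodingerWeight := continuous_const

theorem continuous_weight35 : Continuous weight35 :=
  Continuous.rpow_const (by fun_prop) fun _ => Or.inr (by norm_num)

theorem weight35_nonneg (ξ : ℝ) : 0 ≤ weight35 ξ := by
  unfold weight35
  positivity

theorem weight35_pow_six (ξ : ℝ) : weight35 ξ ^ 6 = |ξ + ξ ^ 3| := by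
  rw [weight35, ← Real.rpow_natCast, ← Real.rpow_mul (abs_nonneg _)]
  norm_num

theorem weight35_neg (ξ : ℝ) : weight35 (-ξ) = weight35 ξ := by
  rw [weight35, weight35, ← abs_neg]
  congr 2
  ring

theorem weight35_ne_zero {ξ : ℝ} (hξ : ξ ≠ 0) : weight35 ξ ≠ 0 := by
  refine (Real.rpow_pos_of_pos (abs_pos.2 ?_) _).ne'
  rw [show ξ + ξ ^ 3 = ξ * (1 + ξ ^ 2) by ring]
  positivity

theorem curvatureBound_schrodinger :
    CurvatureBound schrodingerWeight (fun ξ => -(2 * ξ)) Set.univ 2 := fun w _ => by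
  have hderiv : deviationDeriv (fun ξ => -(2 * ξ)) w = -(2 * deviationSq w) := by
    rw [deviationDeriv_eq_tripleSum_sub]
    simp only [deviationSq, tripleSum]
    ring
  rw [hderiv, abs_neg]
  simpa [tripleProd, schrodingerWeight] using le_abs_self (2 * deviationSq w)

theorem weight35_pow_six_le {c ξ : ℝ} (hξ : 0 < ξ) (hξc : ξ ≤ 3 * c) :
    weight35 ξ ^ 6 ≤ 27 * (c + c ^ 3) := by
  rw [weight35_pow_six, abs_of_pos (by positivity)]
  have hcube : ξ ^ 3 ≤ (3 * c) ^ 3 := by gcongr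
  linarith

theorem tripleProd_weight35_sq_le {w : ℝ × ℝ × ℝ} {c : ℝ}
    (hw : w ∈ Set.Ioi 0 ×ˢ Set.Ioi 0 ×ˢ Set.Ioi (0 : ℝ)) (hc : tripleSum id w = 3 * c) :
    tripleProd weight35 w ^ 2 ≤ 27 * (c + c ^ 3) := by
  obtain ⟨h₁ : 0 < w.1, h₂ : 0 < w.2.1, h₃ : 0 < w.2.2⟩ := hw
  simp only [tripleSum, id] at hc
  have hc0 : 0 < c := by linarith
  refine le_of_pow_le_pow_left₀ three_ne_zero (by positivity) ?_
  calc (tripleProd weight35 w ^ 2) ^ 3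
      = weight35 w.1 ^ 6 * weight35 w.2.1 ^ 6 * weight35 w.2.2 ^ 6 := by
        simp only [tripleProd]
        ring
    _ ≤ 27 * (c + c ^ 3) * (27 * (c + c ^ 3)) * (27 * (c + c ^ 3)) := by
        gcongr
        · exact weight35_pow_six_le h₁ (by linarith)
        · exact weight35_pow_six_le h₂ (by linarith)
        · exact weight35_pow_six_le h₃ (by linarith)
    _ = (27 * (c + c ^ 3)) ^ 3 := by ring

theorem curvatureBound_weight35_Ioi :
    CurvatureBound weight35 (fun ξ => 3 * ξ ^ 2 + 5 * ξ ^ 4) (Set.Ioi 0) (1 / 9) := fun w hw => by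
  set c := tripleSum id w / 3 with hc
  have hc0 : 0 < c := by
    obtain ⟨h₁ : 0 < w.1, h₂ : 0 < w.2.1, h₃ : 0 < w.2.2⟩ := hw
    simp only [hc, tripleSum, id]
    positivity
  have hprod := tripleProd_weight35_sq_le hw (c := c) (by linarith)
  have hdev : 0 ≤ deviationSq w := by
    unfold deviationSq tripleSum
    positivity
  calc 1 / 9 * tripleProd weight35 w ^ 2 * deviationSq w
      ≤ 3 * (c + c ^ 3) * deviationSq w :=
        mul_le_mul_of_nonneg_right (by linarith) hdev
    _ ≤ deviationDeriv (fun ξ => 3 * ξ ^ 2 + 5 * ξ ^ 4) w := by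
        refine mul_deviationSq_le_deviationDeriv hw fun ξ (hξ : 0 < ξ) => ?_
        have hfactor : 3 * (c + c ^ 3) ≤ (ξ + c) * (3 + 5 * (ξ ^ 2 + c ^ 2)) := by
          have h₁ : 0 ≤ ξ * (3 + 5 * (ξ ^ 2 + c ^ 2)) := by positivity
          have h₂ : 0 ≤ c * (5 * ξ ^ 2 + 2 * c ^ 2) := by positivity
          linarith
        calc 3 * (c + c ^ 3) * (ξ - c) ^ 2
            ≤ (ξ + c) * (3 + 5 * (ξ ^ 2 + c ^ 2)) * (ξ - c) ^ 2 := by gcongr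
          _ = (ξ - c) * (3 * ξ ^ 2 + 5 * ξ ^ 4 - (3 * c ^ 2 + 5 * c ^ 4)) := by ring
    _ ≤ _ := le_abs_self _

theorem exists_hasExtensionBound_schrodinger :
    ∃ C, HasExtensionBound schrodingerWeight schrodingerPhase Set.univ C :=
  exists_hasExtensionBound_of_curvatureBound hasDerivAt_schrodingerPhase MeasurableSet.univ
    convex_univ two_pos continuous_schrodingerWeight.measurable (fun _ _ => one_ne_zero)
    curvatureBound_schrodinger

theorem exists_hasExtensionBound_weight35 :
    ∃ C, HasExtensionBound weight35 phase35 Set.univ C := by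
  have hm := continuous_weight35.measurable
  obtain ⟨C₁, h₁⟩ := exists_hasExtensionBound_of_curvatureBound hasDerivAt_phase35
    measurableSet_Ioi (convex_Ioi 0) (by norm_num) hm
    (fun ξ hξ => weight35_ne_zero (ne_of_gt hξ)) curvatureBound_weight35_Ioi
  obtain ⟨C₂, h₂⟩ := exists_hasExtensionBound_of_curvatureBound hasDerivAt_phase35
    measurableSet_Ioi.neg (convex_Ioi 0).neg (by norm_num) hm
    (fun ξ hξ => weight35_ne_zero (neg_ne_zero.1 (ne_of_gt hξ)))
    (curvatureBound_weight35_Ioi.neg weight35_neg fun ξ => by ring)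
  refine ⟨C₁ + C₂, (h₁.union h₂ hm measurable_phase35 measurableSet_Ioi).of_ae_mem
    (measurableSet_Ioi.union measurableSet_Ioi.neg) ?_⟩
  filter_upwards [Measure.ae_ne volume 0] with ξ hξ
  exact (lt_or_gt_of_ne hξ).symm.imp id neg_pos.2

theorem isExtension_schrodinger (f : L2R) :
    IsExtension schrodingerWeight schrodingerPhase f (schrodinger f) :=
  let ⟨_, hC⟩ := exists_hasExtensionBound_schrodinger
  isExtension_extension hC continuous_schrodingerWeight measurable_schrodingerPhase f

theorem isExtension_extension35 (f : L2R) : IsExtension weight35 phase35 f (extension35 f) :=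
  let ⟨_, hC⟩ := exists_hasExtensionBound_weight35
  isExtension_extension hC continuous_weight35 measurable_phase35 f

end ConcreteWeights

section VanDerCorput

variable {Ψ Ψ' Ψ'' : ℝ → ℝ} {a b l : ℝ} {S : Set ℝ} {F : ℝ → ℂ}

theorem norm_integral_cis_le_length (Ψ : ℝ → ℝ) (hab : a ≤ b) :
    ‖∫ η in a..b, cis(Ψ η)‖ ≤ b - a := by
  simpa [abs_of_nonneg (sub_nonneg.2 hab)] using
    intervalIntegral.norm_integral_le_of_norm_le_const (a := a) (b := b) (C := 1)
      fun η _ => (norm_cis (Ψ η)).le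

theorem integral_cis_eq_of_deriv_ne_zero (hΨ : ∀ η, HasDerivAt Ψ (Ψ' η) η)
    (hΨ' : ∀ η, HasDerivAt Ψ' (Ψ'' η) η) (hΨ'' : Continuous Ψ'')
    (hne : ∀ η ∈ Set.uIcc a b, Ψ' η ≠ 0) :
    ∫ η in a..b, cis(Ψ η) =
      ((Ψ' b)⁻¹ : ℝ) * (-Complex.I * cis(Ψ b)) - ((Ψ' a)⁻¹ : ℝ) * (-Complex.I * cis(Ψ a))
        - ∫ η in a..b, (-Ψ'' η / Ψ' η ^ 2 : ℝ) * (-Complex.I * cis(Ψ η)) := by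
  have hΨc : Continuous Ψ := continuous_iff_continuousAt.2 fun η => (hΨ η).continuousAt
  have hΨ'c : Continuous Ψ' := continuous_iff_continuousAt.2 fun η => (hΨ' η).continuousAt
  have hinv : ∀ η ∈ Set.uIcc a b, HasDerivAt (fun η => ((Ψ' η)⁻¹ : ℝ) : ℝ → ℂ)
      ((-Ψ'' η / Ψ' η ^ 2 : ℝ) : ℂ) η := fun η hη => ((hΨ' η).inv (hne η hη)).ofReal_comp
  have hexp : ∀ η ∈ Set.uIcc a b, HasDerivAt (fun η => -Complex.I * cis(Ψ η))
      (Ψ' η * cis(Ψ η)) η := fun η _ => by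
    refine (((hΨ η).ofReal_comp.const_mul Complex.I).cexp.const_mul (-Complex.I)).congr_deriv ?_
    linear_combination (-(Ψ' η : ℂ) * cis(Ψ η)) * Complex.I_mul_I
  have hinvc : ContinuousOn (fun η => -Ψ'' η / Ψ' η ^ 2) (Set.uIcc a b) :=
    ContinuousOn.div (by fun_prop) (by fun_prop) fun η hη => pow_ne_zero 2 (hne η hη)
  rw [← intervalIntegral.integral_mul_deriv_eq_deriv_mul hinv hexp
    (Complex.continuous_ofReal.comp_continuousOn hinvc).intervalIntegrable
    (Continuous.intervalIntegrable (by fun_prop) a b)]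
  refine intervalIntegral.integral_congr fun η hη => ?_
  have hη0 : (Ψ' η : ℂ) ≠ 0 := mod_cast hne η hη
  simp only [Complex.ofReal_inv]
  field_simp

theorem norm_integral_deriv_inv_mul_le {μ : ℝ} (hΨ' : ∀ η, HasDerivAt Ψ' (Ψ'' η) η)
    (hΨ'' : Continuous Ψ'') (hab : a ≤ b) (hμ : 0 < μ) (hle : ∀ η ∈ Set.Icc a b, μ ≤ Ψ' η)
    (hnonneg : ∀ η ∈ Set.Icc a b, 0 ≤ Ψ'' η) {g : ℝ → ℂ} (hg : ∀ η, ‖g η‖ = 1) :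
    ‖∫ η in a..b, (-Ψ'' η / Ψ' η ^ 2 : ℝ) * g η‖ ≤ 1 / μ := by
  have hne : ∀ η ∈ Set.uIcc a b, Ψ' η ≠ 0 := fun η hη =>
    (hμ.trans_le (hle η (by rwa [Set.uIcc_of_le hab] at hη))).ne'
  have hΨ'c : Continuous Ψ' := continuous_iff_continuousAt.2 fun η => (hΨ' η).continuousAt
  have hfint : IntervalIntegrable (fun η => -Ψ'' η / Ψ' η ^ 2) volume a b :=
    (ContinuousOn.div (by fun_prop) (by fun_prop)
      fun η hη => pow_ne_zero 2 (hne η hη)).intervalIntegrable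
  calc ‖∫ η in a..b, (-Ψ'' η / Ψ' η ^ 2 : ℝ) * g η‖
      ≤ ∫ η in a..b, -(-Ψ'' η / Ψ' η ^ 2) := by
        refine intervalIntegral.norm_integral_le_of_norm_le hab
          (Eventually.of_forall fun η hη => ?_) hfint.neg
        have hη0 := hnonneg η (Set.Ioc_subset_Icc_self hη)
        rw [norm_mul, hg, mul_one, Complex.norm_real, Real.norm_eq_abs, neg_div, abs_neg, neg_neg,
          abs_of_nonneg (by positivity)]
    _ = (Ψ' a)⁻¹ - (Ψ' b)⁻¹ := by
        rw [intervalIntegral.integral_neg, intervalIntegral.integral_eq_sub_of_hasDerivAt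
          (fun η hη => (hΨ' η).inv (hne η hη)) hfint, Pi.inv_apply, Pi.inv_apply, neg_sub]
    _ ≤ 1 / μ := by
        have ha : (Ψ' a)⁻¹ ≤ 1 / μ := by
          rw [one_div]
          exact inv_anti₀ hμ (hle a (Set.left_mem_Icc.2 hab))
        have hb : 0 ≤ (Ψ' b)⁻¹ := inv_nonneg.2 (hμ.le.trans (hle b (Set.right_mem_Icc.2 hab)))
        linarith

theorem norm_integral_cis_le_of_le_deriv {μ : ℝ} (hΨ : ∀ η, HasDerivAt Ψ (Ψ' η) η)
    (hΨ' : ∀ η, HasDerivAt Ψ' (Ψ'' η) η) (hΨ'' : Continuous Ψ'') (hab : a ≤ b) (hμ : 0 < μ)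
    (hle : ∀ η ∈ Set.Icc a b, μ ≤ Ψ' η) (hnonneg : ∀ η ∈ Set.Icc a b, 0 ≤ Ψ'' η) :
    ‖∫ η in a..b, cis(Ψ η)‖ ≤ 3 / μ := by
  have hunit : ∀ η, ‖-Complex.I * cis(Ψ η)‖ = 1 := fun η => by
    rw [norm_mul, norm_neg, Complex.norm_I, norm_cis, one_mul]
  have hboundary : ∀ η ∈ Set.Icc a b,
      ‖((Ψ' η)⁻¹ : ℝ) * (-Complex.I * cis(Ψ η))‖ ≤ 1 / μ := fun η hη => by
    rw [norm_mul, hunit, mul_one, Complex.norm_real, Real.norm_of_nonneg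
      (inv_nonneg.2 (hμ.le.trans (hle η hη))), one_div]
    exact inv_anti₀ hμ (hle η hη)
  rw [integral_cis_eq_of_deriv_ne_zero hΨ hΨ' hΨ'' fun η hη =>
    (hμ.trans_le (hle η (by rwa [Set.uIcc_of_le hab] at hη))).ne']
  refine (norm_sub_le _ _).trans ((add_le_add ((norm_sub_le _ _).trans (add_le_add
    (hboundary b (Set.right_mem_Icc.2 hab)) (hboundary a (Set.left_mem_Icc.2 hab))))
    (norm_integral_deriv_inv_mul_le hΨ' hΨ'' hab hμ hle hnonneg hunit)).trans_eq ?_)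
  ring

theorem norm_integral_cis_le_of_deriv_nonneg {δ : ℝ} (hΨ : ∀ η, HasDerivAt Ψ (Ψ' η) η)
    (hΨ' : ∀ η, HasDerivAt Ψ' (Ψ'' η) η) (hΨ'' : Continuous Ψ'') (hab : a ≤ b) (hl : 0 < l)
    (hδ : 0 < δ) (ha : 0 ≤ Ψ' a) (hle : ∀ η ∈ Set.Icc a b, l ≤ Ψ'' η) :
    ‖∫ η in a..b, cis(Ψ η)‖ ≤ δ + 3 / (l * δ) := by
  have hΨc : Continuous Ψ := continuous_iff_continuousAt.2 fun η => (hΨ η).continuousAt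
  have hpos : 0 ≤ 3 / (l * δ) := by positivity
  rcases le_total b (a + δ) with hbδ | hbδ
  · exact (norm_integral_cis_le_length Ψ hab).trans (by linarith)
  have hgrow : ∀ η ∈ Set.Icc (a + δ) b, l * δ ≤ Ψ' η := fun η hη => by
    have haη : a ≤ η := by linarith [hη.1]
    have hmvt : l * (η - a) ≤ Ψ' η - Ψ' a :=
      (convex_Icc a b).mul_sub_le_image_sub_of_le_deriv
        (fun x _ => (hΨ' x).continuousAt.continuousWithinAt)
        (fun x _ => (hΨ' x).differentiableAt.differentiableWithinAt)
        (fun x hx => (hle x (interior_subset hx)).trans_eq (hΨ' x).deriv.symm)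
        a (Set.left_mem_Icc.2 hab) η ⟨haη, hη.2⟩ haη
    have hδη : l * δ ≤ l * (η - a) := by
      gcongr
      linarith [hη.1]
    linarith
  have hcis : Continuous fun η => cis(Ψ η) := by fun_prop
  rw [← intervalIntegral.integral_add_adjacent_intervals (hcis.intervalIntegrable a (a + δ))
    (hcis.intervalIntegrable (a + δ) b)]
  refine (norm_add_le _ _).trans (add_le_add ?_ ?_)
  · exact (norm_integral_cis_le_length Ψ (by linarith)).trans (by linarith)
  · exact norm_integral_cis_le_of_le_deriv hΨ hΨ' hΨ'' hbδ (by positivity) hgrow fun η hη =>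
      hl.le.trans (hle η ⟨by linarith [hη.1], hη.2⟩)

theorem norm_integral_cis_le_of_deriv_nonpos {δ : ℝ} (hΨ : ∀ η, HasDerivAt Ψ (Ψ' η) η)
    (hΨ' : ∀ η, HasDerivAt Ψ' (Ψ'' η) η) (hΨ'' : Continuous Ψ'') (hab : a ≤ b) (hl : 0 < l)
    (hδ : 0 < δ) (hb : Ψ' b ≤ 0) (hle : ∀ η ∈ Set.Icc a b, l ≤ Ψ'' η) :
    ‖∫ η in a..b, cis(Ψ η)‖ ≤ δ + 3 / (l * δ) := by
  have hreflect : ∀ η, HasDerivAt (fun η => Ψ (-η)) (-Ψ' (-η)) η := fun η => by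
    simpa using! (hΨ (-η)).comp η (hasDerivAt_neg η)
  have hreflect' : ∀ η, HasDerivAt (fun η => -Ψ' (-η)) (Ψ'' (-η)) η := fun η => by
    simpa using! ((hΨ' (-η)).comp η (hasDerivAt_neg η)).neg
  have hbound := norm_integral_cis_le_of_deriv_nonneg (a := -b) (b := -a) hreflect hreflect'
    (hΨ''.comp continuous_neg) (neg_le_neg hab) hl hδ (by simpa using hb) fun η hη =>
      hle (-η) ⟨le_neg.1 hη.2, neg_le.1 hη.1⟩
  rwa [intervalIntegral.integral_comp_neg fun η => cis(Ψ η), neg_neg, neg_neg] at hbound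

theorem norm_integral_cis_le_of_le_deriv_deriv {δ : ℝ} (hΨ : ∀ η, HasDerivAt Ψ (Ψ' η) η)
    (hΨ' : ∀ η, HasDerivAt Ψ' (Ψ'' η) η) (hΨ'' : Continuous Ψ'') (hab : a ≤ b) (hl : 0 < l)
    (hδ : 0 < δ) (hle : ∀ η ∈ Set.Icc a b, l ≤ Ψ'' η) :
    ‖∫ η in a..b, cis(Ψ η)‖ ≤ 2 * (δ + 3 / (l * δ)) := by
  have hpos : 0 ≤ δ + 3 / (l * δ) := by positivity
  rcases le_total 0 (Ψ' a) with ha | ha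
  · exact (norm_integral_cis_le_of_deriv_nonneg hΨ hΨ' hΨ'' hab hl hδ ha hle).trans (by linarith)
  rcases le_total (Ψ' b) 0 with hb | hb
  · exact (norm_integral_cis_le_of_deriv_nonpos hΨ hΨ' hΨ'' hab hl hδ hb hle).trans (by linarith)
  obtain ⟨c, hc, hc0⟩ := intermediate_value_Icc hab
    (fun η _ => (hΨ' η).continuousAt.continuousWithinAt) ⟨ha, hb⟩
  have hcis : Continuous fun η => cis(Ψ η) := by
    have hΨc : Continuous Ψ := continuous_iff_continuousAt.2 fun η => (hΨ η).continuousAt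
    fun_prop
  rw [← intervalIntegral.integral_add_adjacent_intervals (hcis.intervalIntegrable a c)
    (hcis.intervalIntegrable c b), two_mul]
  exact (norm_add_le _ _).trans (add_le_add
    (norm_integral_cis_le_of_deriv_nonpos hΨ hΨ' hΨ'' hc.1 hl hδ hc0.le fun η hη =>
      hle η ⟨hη.1, hη.2.trans hc.2⟩)
    (norm_integral_cis_le_of_deriv_nonneg hΨ hΨ' hΨ'' hc.2 hl hδ hc0.ge fun η hη =>
      hle η ⟨hc.1.trans hη.1, hη.2⟩))

/-- `Ψ` is twice continuously differentiable on the line, with derivatives `Ψ'` and `Ψ''`, and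
`|Ψ''| ≥ l` on `S`: the hypothesis of the second derivative test. -/
structure CurvedPhase (Ψ Ψ' Ψ'' : ℝ → ℝ) (S : Set ℝ) (l : ℝ) : Prop where
  hasDerivAt : ∀ η, HasDerivAt Ψ (Ψ' η) η
  hasDerivAt_deriv : ∀ η, HasDerivAt Ψ' (Ψ'' η) η
  continuous_deriv_deriv : Continuous Ψ''
  le_abs : ∀ η ∈ S, l ≤ |Ψ'' η|

namespace CurvedPhase

theorem continuous (h : CurvedPhase Ψ Ψ' Ψ'' S l) : Continuous Ψ :=
  continuous_iff_continuousAt.2 fun η => (h.hasDerivAt η).continuousAt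

theorem mono (h : CurvedPhase Ψ Ψ' Ψ'' S l) {T : Set ℝ} (hTS : T ⊆ S) :
    CurvedPhase Ψ Ψ' Ψ'' T l :=
  { h with le_abs := fun η hη => h.le_abs η (hTS hη) }

theorem linear_add_const_mul (h : CurvedPhase Ψ Ψ' Ψ'' S l) (y s : ℝ) :
    CurvedPhase (fun η => y * η + s * Ψ η) (fun η => y + s * Ψ' η) (fun η => s * Ψ'' η) S
      (|s| * l) where
  hasDerivAt η := by
    simpa using! ((hasDerivAt_id η).const_mul y).add ((h.hasDerivAt η).const_mul s)
  hasDerivAt_deriv η := ((h.hasDerivAt_deriv η).const_mul s).const_add y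
  continuous_deriv_deriv := h.continuous_deriv_deriv.const_mul s
  le_abs η hη := by
    rw [abs_mul]
    exact mul_le_mul_of_nonneg_left (h.le_abs η hη) (abs_nonneg s)

theorem norm_integral_cis_le_add {δ : ℝ} (h : CurvedPhase Ψ Ψ' Ψ'' (Set.Icc a b) l) (hab : a ≤ b)
    (hl : 0 < l) (hδ : 0 < δ) : ‖∫ η in a..b, cis(Ψ η)‖ ≤ 2 * (δ + 3 / (l * δ)) := by
  have hne : ∀ η ∈ Set.Icc a b, Ψ'' η ≠ 0 := fun η hη =>
    abs_pos.1 (hl.trans_le (h.le_abs η hη))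
  rcases hasDerivWithinAt_forall_lt_or_forall_gt_of_forall_ne (convex_Icc a b)
    (fun η _ => (h.hasDerivAt_deriv η).hasDerivWithinAt) hne with hneg | hpos
  · have hconj := norm_integral_cis_le_of_le_deriv_deriv (fun η => (h.hasDerivAt η).neg)
      (fun η => (h.hasDerivAt_deriv η).neg) h.continuous_deriv_deriv.neg hab hl hδ
      fun η hη => (h.le_abs η hη).trans_eq (abs_of_neg (hneg η hη))
    refine le_of_eq_of_le ?_ hconj
    rw [← RCLike.norm_conj, intervalIntegral.integral_of_le hab,
      intervalIntegral.integral_of_le hab, ← integral_conj]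
    simp [← Complex.exp_conj]
  · exact norm_integral_cis_le_of_le_deriv_deriv h.hasDerivAt h.hasDerivAt_deriv
      h.continuous_deriv_deriv hab hl hδ
      fun η hη => (h.le_abs η hη).trans_eq (abs_of_pos (hpos η hη))

theorem norm_integral_cis_le (h : CurvedPhase Ψ Ψ' Ψ'' (Set.Icc a b) l) (hab : a ≤ b)
    (hl : 0 < l) : ‖∫ η in a..b, cis(Ψ η)‖ ≤ 8 / Real.sqrt l := by
  have hsqrt : 0 < Real.sqrt l := Real.sqrt_pos.2 hl
  refine (h.norm_integral_cis_le_add hab hl (inv_pos.2 hsqrt)).trans_eq ?_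
  nth_rewrite 2 [← Real.mul_self_sqrt hl.le]
  field_simp
  norm_num

theorem norm_integral_mul_cis_le (h : CurvedPhase Ψ Ψ' Ψ'' (Set.Icc a b) l) (hab : a ≤ b)
    (hl : 0 < l) (hF : ContDiff ℝ 1 F) :
    ‖∫ η in a..b, F η * cis(Ψ η)‖ ≤
      8 / Real.sqrt l * (‖F b‖ + ∫ η in a..b, ‖deriv F η‖) := by
  have hcis : Continuous fun η => cis(Ψ η) := by
    have hΨ := h.continuous
    fun_prop
  have hF' : Continuous (deriv F) := hF.continuous_deriv le_rfl
  set v : ℝ → ℂ := fun η => ∫ x in a..η, cis(Ψ x)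
  have hvle : ∀ η ∈ Set.Icc a b, ‖v η‖ ≤ 8 / Real.sqrt l := fun η hη =>
    (h.mono (Set.Icc_subset_Icc_right hη.2)).norm_integral_cis_le hη.1 hl
  have hv : ∀ η, HasDerivAt v cis(Ψ η) η := fun η =>
    intervalIntegral.integral_hasDerivAt_right (hcis.intervalIntegrable _ _)
      (hcis.stronglyMeasurableAtFilter _ _) hcis.continuousAt
  have hva : v a = 0 := intervalIntegral.integral_same
  rw [intervalIntegral.integral_mul_deriv_eq_deriv_mul
    (fun η _ => (hF.differentiable one_ne_zero η).hasDerivAt) (fun η _ => hv η)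
    (hF'.intervalIntegrable _ _) (hcis.intervalIntegrable _ _), hva, mul_zero, sub_zero, mul_add]
  refine (norm_sub_le _ _).trans (add_le_add ?_ ?_)
  · rw [norm_mul, mul_comm]
    exact mul_le_mul_of_nonneg_right (hvle b (Set.right_mem_Icc.2 hab)) (norm_nonneg _)
  · rw [← intervalIntegral.integral_const_mul]
    refine intervalIntegral.norm_integral_le_of_norm_le hab (Eventually.of_forall fun η hη => ?_)
      ((hF'.norm.const_mul _).intervalIntegrable _ _)
    rw [norm_mul, mul_comm]
    exact mul_le_mul_of_nonneg_right (hvle η (Set.Ioc_subset_Icc_self hη)) (norm_nonneg _)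

theorem sq_mul_norm_oscIntegral_pow_four_le {K : ℝ}
    (h : CurvedPhase Ψ Ψ' Ψ'' (Set.Icc (-K) K) l) (hK : 0 ≤ K) (hl : 0 < l)
    (hF : ContDiff ℝ 1 F) (hFK : ∀ η, K ≤ |η| → F η = 0) (p : ℝ × ℝ) :
    p.1 ^ 2 * ‖oscIntegral Ψ F p‖ ^ 4 ≤ (8 * ∫ η in (-K)..K, ‖deriv F η‖) ^ 4 / l ^ 2 := by
  rcases eq_or_ne p.1 0 with hp | hp
  · rw [hp, zero_pow two_ne_zero, zero_mul]
    positivity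
  have hKK : -K ≤ K := neg_le_self hK
  have hpl : 0 < |p.1| * l := mul_pos (abs_pos.2 hp) hl
  have hosc : oscIntegral Ψ F p = ∫ η in (-K)..K, F η * cis(p.2 * η + p.1 * Ψ η) := by
    rw [intervalIntegral.integral_of_le hKK]
    refine (setIntegral_eq_integral_of_forall_compl_eq_zero fun η hη => ?_).symm
    rw [hFK η, zero_mul]
    contrapose! hη
    exact ⟨(abs_lt.1 hη).1, (abs_lt.1 hη).2.le⟩
  have hbound := (h.linear_add_const_mul p.2 p.1).norm_integral_mul_cis_le hKK hpl hF
  rw [← hosc, hFK K (le_abs_self K), norm_zero, zero_add] at hbound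
  have hsqrt : Real.sqrt (|p.1| * l) ^ 4 = p.1 ^ 2 * l ^ 2 := by
    rw [show 4 = 2 * 2 from rfl, pow_mul, Real.sq_sqrt hpl.le, mul_pow, sq_abs]
  calc p.1 ^ 2 * ‖oscIntegral Ψ F p‖ ^ 4
      ≤ p.1 ^ 2 * (8 / Real.sqrt (|p.1| * l) * ∫ η in (-K)..K, ‖deriv F η‖) ^ 4 := by gcongr
    _ = _ := by
      rw [mul_pow, div_pow, hsqrt]
      field_simp

end CurvedPhase

end VanDerCorput

section PhaseConvergence

variable {φ ψ : ℝ → ℝ} {F : ℝ → ℂ} {c : ℝ}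

theorem norm_oscIntegral_le (φ : ℝ → ℝ) (a : ℝ → ℂ) (p : ℝ × ℝ) :
    ‖oscIntegral φ a p‖ ≤ ∫ ξ, ‖a ξ‖ :=
  (norm_integral_le_integral_norm _).trans_eq <| by
    simp only [norm_mul, norm_cis, mul_one]

theorem exists_forall_norm_oscIntegral_pow_four_le {K l : ℝ} (hK : 0 ≤ K) (hl : 0 < l)
    (hF : ContDiff ℝ 1 F) (hFK : ∀ η, K ≤ |η| → F η = 0) :
    ∃ c, ∀ {ψ ψ' ψ'' : ℝ → ℝ}, CurvedPhase ψ ψ' ψ'' (Set.Icc (-K) K) l →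
      ∀ p : ℝ × ℝ, (1 + p.1 ^ 2) * ‖oscIntegral ψ F p‖ ^ 4 ≤ c := by
  refine ⟨(∫ ξ, ‖F ξ‖) ^ 4 + (8 * ∫ η in (-K)..K, ‖deriv F η‖) ^ 4 / l ^ 2, fun h p => ?_⟩
  rw [add_mul, one_mul]
  exact add_le_add (pow_le_pow_left₀ (norm_nonneg _) (norm_oscIntegral_le _ F p) 4)
    (h.sq_mul_norm_oscIntegral_pow_four_le hK hl hF hFK p)

theorem enorm_sub_pow_six_le {a b : ℂ} {s : ℝ} (ha : (1 + s ^ 2) * ‖a‖ ^ 4 ≤ c)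
    (hb : (1 + s ^ 2) * ‖b‖ ^ 4 ≤ c) :
    ‖a - b‖ₑ ^ 6 ≤ ENNReal.ofReal (16 * c * (1 + s ^ 2)⁻¹) * ‖a - b‖ₑ ^ 2 := by
  have hpow : ‖a - b‖ ^ 4 ≤ 8 * (‖a‖ ^ 4 + ‖b‖ ^ 4) :=
    (pow_le_pow_left₀ (norm_nonneg _) (norm_sub_le a b) 4).trans <| by
      have := add_pow_le (norm_nonneg a) (norm_nonneg b) 4
      norm_num at this
      exact this
  have hfour : ‖a - b‖ ^ 4 ≤ 16 * c * (1 + s ^ 2)⁻¹ := by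
    rw [← div_eq_mul_inv, le_div_iff₀ (by positivity)]
    have := mul_le_mul_of_nonneg_right hpow (by positivity : (0 : ℝ) ≤ 1 + s ^ 2)
    linarith
  have hsix : ‖a - b‖ₑ ^ 6 = ENNReal.ofReal (‖a - b‖ ^ 4) * ‖a - b‖ₑ ^ 2 := by
    rw [ENNReal.ofReal_pow (norm_nonneg _), ofReal_norm, ← pow_add]
  rw [hsix]
  gcongr

/-- `F(ξ) (e^{isφ(ξ)} - e^{isψ(ξ)})`, whose Fourier integral is the difference at time `s` of the
oscillatory integrals with phases `φ` and `ψ`. -/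
def phaseDefect (φ ψ : ℝ → ℝ) (F : ℝ → ℂ) (s ξ : ℝ) : ℂ := F ξ * (cis(s * φ ξ) - cis(s * ψ ξ))

theorem measurable_phaseDefect (hφ : Measurable φ) (hψ : Measurable ψ) (hF : Measurable F)
    (s : ℝ) : Measurable (phaseDefect φ ψ F s) := by
  unfold phaseDefect
  fun_prop

theorem norm_phaseDefect_le (φ ψ : ℝ → ℝ) (F : ℝ → ℂ) (s ξ : ℝ) :
    ‖phaseDefect φ ψ F s ξ‖ ≤ 2 * ‖F ξ‖ := by
  rw [phaseDefect, norm_mul, mul_comm]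
  gcongr
  refine (norm_sub_le _ _).trans_eq ?_
  rw [norm_cis, norm_cis]
  norm_num

theorem enorm_phaseDefect_sq_le (φ ψ : ℝ → ℝ) (F : ℝ → ℂ) (s ξ : ℝ) :
    ‖phaseDefect φ ψ F s ξ‖ₑ ^ 2 ≤ ‖2 * F ξ‖ₑ ^ 2 := by
  gcongr
  rw [enorm_le_iff_norm_le, norm_mul, RCLike.norm_ofNat]
  exact norm_phaseDefect_le φ ψ F s ξ

theorem lintegral_two_mul_enorm_sq_ne_top (hF : MemLp F 2) : ∫⁻ ξ, ‖2 * F ξ‖ₑ ^ 2 ≠ ⊤ := by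
  rw [← eLpNorm_two_sq]
  exact ENNReal.pow_ne_top (hF.const_mul 2).2.ne

theorem oscIntegral_sub_eq_integral_phaseDefect (hφ : Measurable φ) (hψ : Measurable ψ)
    (hF : Integrable F) (s y : ℝ) :
    oscIntegral φ F (s, y) - oscIntegral ψ F (s, y) =
      ∫ ξ, phaseDefect φ ψ F s ξ * cis(y * ξ) := by
  simp only [oscIntegral, phaseDefect]
  rw [← integral_sub (integrable_mul_cis hF (by fun_prop)) (integrable_mul_cis hF (by fun_prop))]
  congr 1
  ext ξ
  rw [cis_add, cis_add]
  ring

theorem lintegral_enorm_oscIntegral_sub_pow_six_le (hφ : Measurable φ) (hψ : Measurable ψ)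
    (hF : Measurable F) (hFi : Integrable F)
    (hφc : ∀ p : ℝ × ℝ, (1 + p.1 ^ 2) * ‖oscIntegral φ F p‖ ^ 4 ≤ c)
    (hψc : ∀ p : ℝ × ℝ, (1 + p.1 ^ 2) * ‖oscIntegral ψ F p‖ ^ 4 ≤ c) (s : ℝ) :
    ∫⁻ y, ‖oscIntegral φ F (s, y) - oscIntegral ψ F (s, y)‖ₑ ^ 6 ≤
      ENNReal.ofReal (16 * c * (1 + s ^ 2)⁻¹) *
        (ENNReal.ofReal (2 * Real.pi) * ∫⁻ ξ, ‖phaseDefect φ ψ F s ξ‖ₑ ^ 2) := by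
  have hfint : Integrable (phaseDefect φ ψ F s) :=
    (hFi.norm.const_mul 2).mono' (measurable_phaseDefect hφ hψ hF s).aestronglyMeasurable
      (Eventually.of_forall (norm_phaseDefect_le φ ψ F s))
  calc ∫⁻ y, ‖oscIntegral φ F (s, y) - oscIntegral ψ F (s, y)‖ₑ ^ 6
      ≤ ∫⁻ y, ENNReal.ofReal (16 * c * (1 + s ^ 2)⁻¹) *
          ‖oscIntegral φ F (s, y) - oscIntegral ψ F (s, y)‖ₑ ^ 2 :=
        lintegral_mono fun y => enorm_sub_pow_six_le (hφc (s, y)) (hψc (s, y))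
    _ = ENNReal.ofReal (16 * c * (1 + s ^ 2)⁻¹) *
          ∫⁻ y, ‖∫ ξ, phaseDefect φ ψ F s ξ * cis(y * ξ)‖ₑ ^ 2 := by
        simp_rw [lintegral_const_mul' _ _ ENNReal.ofReal_ne_top,
          oscIntegral_sub_eq_integral_phaseDefect hφ hψ hFi]
    _ ≤ _ := by
        gcongr
        exact lintegral_enorm_sq_integral_mul_cis_le hfint

variable {ι : Type*} {L : Filter ι} [L.IsCountablyGenerated] {φ : ι → ℝ → ℝ}

theorem tendsto_lintegral_enorm_phaseDefect_sq (hφ : ∀ N, Measurable (φ N)) (hψ : Measurable ψ)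
    (hF : Measurable F) (hF2 : MemLp F 2) (hlim : ∀ ξ, Tendsto (fun N => φ N ξ) L (𝓝 (ψ ξ)))
    (s : ℝ) : Tendsto (fun N => ∫⁻ ξ, ‖phaseDefect (φ N) ψ F s ξ‖ₑ ^ 2) L (𝓝 0) := by
  rw [← lintegral_zero (μ := (volume : Measure ℝ))]
  refine tendsto_lintegral_filter_of_dominated_convergence (fun ξ => ‖2 * F ξ‖ₑ ^ 2)
    (Eventually.of_forall fun N => (measurable_phaseDefect (hφ N) hψ hF s).enorm.pow_const 2)
    (Eventually.of_forall fun N => Eventually.of_forall (enorm_phaseDefect_sq_le (φ N) ψ F s))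
    (lintegral_two_mul_enorm_sq_ne_top hF2) (Eventually.of_forall fun ξ => ?_)
  have hcont : Continuous fun x : ℝ => F ξ * (cis(s * x) - cis(s * ψ ξ)) := by fun_prop
  have hdefect : Tendsto (fun N => phaseDefect (φ N) ψ F s ξ) L (𝓝 0) := by
    simpa [phaseDefect, Function.comp_def] using! (hcont.tendsto (ψ ξ)).comp (hlim ξ)
  simpa using ENNReal.Tendsto.pow (n := 2) hdefect.enorm

theorem tendsto_lintegral_enorm_oscIntegral_sub_pow_six (hφ : ∀ N, Measurable (φ N))
    (hψ : Measurable ψ) (hF : Measurable F) (hFi : Integrable F) (hF2 : MemLp F 2)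
    (hφc : ∀ᶠ N in L, ∀ p : ℝ × ℝ, (1 + p.1 ^ 2) * ‖oscIntegral (φ N) F p‖ ^ 4 ≤ c)
    (hψc : ∀ p : ℝ × ℝ, (1 + p.1 ^ 2) * ‖oscIntegral ψ F p‖ ^ 4 ≤ c)
    (hlim : ∀ ξ, Tendsto (fun N => φ N ξ) L (𝓝 (ψ ξ))) (s : ℝ) :
    Tendsto (fun N => ∫⁻ y, ‖oscIntegral (φ N) F (s, y) - oscIntegral ψ F (s, y)‖ₑ ^ 6) L
      (𝓝 0) := by
  have hupper : Tendsto (fun N => ENNReal.ofReal (16 * c * (1 + s ^ 2)⁻¹) *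
      (ENNReal.ofReal (2 * Real.pi) * ∫⁻ ξ, ‖phaseDefect (φ N) ψ F s ξ‖ₑ ^ 2)) L (𝓝 0) := by
    simpa only [mul_zero] using ENNReal.Tendsto.const_mul (ENNReal.Tendsto.const_mul
      (tendsto_lintegral_enorm_phaseDefect_sq hφ hψ hF hF2 hlim s)
      (Or.inr ENNReal.ofReal_ne_top)) (Or.inr ENNReal.ofReal_ne_top)
  exact tendsto_of_tendsto_of_tendsto_of_le_of_le' tendsto_const_nhds hupper
    (Eventually.of_forall fun _ => zero_le) (hφc.mono fun N hN =>
      lintegral_enorm_oscIntegral_sub_pow_six_le (hφ N) hψ hF hFi hN hψc s)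

theorem tendsto_eLpNorm_oscIntegral_sub (hφ : ∀ N, Measurable (φ N)) (hψ : Measurable ψ)
    (hF : Measurable F) (hFi : Integrable F) (hF2 : MemLp F 2)
    (hφc : ∀ᶠ N in L, ∀ p : ℝ × ℝ, (1 + p.1 ^ 2) * ‖oscIntegral (φ N) F p‖ ^ 4 ≤ c)
    (hψc : ∀ p : ℝ × ℝ, (1 + p.1 ^ 2) * ‖oscIntegral ψ F p‖ ^ 4 ≤ c)
    (hlim : ∀ ξ, Tendsto (fun N => φ N ξ) L (𝓝 (ψ ξ))) :
    Tendsto (fun N => eLpNorm (oscIntegral (φ N) F - oscIntegral ψ F) 6) L (𝓝 0) := by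
  have hmeas : ∀ N, Measurable fun p => ‖oscIntegral (φ N) F p - oscIntegral ψ F p‖ₑ ^ 6 :=
    fun N => ((stronglyMeasurable_oscIntegral (hφ N) hF).sub
      (stronglyMeasurable_oscIntegral hψ hF)).measurable.enorm.pow_const 6
  refine tendsto_eLpNorm_zero_of_lintegral (n := 6) (by norm_num) ?_
  simp_rw [Measure.volume_eq_prod, Pi.sub_apply, lintegral_prod _ (hmeas _).aemeasurable]
  rw [← lintegral_zero (μ := (volume : Measure ℝ))]
  refine tendsto_lintegral_filter_of_dominated_convergence
    (fun s => ENNReal.ofReal (16 * c * (1 + s ^ 2)⁻¹) *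
      (ENNReal.ofReal (2 * Real.pi) * ∫⁻ ξ, ‖2 * F ξ‖ₑ ^ 2))
    (Eventually.of_forall fun N => (hmeas N).lintegral_prod_right')
    (hφc.mono fun N hN => Eventually.of_forall fun s =>
      (lintegral_enorm_oscIntegral_sub_pow_six_le (hφ N) hψ hF hFi hN hψc s).trans ?_) ?_
    (Eventually.of_forall
      (tendsto_lintegral_enorm_oscIntegral_sub_pow_six hφ hψ hF hFi hF2 hφc hψc hlim))
  · exact mul_le_mul_right (mul_le_mul_right
      (lintegral_mono (enorm_phaseDefect_sq_le (φ N) ψ F s)) _) _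
  · have hconst : ENNReal.ofReal (2 * Real.pi) * ∫⁻ ξ, ‖2 * F ξ‖ₑ ^ 2 ≠ ⊤ :=
      ENNReal.mul_ne_top ENNReal.ofReal_ne_top (lintegral_two_mul_enorm_sq_ne_top hF2)
    rw [lintegral_mul_const' _ _ hconst]
    exact ENNReal.mul_ne_top
      (integrable_inv_one_add_sq.const_mul (16 * c)).lintegral_lt_top.ne hconst

end PhaseConvergence

instance isCountablyGenerated_cobounded {E : Type*} [SeminormedAddGroup E] :
    (Bornology.cobounded E).IsCountablyGenerated := by
  rw [← comap_norm_atTop]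
  infer_instance

section Boost

variable {N : ℝ}

/-- The Galilean boost `(s, y) ↦ (t, x)` to the frame in which the evolution with phase `phase35`
at frequencies near `N` looks like the Schrödinger evolution. -/
def boostMap (N : ℝ) (p : ℝ × ℝ) : ℝ × ℝ :=
  (-(10 * N ^ 3)⁻¹ * p.1, p.2 + (3 * N ^ 2 + 5 * N ^ 4) * (10 * N ^ 3)⁻¹ * p.1)

/-- The phase `xN + t (N³ + N⁵)` of the carrier wave of frequency `N`, in the coordinates
`(t, x) = boostMap N p`. -/
def carrierPhase (N : ℝ) (p : ℝ × ℝ) : ℝ := N * p.2 + (1 + 2 * N ^ 2) / 5 * p.1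

/-- The phase `phase35` around the frequency `N`, without its affine part and in the time scale of
`boostMap N`. -/
def profilePhase (N η : ℝ) : ℝ :=
  -(phase35 (N + η) - phase35 N - (3 * N ^ 2 + 5 * N ^ 4) * η) * (10 * N ^ 3)⁻¹

theorem measurable_boostMap (N : ℝ) : Measurable (boostMap N) := by
  unfold boostMap; fun_prop

theorem continuous_carrierPhase (N : ℝ) : Continuous (carrierPhase N) := by
  unfold carrierPhase; fun_prop

theorem measurable_profilePhase (N : ℝ) : Measurable (profilePhase N) := by
  unfold profilePhase phase35; fun_prop

theorem boostMap_neg (N : ℝ) (p : ℝ × ℝ) : boostMap (-N) p = boostMap N (-p.1, p.2) := by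
  have hcube : (10 * (-N) ^ 3)⁻¹ = -(10 * N ^ 3)⁻¹ := by rw [← inv_neg]; congr 1; ring
  ext <;> simp only [boostMap, hcube] <;> ring

theorem carrierPhase_neg (N : ℝ) (p : ℝ × ℝ) :
    carrierPhase (-N) p = -carrierPhase N (-p.1, p.2) := by
  simp only [carrierPhase]; ring

theorem map_shear_scale {a : ℝ} (ha : a ≠ 0) (b : ℝ) :
    Measure.map (fun p : ℝ × ℝ => (a * p.1, p.2 + b * p.1)) volume =
      ENNReal.ofReal |a⁻¹| • (volume : Measure (ℝ × ℝ)) := by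
  have hshear : Measurable fun p : ℝ × ℝ => (a * p.1, p.2 + b * p.1) := by fun_prop
  refine Measure.ext_of_lintegral _ fun f hf => ?_
  rw [lintegral_map hf hshear, lintegral_smul_measure, smul_eq_mul, Measure.volume_eq_prod,
    lintegral_prod (fun p : ℝ × ℝ => f (a * p.1, p.2 + b * p.1)) (hf.comp hshear).aemeasurable,
    lintegral_prod _ hf.aemeasurable,
    ← lintegral_comp_mul_left_real ha]
  exact lintegral_congr fun s => lintegral_add_right_eq_self (fun y => f (a * s, y)) (b * s)

theorem map_boostMap (hN : N ≠ 0) : Measure.map (boostMap N) volume =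
    ENNReal.ofReal (10 * |N| ^ 3) • (volume : Measure (ℝ × ℝ)) := by
  have hscale : |(-(10 * N ^ 3)⁻¹)⁻¹| = 10 * |N| ^ 3 := by
    rw [inv_neg, inv_inv, abs_neg, abs_mul, abs_pow, abs_of_pos (by norm_num : (0 : ℝ) < 10)]
  rw [← hscale]
  exact map_shear_scale (by simp [hN]) _

theorem sqrt_abs_pow_six (N : ℝ) : Real.sqrt |N| ^ 6 = |N| ^ 3 := by
  rw [show (6 : ℕ) = 2 * 3 from rfl, pow_mul, Real.sq_sqrt (abs_nonneg N)]

theorem cube_abs_rpow (N : ℝ) : (|N| ^ 3) ^ (1 / 6 : ℝ) = Real.sqrt |N| := by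
  rw [← sqrt_abs_pow_six, ← Real.rpow_natCast, ← Real.rpow_mul (Real.sqrt_nonneg _)]
  norm_num

theorem sqrt_abs_pos (hN : N ≠ 0) : 0 < Real.sqrt |N| := Real.sqrt_pos.2 (abs_pos.2 hN)

/-- A space-time function in the frame of `boostMap N`, divided by `√|N|`, the size of `weight35`
near `N`. -/
def rescale (N : ℝ) (u : ℝ × ℝ → ℂ) (p : ℝ × ℝ) : ℂ := (Real.sqrt |N| : ℂ)⁻¹ * u (boostMap N p)

theorem quasiMeasurePreserving_boostMap (hN : N ≠ 0) :
    Measure.QuasiMeasurePreserving (boostMap N) :=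
  ⟨measurable_boostMap N, by rw [map_boostMap hN]; exact Measure.smul_absolutelyContinuous⟩

theorem aestronglyMeasurable_rescale (hN : N ≠ 0) {u : ℝ × ℝ → ℂ} (hu : AEStronglyMeasurable u) :
    AEStronglyMeasurable (rescale N u) :=
  (hu.comp_quasiMeasurePreserving (quasiMeasurePreserving_boostMap hN)).const_mul _

theorem eLpNorm_rescale (hN : N ≠ 0) {u : ℝ × ℝ → ℂ} (hu : AEStronglyMeasurable u) :
    eLpNorm (rescale N u) 6 = ENNReal.ofReal (10 ^ (1 / 6 : ℝ)) * eLpNorm u 6 := by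
  have hcomp : eLpNorm (u ∘ boostMap N) 6 volume =
      ENNReal.ofReal (10 ^ (1 / 6 : ℝ) * Real.sqrt |N|) * eLpNorm u 6 := by
    rw [← eLpNorm_map_measure
        (hu.mono_ac (quasiMeasurePreserving_boostMap hN).absolutelyContinuous)
        (measurable_boostMap N).aemeasurable, map_boostMap hN,
      eLpNorm_smul_measure_of_ne_top (by norm_num), smul_eq_mul,
      ENNReal.ofReal_rpow_of_nonneg (by positivity) (by positivity), ← cube_abs_rpow,
      ← Real.mul_rpow (by norm_num) (by positivity)]
    norm_num
  have hscale : ‖(Real.sqrt |N| : ℂ)⁻¹‖ₑ = ENNReal.ofReal (Real.sqrt |N|)⁻¹ := by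
    rw [← ofReal_norm, norm_inv, Complex.norm_real, Real.norm_of_nonneg (Real.sqrt_nonneg _)]
  refine (eLpNorm_const_smul (Real.sqrt |N| : ℂ)⁻¹ (u ∘ boostMap N) 6 volume).trans ?_
  rw [hcomp, hscale, ← mul_assoc, ← ENNReal.ofReal_mul (by positivity), mul_left_comm,
    inv_mul_cancel₀ (sqrt_abs_pos hN).ne', mul_one]

theorem oscIntegral_comp_sub (φ : ℝ → ℝ) (F : ℝ → ℂ) (M : ℝ) (p : ℝ × ℝ) :
    oscIntegral φ (fun ξ => F (ξ - M)) p =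
      ∫ η, F η * cis(p.2 * (η + M) + p.1 * φ (η + M)) := by
  rw [oscIntegral, ← integral_add_right_eq_self _ M]
  simp only [add_sub_cancel_right]

theorem oscIntegral_phase35_boostMap (hN : N ≠ 0) (F : ℝ → ℂ) (p : ℝ × ℝ) :
    oscIntegral phase35 (fun ξ => F (ξ - N)) (boostMap N p) =
      cis(carrierPhase N p) * oscIntegral (profilePhase N) F p := by
  rw [oscIntegral_comp_sub, oscIntegral, ← integral_const_mul]
  refine integral_congr_ae (Eventually.of_forall fun η => ?_)
  have hphase : (boostMap N p).2 * (η + N) + (boostMap N p).1 * phase35 (η + N) =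
      carrierPhase N p + (p.2 * η + p.1 * profilePhase N η) := by
    simp only [boostMap, carrierPhase, profilePhase, phase35]
    field_simp
    ring
  simp only [hphase, cis_add]
  ring

end Boost

section ProfilePhase

variable {N K η : ℝ}

theorem profilePhase_eq (hN : N ≠ 0) (η : ℝ) : profilePhase N η =
    -((3 / 10 * N⁻¹ ^ 2 + 1) * η ^ 2 + (1 / 10 * N⁻¹ ^ 3 + N⁻¹) * η ^ 3
      + 1 / 2 * N⁻¹ ^ 2 * η ^ 4 + 1 / 10 * N⁻¹ ^ 3 * η ^ 5) := by
  simp only [profilePhase, phase35]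
  field_simp
  ring

theorem tendsto_profilePhase (η : ℝ) :
    Tendsto (fun N => profilePhase N η) (Bornology.cobounded ℝ) (𝓝 (schrodingerPhase η)) := by
  have hcont : Continuous fun z : ℝ => -((3 / 10 * z ^ 2 + 1) * η ^ 2
      + (1 / 10 * z ^ 3 + z) * η ^ 3 + 1 / 2 * z ^ 2 * η ^ 4 + 1 / 10 * z ^ 3 * η ^ 5) := by
    fun_prop
  have hlim := (hcont.tendsto 0).comp tendsto_inv₀_cobounded
  simp only [ne_eq, OfNat.ofNat_ne_zero, not_false_eq_true, zero_pow, mul_zero, zero_mul,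
    zero_add, one_mul, add_zero] at hlim
  refine hlim.congr' ?_
  filter_upwards [Bornology.eventually_ne_cobounded 0] with N hN
  exact (profilePhase_eq hN η).symm

theorem hasDerivAt_profilePhase (N η : ℝ) : HasDerivAt (profilePhase N)
    (-(3 * (N + η) ^ 2 + 5 * (N + η) ^ 4 - (3 * N ^ 2 + 5 * N ^ 4)) * (10 * N ^ 3)⁻¹) η := by
  have hlin : HasDerivAt (fun η => (3 * N ^ 2 + 5 * N ^ 4) * η) (3 * N ^ 2 + 5 * N ^ 4) η := by
    simpa using (hasDerivAt_id η).const_mul (3 * N ^ 2 + 5 * N ^ 4)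
  exact (((((hasDerivAt_phase35 (N + η)).comp_const_add N η).sub_const _).sub hlin).neg).mul_const _

theorem hasDerivAt_deriv_profilePhase (N η : ℝ) : HasDerivAt (fun η =>
      -(3 * (N + η) ^ 2 + 5 * (N + η) ^ 4 - (3 * N ^ 2 + 5 * N ^ 4)) * (10 * N ^ 3)⁻¹)
    (-(6 * (N + η) + 20 * (N + η) ^ 3) * (10 * N ^ 3)⁻¹) η := by
  have hshift : HasDerivAt (fun η => N + η) 1 η := (hasDerivAt_id η).const_add N
  have hderiv := (((((hshift.pow 2).const_mul 3).add ((hshift.pow 4).const_mul 5)).sub_const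
    (3 * N ^ 2 + 5 * N ^ 4)).neg).mul_const (10 * N ^ 3)⁻¹
  refine hderiv.congr_deriv ?_
  push_cast
  ring

theorem cube_abs_le_abs_add (x : ℝ) {a : ℝ} (ha : 0 ≤ a) : |x| ^ 3 ≤ |a * x + x ^ 3| := by
  have hfactor : a * x + x ^ 3 = x * (a + x ^ 2) := by ring
  rw [hfactor, abs_mul, abs_of_nonneg (by positivity : 0 ≤ a + x ^ 2), ← sq_abs x]
  nlinarith [mul_nonneg ha (abs_nonneg x)]

theorem half_cube_abs_le (hη : |η| ≤ |N| / 2) : (|N| / 2) ^ 3 ≤ |N + η| ^ 3 := by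
  have hadd := abs_sub_abs_le_abs_sub N (-η)
  rw [abs_neg, sub_neg_eq_add] at hadd
  exact pow_le_pow_left₀ (by positivity) (by linarith) 3

theorem curvedPhase_profilePhase (hN : N ≠ 0) (hNK : 2 * K ≤ |N|) :
    CurvedPhase (profilePhase N)
      (fun η => -(3 * (N + η) ^ 2 + 5 * (N + η) ^ 4 - (3 * N ^ 2 + 5 * N ^ 4)) * (10 * N ^ 3)⁻¹)
      (fun η => -(6 * (N + η) + 20 * (N + η) ^ 3) * (10 * N ^ 3)⁻¹) (Set.Icc (-K) K) (1 / 4) where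
  hasDerivAt := hasDerivAt_profilePhase N
  hasDerivAt_deriv := hasDerivAt_deriv_profilePhase N
  continuous_deriv_deriv := by fun_prop
  le_abs η hη := by
    have hηN : |η| ≤ |N| / 2 := (abs_le.2 hη).trans (by linarith)
    have hlower := cube_abs_le_abs_add (N + η) (a := 6 / 20) (by norm_num)
    have hcube := half_cube_abs_le hηN
    have hfactor : 6 * (N + η) + 20 * (N + η) ^ 3 =
        20 * (6 / 20 * (N + η) + (N + η) ^ 3) := by ring
    rw [neg_mul, abs_neg, abs_mul, abs_inv, abs_mul, abs_pow, ← div_eq_mul_inv,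
      abs_of_pos (by norm_num : (0 : ℝ) < 10),
      le_div_iff₀ (mul_pos (by norm_num) (pow_pos (abs_pos.2 hN) 3)), hfactor, abs_mul,
      abs_of_pos (by norm_num : (0 : ℝ) < 20)]
    nlinarith

theorem curvedPhase_schrodingerPhase (S : Set ℝ) :
    CurvedPhase schrodingerPhase (fun ξ => -(2 * ξ)) (fun _ => -2) S (1 / 4) where
  hasDerivAt := hasDerivAt_schrodingerPhase
  hasDerivAt_deriv η := by simpa using! ((hasDerivAt_id η).const_mul (2 : ℝ)).neg
  continuous_deriv_deriv := continuous_const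
  le_abs _ _ := by norm_num

theorem tendsto_eLpNorm_oscIntegral_profilePhase_sub {F : ℝ → ℂ} (hF : ContDiff ℝ 1 F)
    (hFs : HasCompactSupport F) :
    Tendsto (fun N => eLpNorm (oscIntegral (profilePhase N) F - oscIntegral schrodingerPhase F) 6)
      (Bornology.cobounded ℝ) (𝓝 0) := by
  obtain ⟨K, hK, hFK⟩ := hFs.exists_pos_le_norm
  obtain ⟨c, hc⟩ := exists_forall_norm_oscIntegral_pow_four_le hK.le (by norm_num : (0 : ℝ) < 1 / 4)
    hF hFK
  refine tendsto_eLpNorm_oscIntegral_sub (c := c) measurable_profilePhase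
    measurable_schrodingerPhase hF.continuous.measurable
    (hF.continuous.integrable_of_hasCompactSupport hFs)
    (hF.continuous.memLp_of_hasCompactSupport hFs) ?_
    (hc (curvedPhase_schrodingerPhase _)) tendsto_profilePhase
  filter_upwards [Bornology.eventually_ne_cobounded 0,
    tendsto_norm_cobounded_atTop.eventually_ge_atTop (2 * K)] with N hN hNK
  exact hc (curvedPhase_profilePhase hN hNK)

end ProfilePhase

section WeightRatio

variable {N η : ℝ}

/-- `√|N| / m(N + η)` for the weight `m = weight35`. -/
def weightRatio (N η : ℝ) : ℝ := Real.sqrt |N| / weight35 (N + η)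

theorem measurable_weightRatio (N : ℝ) : Measurable (weightRatio N) :=
  measurable_const.div (continuous_weight35.measurable.comp (measurable_const_add N))

theorem weight35_mul_weightRatio_sub {ξ : ℝ} (hξ : ξ ≠ 0) (N : ℝ) :
    weight35 ξ * weightRatio N (ξ - N) = Real.sqrt |N| := by
  rw [weightRatio, add_sub_cancel, mul_div_cancel₀ _ (weight35_ne_zero hξ)]

theorem weightRatio_nonneg (N η : ℝ) : 0 ≤ weightRatio N η :=
  div_nonneg (Real.sqrt_nonneg _) (weight35_nonneg _)

theorem weightRatio_le_two (hη : |η| ≤ |N| / 2) : weightRatio N η ≤ 2 := by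
  have hlower := cube_abs_le_abs_add (N + η) zero_le_one
  rw [one_mul] at hlower
  refine div_le_of_le_mul₀ (weight35_nonneg _) zero_le_two ?_
  refine le_of_pow_le_pow_left₀ (n := 6) (by norm_num)
    (mul_nonneg zero_le_two (weight35_nonneg _)) ?_
  rw [sqrt_abs_pow_six, mul_pow, weight35_pow_six]
  have hcube := half_cube_abs_le hη
  nlinarith [abs_nonneg (N + η + (N + η) ^ 3)]

theorem norm_one_sub_weightRatio_le (hη : |η| ≤ |N| / 2) : ‖(1 - weightRatio N η : ℂ)‖ ≤ 1 := by
  rw [← Complex.ofReal_one, ← Complex.ofReal_sub, Complex.norm_real, Real.norm_eq_abs, abs_le]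
  constructor <;> linarith [weightRatio_nonneg N η, weightRatio_le_two hη]

theorem weightRatio_eq (hN : N ≠ 0) (η : ℝ) : weightRatio N η =
    (|(1 + η * N⁻¹) * N⁻¹ ^ 2 + (1 + η * N⁻¹) ^ 3| ^ (1 / 6 : ℝ))⁻¹ := by
  have hfactor : N + η + (N + η) ^ 3 =
      N ^ 3 * ((1 + η * N⁻¹) * N⁻¹ ^ 2 + (1 + η * N⁻¹) ^ 3) := by field_simp
  rw [weightRatio, weight35, hfactor, abs_mul, Real.mul_rpow (abs_nonneg _) (abs_nonneg _), abs_pow,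
    cube_abs_rpow, div_mul_eq_div_div, div_self (sqrt_abs_pos hN).ne', one_div]

theorem tendsto_weightRatio (η : ℝ) :
    Tendsto (fun N => weightRatio N η) (Bornology.cobounded ℝ) (𝓝 1) := by
  have hcont : Continuous fun z : ℝ => |(1 + η * z) * z ^ 2 + (1 + η * z) ^ 3| ^ (1 / 6 : ℝ) :=
    Continuous.rpow_const (by fun_prop) fun _ => Or.inr (by norm_num)
  have hlim := ((hcont.tendsto 0).comp tendsto_inv₀_cobounded).inv₀ (by norm_num)
  have hone : (|(1 + η * 0) * 0 ^ 2 + (1 + η * 0) ^ 3| ^ (1 / 6 : ℝ))⁻¹ = (1 : ℝ) := by norm_num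
  rw [hone] at hlim
  refine hlim.congr' ?_
  filter_upwards [Bornology.eventually_ne_cobounded 0] with N hN
  exact (weightRatio_eq hN η).symm

theorem tendsto_eLpNorm_mul_one_sub_weightRatio {F : ℝ → ℂ} (hF : Continuous F)
    (hFs : HasCompactSupport F) :
    Tendsto (fun N => eLpNorm (fun η => F η * (1 - weightRatio N η)) 2) (Bornology.cobounded ℝ)
      (𝓝 0) := by
  obtain ⟨K, -, hFK⟩ := hFs.exists_pos_le_norm
  have hmeas : ∀ N, Measurable fun η => F η * (1 - weightRatio N η) := fun N => by
    have hFm := hF.measurable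
    have hratio := measurable_weightRatio N
    fun_prop
  refine tendsto_eLpNorm_zero_of_lintegral (n := 2) two_ne_zero ?_
  rw [← lintegral_zero (μ := (volume : Measure ℝ))]
  refine tendsto_lintegral_filter_of_dominated_convergence (fun η => ‖F η‖ₑ ^ 2)
    (Eventually.of_forall fun N => (hmeas N).enorm.pow_const 2) ?_ ?_
    (Eventually.of_forall fun η => ?_)
  · filter_upwards [tendsto_norm_cobounded_atTop.eventually_ge_atTop (2 * K)] with N hN
    refine Eventually.of_forall fun η => pow_le_pow_left' ?_ 2
    rcases le_total K |η| with h | h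
    · simp [hFK η h]
    · rw [enorm_mul]
      refine mul_le_of_le_one_right' ?_
      rw [← ofReal_norm]
      refine ENNReal.ofReal_le_one.2 (norm_one_sub_weightRatio_le (h.trans ?_))
      linarith [hN.trans_eq (Real.norm_eq_abs N)]
  · rw [← eLpNorm_two_sq]
    exact ENNReal.pow_ne_top (hF.memLp_of_hasCompactSupport hFs).2.ne
  · have hratio : Tendsto (fun N => F η * (1 - weightRatio N η)) (Bornology.cobounded ℝ) (𝓝 0) := by
      have hcont : Continuous fun r : ℝ => F η * (1 - r) := by fun_prop
      simpa [Function.comp_def] using (hcont.tendsto 1).comp (tendsto_weightRatio η)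
    simpa using ENNReal.Tendsto.pow (n := 2) hratio.enorm

end WeightRatio

section SingleProfile

variable {ι : Type*} {L : Filter ι} {N : ℝ}

theorem tendsto_zero_of_forall_le_add {D : ι → ℝ≥0∞} {C : ℝ≥0∞} (hC : C ≠ ⊤)
    (h : ∀ ε : ℝ≥0, 0 < ε → ∃ r : ι → ℝ≥0∞, Tendsto r L (𝓝 0) ∧ ∀ᶠ N in L, D N ≤ ε * C + r N) :
    Tendsto D L (𝓝 0) := by
  refine ENNReal.tendsto_nhds_zero.2 fun δ hδ => ?_
  obtain ⟨ε, hε, hεδ⟩ := ENNReal.exists_nnreal_pos_mul_lt hC (ENNReal.half_pos hδ.ne').ne'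
  obtain ⟨r, hr, hD⟩ := h ε hε
  filter_upwards [hD, ENNReal.tendsto_nhds_zero.1 hr _ (ENNReal.half_pos hδ.ne')] with N hDN hrN
  calc D N ≤ ε * C + r N := hDN
    _ ≤ δ / 2 + δ / 2 := add_le_add hεδ.le hrN
    _ = δ := ENNReal.add_halves δ

theorem eLpNorm_cis_mul {α : Type*} [MeasurableSpace α] {μ : Measure α} (θ : α → ℝ) (A : α → ℂ)
    (q : ℝ≥0∞) : eLpNorm (fun x => cis(θ x) * A x) q μ = eLpNorm A q μ :=
  eLpNorm_congr_norm_ae (Eventually.of_forall fun x => by rw [norm_mul, norm_cis, one_mul])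

theorem aestronglyMeasurable_cis_mul {α : Type*} [MeasurableSpace α] {μ : Measure α} {θ : α → ℝ}
    (hθ : Measurable θ) {A : α → ℂ} (hA : AEStronglyMeasurable A μ) :
    AEStronglyMeasurable (fun x => cis(θ x) * A x) μ :=
  (Measurable.aestronglyMeasurable (by fun_prop)).mul hA

theorem exists_contDiff_approx {F : ℝ → ℂ} (hF : MemLp F 2) {ε : ℝ≥0} (hε : 0 < ε) :
    ∃ G : ℝ → ℂ, ContDiff ℝ 1 G ∧ HasCompactSupport G ∧ eLpNorm (F - G) 2 ≤ ε := by
  obtain ⟨G, hGs, hG, hFG⟩ := hF.exist_eLpNorm_sub_le (by norm_num) (by norm_num)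
    (NNReal.coe_pos.2 hε)
  exact ⟨G, hG.of_le (by exact_mod_cast le_top), hGs, by simpa using hFG⟩

/-- The frequency profile `F` moved to the frequency `N` and normalised there by the weight. -/
def movedProfile (N : ℝ) (F : ℝ → ℂ) (ξ : ℝ) : ℂ := weightRatio N (ξ - N) * F (ξ - N)

theorem measurable_movedProfile (N : ℝ) {F : ℝ → ℂ} (hF : Measurable F) :
    Measurable (movedProfile N F) := by
  have hratio := measurable_weightRatio N
  unfold movedProfile
  fun_prop

theorem weight35_mul_movedProfile_ae_eq (N : ℝ) (F : ℝ → ℂ) :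
    (fun ξ => (weight35 ξ : ℂ) * movedProfile N F ξ) =ᵐ[volume]
      fun ξ => (Real.sqrt |N| : ℂ) * F (ξ - N) := by
  filter_upwards [Measure.ae_ne volume 0] with ξ hξ
  rw [movedProfile, ← mul_assoc, ← Complex.ofReal_mul, weight35_mul_weightRatio_sub hξ]

theorem eLpNorm_fourierHat_modulate_sub_movedProfile_le (N : ℝ) (g : L2R) {F : ℝ → ℂ}
    (hF : Measurable F) : eLpNorm (fourierHat (modulate N g) - movedProfile N F) 2 ≤
      eLpNorm (fourierHat g - F) 2 + eLpNorm (fun η => F η * (1 - weightRatio N η)) 2 := by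
  have hratio := measurable_weightRatio N
  have herror : Measurable (fourierHat g - F) := (measurable_fourierHat g).sub hF
  have hweight : Measurable fun η => F η * (1 - weightRatio N η) := by fun_prop
  have htranslate : fourierHat (modulate N g) - movedProfile N F =ᵐ[volume]
      ((fourierHat g - F) + fun η => F η * (1 - weightRatio N η)) ∘ fun ξ => ξ - N := by
    filter_upwards [fourierHat_modulate_ae_eq N g] with ξ hξ
    simp only [Pi.sub_apply, hξ, movedProfile, Function.comp_apply, Pi.add_apply]
    ring
  rw [eLpNorm_congr_ae htranslate, eLpNorm_comp_measurePreserving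
    (herror.add hweight).aestronglyMeasurable (measurePreserving_sub_right volume N)]
  exact eLpNorm_add_le herror.aestronglyMeasurable hweight.aestronglyMeasurable (by norm_num)

theorem rescale_sub (N : ℝ) (u v : ℝ × ℝ → ℂ) :
    rescale N (u - v) = rescale N u - rescale N v :=
  funext fun _ => mul_sub _ _ _

theorem rescale_freqExtension_movedProfile (hN : N ≠ 0) (F : ℝ → ℂ) (p : ℝ × ℝ) :
    rescale N (freqExtension weight35 phase35 (movedProfile N F)) p =
      cis(carrierPhase N p) * freqExtension schrodingerWeight (profilePhase N) F p := by
  have hsqrt : (Real.sqrt |N| : ℂ) ≠ 0 := by exact_mod_cast (sqrt_abs_pos hN).ne'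
  have hscale : oscIntegral phase35 (fun ξ => (Real.sqrt |N| : ℂ) * F (ξ - N)) (boostMap N p) =
      Real.sqrt |N| * (cis(carrierPhase N p) * oscIntegral (profilePhase N) F p) := by
    rw [← oscIntegral_phase35_boostMap hN, oscIntegral, oscIntegral, ← integral_const_mul]
    simp only [mul_assoc]
  simp only [rescale, freqExtension, schrodingerWeight, Complex.ofReal_one, one_mul,
    oscIntegral_congr_ae (weight35_mul_movedProfile_ae_eq N F), hscale]
  field_simp

theorem tendsto_eLpNorm_freqExtension_profilePhase_sub {F : ℝ → ℂ} (hF : ContDiff ℝ 1 F)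
    (hFs : HasCompactSupport F) :
    Tendsto (fun N => eLpNorm (freqExtension schrodingerWeight (profilePhase N) F -
      freqExtension schrodingerWeight schrodingerPhase F) 6) (Bornology.cobounded ℝ) (𝓝 0) := by
  refine tendsto_of_tendsto_of_tendsto_of_le_of_le tendsto_const_nhds
    (tendsto_eLpNorm_oscIntegral_profilePhase_sub hF hFs) (fun _ => zero_le) fun N => ?_
  have hfactor : freqExtension schrodingerWeight (profilePhase N) F -
      freqExtension schrodingerWeight schrodingerPhase F = (1 / (2 * Real.pi) : ℂ) •
        (oscIntegral (profilePhase N) F - oscIntegral schrodingerPhase F) := by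
    ext p
    simp only [Pi.sub_apply, freqExtension, schrodingerWeight, Complex.ofReal_one, one_mul,
      Pi.smul_apply, smul_eq_mul, mul_sub]
  rw [hfactor, eLpNorm_const_smul]
  exact mul_le_of_le_one_left' enorm_one_div_two_pi_le

/-- `|N|^{-1/2} Ẽ₅(e^{ixN} g)` in the frame of `boostMap N`, minus the Schrödinger evolution of `g`
on its carrier wave. -/
def profileDefect (N : ℝ) (g : L2R) (p : ℝ × ℝ) : ℂ :=
  rescale N (extension35 (modulate N g)) p - cis(carrierPhase N p) * schrodinger g p

theorem profileDefect_eq (hN : N ≠ 0) (g : L2R) (F : ℝ → ℂ) :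
    profileDefect N g =
      rescale N (extension35 (modulate N g) -
        freqExtension weight35 phase35 (movedProfile N F)) +
      (fun p => cis(carrierPhase N p) * (freqExtension schrodingerWeight (profilePhase N) F -
        freqExtension schrodingerWeight schrodingerPhase F) p) -
      fun p => cis(carrierPhase N p) *
        (schrodinger g - freqExtension schrodingerWeight schrodingerPhase F : ℝ × ℝ → ℂ) p := by
  ext p
  simp only [profileDefect, rescale_sub, Pi.add_apply, Pi.sub_apply,
    rescale_freqExtension_movedProfile hN]
  ring

theorem eLpNorm_profileDefect_le (hN : N ≠ 0) (g : L2R) {F : ℝ → ℂ} (hF : Measurable F)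
    (hFi : Integrable F) {C C' : ℝ≥0} (hC : HasExtensionBound weight35 phase35 Set.univ C)
    (hC' : HasExtensionBound schrodingerWeight schrodingerPhase Set.univ C') :
    eLpNorm (profileDefect N g) 6 ≤ ENNReal.ofReal (10 ^ (1 / 6 : ℝ)) *
        (C * eLpNorm (fourierHat (modulate N g) - movedProfile N F) 2) +
      eLpNorm (freqExtension schrodingerWeight (profilePhase N) F -
        freqExtension schrodingerWeight schrodingerPhase F) 6 +
      C' * eLpNorm (fourierHat g - F) 2 := by
  have hFN := measurable_movedProfile N hF
  have hmoved : Integrable fun ξ => (weight35 ξ : ℂ) * movedProfile N F ξ :=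
    ((hFi.comp_sub_right N).const_mul _).congr (weight35_mul_movedProfile_ae_eq N F).symm
  have hone : Integrable fun ξ => (schrodingerWeight ξ : ℂ) * F ξ := by
    simpa only [schrodingerWeight, Complex.ofReal_one, one_mul] using hFi
  set u := extension35 (modulate N g) - freqExtension weight35 phase35 (movedProfile N F)
  set v := freqExtension schrodingerWeight (profilePhase N) F -
    freqExtension schrodingerWeight schrodingerPhase F
  set w := schrodinger g - freqExtension schrodingerWeight schrodingerPhase F
  have hu : AEStronglyMeasurable u := (isExtension_extension35 _).1.1.sub
    (aestronglyMeasurable_freqExtension continuous_weight35.measurable measurable_phase35 hFN)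
  have hfree := aestronglyMeasurable_freqExtension continuous_schrodingerWeight.measurable
    measurable_schrodingerPhase hF
  have hv : AEStronglyMeasurable v := (aestronglyMeasurable_freqExtension
    continuous_schrodingerWeight.measurable (measurable_profilePhase N) hF).sub hfree
  have hw : AEStronglyMeasurable w := (isExtension_schrodinger g).1.1.sub hfree
  have hθ := (continuous_carrierPhase N).measurable
  rw [profileDefect_eq hN g F]
  have hru := aestronglyMeasurable_rescale hN hu
  refine (eLpNorm_sub_le (hru.add (aestronglyMeasurable_cis_mul hθ hv))
    (aestronglyMeasurable_cis_mul hθ hw) (by norm_num)).trans ?_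
  rw [eLpNorm_cis_mul]
  refine add_le_add ((eLpNorm_add_le hru (aestronglyMeasurable_cis_mul hθ hv)
    (by norm_num)).trans ?_) ((isExtension_schrodinger g).eLpNorm_sub_freqExtension_le hC'
      continuous_schrodingerWeight measurable_schrodingerPhase hF hone)
  rw [eLpNorm_cis_mul, eLpNorm_rescale hN hu]
  gcongr
  exact (isExtension_extension35 _).eLpNorm_sub_freqExtension_le hC continuous_weight35
    measurable_phase35 hFN hmoved

theorem tendsto_eLpNorm_profileDefect (g : L2R) :
    Tendsto (fun N => eLpNorm (profileDefect N g) 6) (Bornology.cobounded ℝ) (𝓝 0) := by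
  obtain ⟨C, hC⟩ := exists_hasExtensionBound_weight35
  obtain ⟨C', hC'⟩ := exists_hasExtensionBound_schrodinger
  set κ : ℝ≥0∞ := ENNReal.ofReal (10 ^ (1 / 6 : ℝ)) * C
  have hκ : κ ≠ ⊤ := ENNReal.mul_ne_top ENNReal.ofReal_ne_top ENNReal.coe_ne_top
  refine tendsto_zero_of_forall_le_add (C := κ + C') (ENNReal.add_ne_top.2 ⟨hκ, by simp⟩)
    fun ε hε => ?_
  obtain ⟨F, hF, hFs, hgF⟩ := exists_contDiff_approx (memLp_fourierHat g) hε
  have hFm := hF.continuous.measurable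
  refine ⟨fun N => κ * eLpNorm (fun η => F η * (1 - weightRatio N η)) 2 +
    eLpNorm (freqExtension schrodingerWeight (profilePhase N) F -
      freqExtension schrodingerWeight schrodingerPhase F) 6, ?_, ?_⟩
  · simpa only [mul_zero, add_zero] using (ENNReal.Tendsto.const_mul
      (tendsto_eLpNorm_mul_one_sub_weightRatio hF.continuous hFs) (Or.inr hκ)).add
      (tendsto_eLpNorm_freqExtension_profilePhase_sub hF hFs)
  filter_upwards [Bornology.eventually_ne_cobounded 0] with N hN
  refine (eLpNorm_profileDefect_le hN g hFm
    (hF.continuous.integrable_of_hasCompactSupport hFs) hC hC').trans ?_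
  have hmoved := (eLpNorm_fourierHat_modulate_sub_movedProfile_le N g hFm).trans
    (add_le_add_left hgF _)
  calc _ ≤ ENNReal.ofReal (10 ^ (1 / 6 : ℝ)) *
          (C * (ε + eLpNorm (fun η => F η * (1 - weightRatio N η)) 2)) +
        eLpNorm (freqExtension schrodingerWeight (profilePhase N) F -
          freqExtension schrodingerWeight schrodingerPhase F) 6 + C' * ε := by gcongr
    _ = _ := by simp only [κ]; ring

end SingleProfile

/-- The free Schrödinger evolution run backwards in time. -/
def schrodingerBackward (g : L2R) (p : ℝ × ℝ) : ℂ := schrodinger g (-p.1, p.2)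

theorem measurePreserving_timeReflect : MeasurePreserving fun p : ℝ × ℝ => (-p.1, p.2) :=
  (Measure.measurePreserving_neg volume).prod (MeasurePreserving.id volume)

theorem memLp_schrodinger (g : L2R) : MemLp (schrodinger g) 6 := (isExtension_schrodinger g).1

theorem memLp_schrodingerBackward (g : L2R) : MemLp (schrodingerBackward g) 6 :=
  (memLp_schrodinger g).comp_measurePreserving measurePreserving_timeReflect

theorem normL6_schrodingerBackward (g : L2R) :
    normL6 (schrodingerBackward g) = normL6 (schrodinger g) :=
  congrArg ENNReal.toReal (eLpNorm_comp_measurePreserving (memLp_schrodinger g).1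
    measurePreserving_timeReflect)

section TwoProfiles

variable {N : ℝ} {A B : ℝ × ℝ → ℂ}

/-- Two profiles `A` and `B` riding on the carrier waves of opposite phases `±carrierPhase N`. -/
def wavePair (N : ℝ) (A B : ℝ × ℝ → ℂ) (p : ℝ × ℝ) : ℂ :=
  cis(carrierPhase N p) * A p + cis(-carrierPhase N p) * B p

theorem memLp_wavePair (N : ℝ) (hA : MemLp A 6) (hB : MemLp B 6) :
    MemLp (wavePair N A B) 6 := by
  have hθ := (continuous_carrierPhase N).measurable
  have hmul : ∀ {θ : ℝ × ℝ → ℝ} {D : ℝ × ℝ → ℂ}, Measurable θ → MemLp D 6 →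
      MemLp (fun p => cis(θ p) * D p) 6 := fun hθ hD =>
    ⟨aestronglyMeasurable_cis_mul hθ hD.1, by rw [eLpNorm_cis_mul]; exact hD.2⟩
  exact (hmul hθ hA).add (hmul hθ.neg hB)

theorem extension35_twoProfile_ae_eq (g₁ g₂ : L2R) (N : ℝ) :
    extension35 (twoProfile g₁ g₂ N) =ᵐ[volume]
      extension35 (modulate N g₁) + extension35 (modulate (-N) g₂) :=
  (isExtension_extension35 _).ae_eq_add (isExtension_extension35 _) (isExtension_extension35 _)
    continuous_weight35 measurable_phase35

theorem aestronglyMeasurable_profileDefect (hN : N ≠ 0) (g : L2R) :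
    AEStronglyMeasurable (profileDefect N g) :=
  (aestronglyMeasurable_rescale hN (isExtension_extension35 _).1.1).sub
    (aestronglyMeasurable_cis_mul (continuous_carrierPhase N).measurable (memLp_schrodinger g).1)

theorem rescale_extension35_twoProfile_sub_ae_eq (hN : N ≠ 0) (g₁ g₂ : L2R) :
    rescale N (extension35 (twoProfile g₁ g₂ N)) -
        wavePair N (schrodinger g₁) (schrodingerBackward g₂) =ᵐ[volume]
      profileDefect N g₁ + fun p => profileDefect (-N) g₂ (-p.1, p.2) := by
  filter_upwards [(quasiMeasurePreserving_boostMap hN).ae_eq_comp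
    (extension35_twoProfile_ae_eq g₁ g₂ N)] with p hp
  simp only [Function.comp_apply, Pi.add_apply] at hp
  simp only [Pi.sub_apply, Pi.add_apply, rescale, profileDefect, wavePair, schrodingerBackward,
    hp, boostMap_neg, carrierPhase_neg, abs_neg, neg_neg]
  ring

theorem tendsto_eLpNorm_rescale_sub_wavePair (g₁ g₂ : L2R) :
    Tendsto (fun N => eLpNorm (rescale N (extension35 (twoProfile g₁ g₂ N)) -
      wavePair N (schrodinger g₁) (schrodingerBackward g₂)) 6) (Bornology.cobounded ℝ) (𝓝 0) := by
  have hlim := (tendsto_eLpNorm_profileDefect g₁).add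
    ((tendsto_eLpNorm_profileDefect g₂).comp tendsto_neg_cobounded)
  rw [add_zero] at hlim
  refine tendsto_of_tendsto_of_tendsto_of_le_of_le' tendsto_const_nhds hlim
    (Eventually.of_forall fun _ => zero_le) ?_
  filter_upwards [Bornology.eventually_ne_cobounded 0] with N hN
  have hdefect := aestronglyMeasurable_profileDefect (neg_ne_zero.2 hN) g₂
  rw [eLpNorm_congr_ae (rescale_extension35_twoProfile_sub_ae_eq hN g₁ g₂)]
  refine (eLpNorm_add_le (aestronglyMeasurable_profileDefect hN g₁)
    (hdefect.comp_measurePreserving measurePreserving_timeReflect) (by norm_num)).trans ?_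
  exact add_le_add_right
    (eLpNorm_comp_measurePreserving hdefect measurePreserving_timeReflect).le _

end TwoProfiles

section RiemannLebesgue

/-- `carrierPhase N` as a continuous linear functional. -/
def carrierFunctional (N : ℝ) : StrongDual ℝ (ℝ × ℝ) :=
  N • ContinuousLinearMap.snd ℝ ℝ ℝ + ((1 + 2 * N ^ 2) / 5) • ContinuousLinearMap.fst ℝ ℝ ℝ

theorem carrierFunctional_apply (N : ℝ) (p : ℝ × ℝ) :
    carrierFunctional N p = carrierPhase N p := by
  simp [carrierFunctional, carrierPhase]

theorem abs_le_norm_carrierFunctional (N : ℝ) : |N| ≤ ‖carrierFunctional N‖ := by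
  have h := (carrierFunctional N).le_opNorm (0, 1)
  simpa [carrierFunctional_apply, carrierPhase, Prod.norm_def] using h

theorem tendsto_const_smul_carrierFunctional {c : ℝ} (hc : c ≠ 0) :
    Tendsto (fun N => c • carrierFunctional N) (Bornology.cobounded ℝ)
      (Bornology.cobounded (StrongDual ℝ (ℝ × ℝ))) := by
  simp only [← tendsto_norm_atTop_iff_cobounded, norm_smul]
  exact (tendsto_atTop_mono abs_le_norm_carrierFunctional
    tendsto_norm_cobounded_atTop).const_mul_atTop (norm_pos_iff.2 hc)

theorem tendsto_integral_cis_carrierPhase_mul (G : ℝ × ℝ → ℂ) {k : ℝ} (hk : k ≠ 0) :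
    Tendsto (fun N => ∫ p, cis(k * carrierPhase N p) * G p) (Bornology.cobounded ℝ) (𝓝 0) := by
  have : (volume : Measure (ℝ × ℝ)).IsAddHaarMeasure :=
    Measure.prod.instIsAddHaarMeasure (volume : Measure ℝ) (volume : Measure ℝ)
  have : ProperSpace (StrongDual ℝ (ℝ × ℝ)) := FiniteDimensional.proper ℝ _
  have hk' : -(k / (2 * Real.pi)) ≠ 0 := neg_ne_zero.2 (div_ne_zero hk Real.two_pi_pos.ne')
  have hlim := tendsto_const_smul_carrierFunctional hk'
  rw [Metric.cobounded_eq_cocompact (α := StrongDual ℝ (ℝ × ℝ))] at hlim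
  refine ((tendsto_integral_exp_smul_cocompact G volume).comp hlim).congr fun N => ?_
  refine integral_congr_ae (Eventually.of_forall fun p => ?_)
  have hphase : 2 * Real.pi * -(-(k / (2 * Real.pi)) * carrierPhase N p) =
      k * carrierPhase N p := by
    field_simp
  simp only [Circle.smul_def, Real.fourierChar_apply, smul_eq_mul,
    smul_apply, carrierFunctional_apply, hphase]
  rw [mul_comm Complex.I]

end RiemannLebesgue

section SixthPower

theorem ofReal_norm_sum_sq {ι : Type*} (s : Finset ι) (z : ι → ℂ) :
    ((‖∑ i ∈ s, z i‖ ^ 2 : ℝ) : ℂ) = ∑ i ∈ s, ∑ j ∈ s, z i * starRingEnd ℂ (z j) := by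
  rw [Complex.ofReal_pow, ← Complex.mul_conj', map_sum, Finset.sum_mul_sum]

theorem conj_cis (x : ℝ) : starRingEnd ℂ (cis(x)) = cis(-x) := by
  rw [← Complex.exp_conj]; simp

theorem ofReal_integral_norm_sum_cis_mul_sq {α ι : Type*} [MeasurableSpace α] {μ : Measure α}
    {s : Finset ι} {θ : ι → α → ℝ} (hθ : ∀ i, Measurable (θ i)) {H : ι → α → ℂ}
    (hH : ∀ i ∈ s, MemLp (H i) 2 μ) :
    ((∫ x, ‖∑ i ∈ s, cis(θ i x) * H i x‖ ^ 2 ∂μ : ℝ) : ℂ) =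
      ∑ i ∈ s, ∑ j ∈ s, ∫ x, cis(θ i x - θ j x) * (H i x * starRingEnd ℂ (H j x)) ∂μ := by
  have hprod : ∀ i ∈ s, ∀ j ∈ s, Integrable (fun x => H i x * starRingEnd ℂ (H j x)) μ :=
    fun i hi j hj => (hH i hi).integrable_mul (hH j hj).star
  have hcross : ∀ i ∈ s, ∀ j ∈ s,
      Integrable (fun x => cis(θ i x - θ j x) * (H i x * starRingEnd ℂ (H j x))) μ :=
    fun i hi j hj => by
      simpa only [mul_comm, Pi.sub_apply] using
        integrable_mul_cis (hprod i hi j hj) ((hθ i).sub (hθ j))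
  have hterm : ∀ i j x, cis(θ i x) * H i x * starRingEnd ℂ (cis(θ j x) * H j x) =
      cis(θ i x - θ j x) * (H i x * starRingEnd ℂ (H j x)) := fun i j x => by
    rw [sub_eq_add_neg, cis_add, map_mul, conj_cis]; ring
  rw [← integral_complex_ofReal]
  simp only [ofReal_norm_sum_sq, hterm]
  rw [integral_finsetSum _ fun i hi => integrable_finsetSum _ (hcross i hi)]
  exact Finset.sum_congr rfl fun i hi => integral_finsetSum _ (hcross i hi)

-- The off-diagonal terms of the expanded square oscillate, hence vanish by Riemann–Lebesgue.
theorem tendsto_integral_norm_sum_cis_carrierPhase_sq {ι : Type*} {s : Finset ι} {c : ι → ℝ}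
    (hc : c.Injective) {H : ι → ℝ × ℝ → ℂ} (hH : ∀ i ∈ s, MemLp (H i) 2) :
    Tendsto (fun N => ∫ p, ‖∑ i ∈ s, cis(c i * carrierPhase N p) * H i p‖ ^ 2)
      (Bornology.cobounded ℝ) (𝓝 (∑ i ∈ s, ∫ p, ‖H i p‖ ^ 2)) := by
  classical
  have hlim : ∀ i j, Tendsto (fun N => ∫ p, cis((c i - c j) * carrierPhase N p) *
      (H i p * starRingEnd ℂ (H j p))) (Bornology.cobounded ℝ)
      (𝓝 (if i = j then ((∫ p, ‖H i p‖ ^ 2 : ℝ) : ℂ) else 0)) := fun i j => by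
    split_ifs with hij
    · subst hij
      simp [Complex.mul_conj', ← integral_complex_ofReal]
    · exact tendsto_integral_cis_carrierPhase_mul _ (sub_ne_zero.2 (hc.ne hij))
  rw [← tendsto_ofReal_iff]
  have hphase := fun N i => (continuous_carrierPhase N).measurable.const_mul (c i)
  simp only [ofReal_integral_norm_sum_cis_mul_sq (hphase _) hH, ← sub_mul]
  have hsum := tendsto_finsetSum s fun i _ => tendsto_finsetSum s fun j _ => hlim i j
  simpa using hsum

theorem wavePair_pow (n : ℕ) (N : ℝ) (A B : ℝ × ℝ → ℂ) (p : ℝ × ℝ) :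
    wavePair N A B p ^ n = ∑ k ∈ Finset.range (n + 1),
      cis((2 * k - n) * carrierPhase N p) * (n.choose k * (A p ^ k * B p ^ (n - k))) := by
  rw [wavePair, add_pow]
  refine Finset.sum_congr rfl fun k hk => ?_
  have hcis : cis((2 * k - n) * carrierPhase N p) =
      cis(carrierPhase N p) ^ k * cis(-carrierPhase N p) ^ (n - k) := by
    rw [← Complex.exp_nat_mul, ← Complex.exp_nat_mul, ← Complex.exp_add]
    congr 1
    push_cast [Nat.cast_sub (Nat.lt_succ_iff.1 (Finset.mem_range.1 hk))]
    ring
  rw [hcis]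
  ring

theorem pow_mul_pow_le_add {a b : ℝ} (ha : 0 ≤ a) (hb : 0 ≤ b) (i j : ℕ) :
    a ^ i * b ^ j ≤ a ^ (i + j) + b ^ (i + j) := by
  rcases le_total a b with h | h
  · calc a ^ i * b ^ j ≤ b ^ i * b ^ j := by gcongr
      _ = b ^ (i + j) := (pow_add b i j).symm
      _ ≤ _ := le_add_of_nonneg_left (by positivity)
  · calc a ^ i * b ^ j ≤ a ^ i * a ^ j := by gcongr
      _ = a ^ (i + j) := (pow_add a i j).symm
      _ ≤ _ := le_add_of_nonneg_right (by positivity)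

variable {α : Type*} [MeasurableSpace α] {μ : Measure α} {A B : α → ℂ}

theorem integrable_norm_pow_mul_norm_pow {i j : ℕ} (hij : i + j ≠ 0)
    (hA : MemLp A (i + j : ℕ) μ) (hB : MemLp B (i + j : ℕ) μ) :
    Integrable (fun p => ‖A p‖ ^ i * ‖B p‖ ^ j) μ := by
  refine ((hA.integrable_norm_pow hij).add (hB.integrable_norm_pow hij)).mono'
    ((hA.1.norm.pow i).mul (hB.1.norm.pow j)) (Eventually.of_forall fun p => ?_)
  rw [Real.norm_of_nonneg (by positivity)]
  exact pow_mul_pow_le_add (norm_nonneg _) (norm_nonneg _) i j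

theorem memLp_two_pow_mul_pow {i j : ℕ} (hij : i + j ≠ 0)
    (hA : MemLp A (2 * (i + j) : ℕ) μ) (hB : MemLp B (2 * (i + j) : ℕ) μ) :
    MemLp (fun p => A p ^ i * B p ^ j) 2 μ := by
  refine (memLp_two_iff_integrable_sq_norm ((hA.1.pow i).mul (hB.1.pow j))).2 ?_
  rw [mul_add] at hA hB
  refine (integrable_norm_pow_mul_norm_pow (by lia) hA hB).congr
    (Eventually.of_forall fun p => ?_)
  simp only [Pi.mul_apply, Pi.pow_apply, norm_mul, norm_pow]
  ring

end SixthPower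

/-- The mean of `|A + e^{iα} B|⁶` over `α`, in terms of `a = |A|` and `b = |B|`. -/
def meanSix (a b : ℝ) : ℝ := a ^ 6 + 9 * (a ^ 4 * b ^ 2) + 9 * (b ^ 4 * a ^ 2) + b ^ 6

theorem meanSix_eq_sum (a b : ℝ) :
    meanSix a b = ∑ k ∈ Finset.range 4, (Nat.choose 3 k * (a ^ k * b ^ (3 - k))) ^ 2 := by
  have h31 : Nat.choose 3 1 = 3 := rfl
  simp [Finset.sum_range_succ, meanSix, h31]
  ring

theorem ten_mul_add_sub_meanSix (a b : ℝ) :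
    10 * (a ^ 6 + b ^ 6) - meanSix a b = 9 * ((a ^ 2 + b ^ 2) * (a ^ 2 - b ^ 2) ^ 2) := by
  rw [meanSix]; ring

theorem cube_add_div_four_sub (X Y : ℝ) :
    (X + Y) ^ 3 / 4 - (X ^ 3 + 9 * (X ^ 2 * Y) + 9 * (Y ^ 2 * X) + Y ^ 3) / 10 =
      3 / 20 * ((X + Y) * (X - Y) ^ 2) := by
  ring

theorem eq_of_add_mul_sub_sq_eq_zero {x y : ℝ} (hx : 0 ≤ x) (hy : 0 ≤ y)
    (h : (x + y) * (x - y) ^ 2 = 0) : x = y := by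
  rcases mul_eq_zero.1 h with hsum | hdiff
  · linarith
  · exact sub_eq_zero.1 (pow_eq_zero_iff two_ne_zero |>.1 hdiff)

theorem integral_norm_pow_eq_toReal_lintegral {α : Type*} [MeasurableSpace α] {μ : Measure α}
    {f : α → ℂ} (hf : AEStronglyMeasurable f μ) (n : ℕ) :
    ∫ x, ‖f x‖ ^ n ∂μ = (∫⁻ x, ‖f x‖ₑ ^ n ∂μ).toReal := by
  simpa only [Pi.pow_apply, norm_pow, enorm_pow] using integral_norm_eq_lintegral_enorm (hf.pow n)

theorem normL6_pow_six {A : ℝ × ℝ → ℂ} (hA : AEStronglyMeasurable A) :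
    normL6 A ^ 6 = ∫ p, ‖A p‖ ^ 6 := by
  rw [integral_norm_pow_eq_toReal_lintegral hA, normL6, ← ENNReal.toReal_pow, eLpNorm_six_pow]

theorem normL6_nonneg (A : ℝ × ℝ → ℂ) : 0 ≤ normL6 A := ENNReal.toReal_nonneg

section MeanSix

variable {A B : ℝ × ℝ → ℂ}

theorem integrable_norm_pow_six (hA : MemLp A 6) : Integrable fun p => ‖A p‖ ^ 6 :=
  hA.integrable_norm_pow (p := 6) (by norm_num)

theorem integrable_pow_four_mul_sq (hA : MemLp A 6) (hB : MemLp B 6) :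
    Integrable fun p => ‖A p‖ ^ 4 * ‖B p‖ ^ 2 :=
  integrable_norm_pow_mul_norm_pow (by norm_num) hA hB

theorem integrable_meanSix (hA : MemLp A 6) (hB : MemLp B 6) :
    Integrable fun p => meanSix ‖A p‖ ‖B p‖ :=
  (((integrable_norm_pow_six hA).add ((integrable_pow_four_mul_sq hA hB).const_mul 9)).add
    ((integrable_pow_four_mul_sq hB hA).const_mul 9)).add (integrable_norm_pow_six hB)

theorem integral_meanSix_nonneg (A B : ℝ × ℝ → ℂ) : 0 ≤ ∫ p, meanSix ‖A p‖ ‖B p‖ :=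
  integral_nonneg fun p => by simp only [Pi.zero_apply, meanSix]; positivity

theorem integral_meanSix (hA : MemLp A 6) (hB : MemLp B 6) :
    ∫ p, meanSix ‖A p‖ ‖B p‖ = (∫ p, ‖A p‖ ^ 6) + 9 * (∫ p, ‖A p‖ ^ 4 * ‖B p‖ ^ 2)
      + 9 * (∫ p, ‖B p‖ ^ 4 * ‖A p‖ ^ 2) + ∫ p, ‖B p‖ ^ 6 := by
  have hA6 := integrable_norm_pow_six hA
  have hA4 := (integrable_pow_four_mul_sq hA hB).const_mul 9
  have hB4 := (integrable_pow_four_mul_sq hB hA).const_mul 9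
  simp only [meanSix]
  rw [integral_add (by fun_prop) (integrable_norm_pow_six hB),
    integral_add (by fun_prop) hB4, integral_add hA6 hA4, integral_const_mul, integral_const_mul]

theorem tendsto_integral_norm_wavePair_pow_six (hA : MemLp A 6) (hB : MemLp B 6) :
    Tendsto (fun N => ∫ p, ‖wavePair N A B p‖ ^ 6) (Bornology.cobounded ℝ)
      (𝓝 (∫ p, meanSix ‖A p‖ ‖B p‖)) := by
  have hsix : ∀ z : ℂ, ‖z‖ ^ 6 = ‖z ^ 3‖ ^ 2 := fun z => by rw [norm_pow, ← pow_mul]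
  have hmem : ∀ k ∈ Finset.range 4,
      MemLp (fun p => (Nat.choose 3 k : ℂ) * (A p ^ k * B p ^ (3 - k))) 2 := fun k hk => by
    have hk3 : k + (3 - k) = 3 := by have := Finset.mem_range.1 hk; lia
    exact (memLp_two_pow_mul_pow (by lia) (by rw [hk3]; exact hA)
      (by rw [hk3]; exact hB)).const_mul _
  have hfreq : Function.Injective fun k : ℕ => (2 * k - (3 : ℕ) : ℝ) := fun i j hij => by
    simpa using hij
  have hmean : ∫ p, meanSix ‖A p‖ ‖B p‖ = ∑ k ∈ Finset.range 4,
      ∫ p, ‖(Nat.choose 3 k : ℂ) * (A p ^ k * B p ^ (3 - k))‖ ^ 2 := by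
    rw [← integral_finsetSum _ fun k hk => (hmem k hk).integrable_norm_pow two_ne_zero]
    simp only [meanSix_eq_sum, norm_mul, norm_pow, Complex.norm_natCast]
  simp only [hmean, hsix, wavePair_pow]
  exact tendsto_integral_norm_sum_cis_carrierPhase_sq hfreq hmem

theorem integral_pow_four_mul_sq_le (hA : MemLp A 6) (hB : MemLp B 6) :
    ∫ p, ‖A p‖ ^ 4 * ‖B p‖ ^ 2 ≤ (normL6 A ^ 2) ^ 2 * normL6 B ^ 2 := by
  have : ENNReal.HolderTriple 6 6 3 :=
    ⟨(ENNReal.toReal_eq_toReal_iff' (by simp) (by simp)).1 (by norm_num [ENNReal.toReal_add])⟩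
  have : ENNReal.HolderTriple 6 3 2 :=
    ⟨(ENNReal.toReal_eq_toReal_iff' (by simp) (by simp)).1 (by norm_num [ENNReal.toReal_add])⟩
  have hholder : eLpNorm (A • A • B) 2 ≤ eLpNorm A 6 * (eLpNorm A 6 * eLpNorm B 6) :=
    (eLpNorm_smul_le_mul_eLpNorm (p := 6) (q := 3) (hA.1.smul hB.1) hA.1).trans
      (mul_le_mul_right (eLpNorm_smul_le_mul_eLpNorm (p := 6) (q := 6) hB.1 hA.1) _)
  have hpow : ∀ p, ‖A p‖ ^ 4 * ‖B p‖ ^ 2 = ‖(A • A • B) p‖ ^ 2 := fun p => by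
    simp only [Pi.smul_apply', smul_eq_mul, Pi.mul_apply, norm_mul]
    ring
  simp only [hpow]
  rw [integral_norm_pow_eq_toReal_lintegral (hA.1.smul (hA.1.smul hB.1)), ← eLpNorm_two_sq,
    ENNReal.toReal_pow]
  calc (eLpNorm (A • A • B) 2 volume).toReal ^ 2
      ≤ (normL6 A * (normL6 A * normL6 B)) ^ 2 := by
        gcongr
        simp only [normL6, ← ENNReal.toReal_mul]
        exact ENNReal.toReal_mono (ENNReal.mul_ne_top hA.2.ne
          (ENNReal.mul_ne_top hA.2.ne hB.2.ne)) hholder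
    _ = _ := by ring

theorem integral_meanSix_le (hA : MemLp A 6) (hB : MemLp B 6) :
    ∫ p, meanSix ‖A p‖ ‖B p‖ ≤ (normL6 A ^ 2) ^ 3 + 9 * ((normL6 A ^ 2) ^ 2 * normL6 B ^ 2)
      + 9 * ((normL6 B ^ 2) ^ 2 * normL6 A ^ 2) + (normL6 B ^ 2) ^ 3 := by
  have hcube : ∀ x : ℝ, (x ^ 2) ^ 3 = x ^ 6 := fun x => (pow_mul x 2 3).symm
  rw [integral_meanSix hA hB, ← normL6_pow_six hA.1, ← normL6_pow_six hB.1, hcube, hcube]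
  linarith [integral_pow_four_mul_sq_le hA hB, integral_pow_four_mul_sq_le hB hA]

theorem integral_meanSix_div_ten_le (hA : MemLp A 6) (hB : MemLp B 6) :
    (∫ p, meanSix ‖A p‖ ‖B p‖) / 10 ≤ (normL6 A ^ 2 + normL6 B ^ 2) ^ 3 / 4 := by
  have hdefect : 0 ≤ 3 / 20 * ((normL6 A ^ 2 + normL6 B ^ 2) * (normL6 A ^ 2 - normL6 B ^ 2) ^ 2) :=
    by positivity
  rw [← cube_add_div_four_sub] at hdefect
  linarith [integral_meanSix_le hA hB]

theorem ae_norm_eq_of_integral_meanSix_eq (hA : MemLp A 6) (hB : MemLp B 6)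
    (h : ∫ p, meanSix ‖A p‖ ‖B p‖ = 10 * ((∫ p, ‖A p‖ ^ 6) + ∫ p, ‖B p‖ ^ 6)) :
    ∀ᵐ p, ‖A p‖ = ‖B p‖ := by
  have hA6 := integrable_norm_pow_six hA
  have hB6 := integrable_norm_pow_six hB
  have hsum : Integrable fun p => 10 * (‖A p‖ ^ 6 + ‖B p‖ ^ 6) := (hA6.add hB6).const_mul 10
  have hdiff : Integrable fun p => 10 * (‖A p‖ ^ 6 + ‖B p‖ ^ 6) - meanSix ‖A p‖ ‖B p‖ :=
    hsum.sub (integrable_meanSix hA hB)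
  have hzero : ∫ p, (10 * (‖A p‖ ^ 6 + ‖B p‖ ^ 6) - meanSix ‖A p‖ ‖B p‖) = 0 := by
    rw [integral_sub hsum (integrable_meanSix hA hB), integral_const_mul,
      integral_add hA6 hB6, h, sub_self]
  have hdefect := (integral_eq_zero_iff_of_nonneg (fun p => by
    simp only [Pi.zero_apply, ten_mul_add_sub_meanSix]; positivity)
    hdiff).1 hzero
  filter_upwards [hdefect] with p hp
  simp only [Pi.zero_apply, ten_mul_add_sub_meanSix] at hp
  refine (sq_eq_sq₀ (norm_nonneg _) (norm_nonneg _)).1 (eq_of_add_mul_sub_sq_eq_zero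
    (sq_nonneg _) (sq_nonneg _) ?_)
  linarith

theorem integral_meanSix_div_ten_eq_iff (hA : MemLp A 6) (hB : MemLp B 6) :
    (∫ p, meanSix ‖A p‖ ‖B p‖) / 10 = (normL6 A ^ 2 + normL6 B ^ 2) ^ 3 / 4 ↔
      ∀ᵐ p, ‖A p‖ = ‖B p‖ := by
  constructor
  · intro h
    have hdefect := cube_add_div_four_sub (normL6 A ^ 2) (normL6 B ^ 2)
    have hXY : normL6 A ^ 2 = normL6 B ^ 2 := by
      refine eq_of_add_mul_sub_sq_eq_zero (sq_nonneg _) (sq_nonneg _)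
        (le_antisymm ?_ (by positivity))
      linarith [integral_meanSix_le hA hB]
    refine ae_norm_eq_of_integral_meanSix_eq hA hB ?_
    rw [← normL6_pow_six hA.1, ← normL6_pow_six hB.1, pow_mul _ 2 3, pow_mul _ 2 3]
    rw [hXY] at h ⊢
    linarith
  · intro h
    have hnorm : normL6 A = normL6 B := congrArg ENNReal.toReal (eLpNorm_congr_norm_ae h)
    have hmean : ∫ p, meanSix ‖A p‖ ‖B p‖ = 20 * normL6 B ^ 6 := by
      rw [normL6_pow_six hB.1, ← integral_const_mul]
      refine integral_congr_ae (h.mono fun p hp => ?_)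
      simp only [hp, meanSix]
      ring
    rw [hmean, hnorm]
    ring

end MeanSix

theorem abs_normL6_sub_le {u v : ℝ × ℝ → ℂ} (hu : MemLp u 6) (hv : MemLp v 6) :
    |normL6 u - normL6 v| ≤ normL6 (u - v) := by
  have htri : ∀ {f g : ℝ × ℝ → ℂ}, MemLp f 6 → MemLp g 6 →
      normL6 f ≤ normL6 (f - g) + normL6 g := fun {f g} hf hg => by
    rw [normL6, normL6, normL6, ← ENNReal.toReal_add (hf.sub hg).2.ne hg.2.ne]
    refine ENNReal.toReal_mono (ENNReal.add_ne_top.2 ⟨(hf.sub hg).2.ne, hg.2.ne⟩) ?_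
    simpa only [sub_add_cancel] using eLpNorm_add_le (p := 6) (hf.sub hg).1 hg.1 (by norm_num)
  have hvu : normL6 (v - u) = normL6 (u - v) := congrArg ENNReal.toReal (eLpNorm_sub_comm v u 6 _)
  rw [abs_le]
  constructor <;> linarith [htri hu hv, htri hv hu]

theorem normL6_rescale {N : ℝ} (hN : N ≠ 0) {u : ℝ × ℝ → ℂ} (hu : AEStronglyMeasurable u) :
    normL6 (rescale N u) = (10 : ℝ) ^ (1 / 6 : ℝ) * normL6 u := by
  rw [normL6, eLpNorm_rescale hN hu, ENNReal.toReal_mul, ENNReal.toReal_ofReal (by positivity),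
    normL6]

theorem memLp_rescale {N : ℝ} (hN : N ≠ 0) {u : ℝ × ℝ → ℂ} (hu : MemLp u 6) :
    MemLp (rescale N u) 6 :=
  ⟨aestronglyMeasurable_rescale hN hu.1, by
    rw [eLpNorm_rescale hN hu.1]; exact ENNReal.mul_lt_top ENNReal.ofReal_lt_top hu.2⟩

theorem normL6_eq_rpow {A : ℝ × ℝ → ℂ} (hA : AEStronglyMeasurable A) :
    normL6 A = (∫ p, ‖A p‖ ^ 6) ^ (1 / 6 : ℝ) := by
  rw [← normL6_pow_six hA, ← Real.rpow_natCast, ← Real.rpow_mul (normL6_nonneg A)]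
  norm_num

theorem tendsto_normL6_rescale_extension35_twoProfile (g₁ g₂ : L2R) :
    Tendsto (fun N => normL6 (rescale N (extension35 (twoProfile g₁ g₂ N))))
      (Bornology.cobounded ℝ)
      (𝓝 ((∫ p, meanSix ‖schrodinger g₁ p‖ ‖schrodingerBackward g₂ p‖) ^ (1 / 6 : ℝ))) := by
  have hpair : ∀ N, MemLp (wavePair N (schrodinger g₁) (schrodingerBackward g₂)) 6 :=
    fun N => memLp_wavePair N (memLp_schrodinger g₁) (memLp_schrodingerBackward g₂)
  have hwave := (tendsto_integral_norm_wavePair_pow_six (memLp_schrodinger g₁)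
    (memLp_schrodingerBackward g₂)).rpow_const (p := 1 / 6) (Or.inr (by norm_num))
  simp only [← normL6_eq_rpow (hpair _).1] at hwave
  have hdiff := (ENNReal.tendsto_toReal ENNReal.zero_ne_top).comp
    (tendsto_eLpNorm_rescale_sub_wavePair g₁ g₂)
  refine tendsto_of_tendsto_of_dist hwave (squeeze_zero' (Eventually.of_forall fun N =>
    dist_nonneg) ?_ hdiff)
  filter_upwards [Bornology.eventually_ne_cobounded 0] with N hN
  rw [dist_comm, Real.dist_eq]
  exact abs_normL6_sub_le (memLp_rescale hN (isExtension_extension35 _).1) (hpair N)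

theorem tendsto_normL6_extension35_twoProfile (g₁ g₂ : L2R) :
    Tendsto (fun N : ℝ => normL6 (extension35 (twoProfile g₁ g₂ N))) atTop
      (𝓝 (((∫ p, meanSix ‖schrodinger g₁ p‖ ‖schrodingerBackward g₂ p‖) / 10) ^ (1 / 6 : ℝ))) := by
  have hlim := ((tendsto_normL6_rescale_extension35_twoProfile g₁ g₂).mono_left
    IsOrderBornology.atTop_le_cobounded).div_const ((10 : ℝ) ^ (1 / 6 : ℝ))
  rw [← Real.div_rpow (integral_meanSix_nonneg _ _) (by norm_num)] at hlim
  refine hlim.congr' ?_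
  filter_upwards [eventually_ne_atTop 0] with N hN
  rw [normL6_rescale hN (isExtension_extension35 _).1.1, mul_div_cancel_left₀ _ (by positivity)]

theorem four_rpow_mul_rpow_half_eq {Z : ℝ} (hZ : 0 ≤ Z) :
    (4 : ℝ) ^ (-(1 / 6) : ℝ) * Z ^ (1 / 2 : ℝ) = (Z ^ 3 / 4) ^ (1 / 6 : ℝ) := by
  rw [Real.div_rpow (pow_nonneg hZ 3) (by norm_num), Real.rpow_neg (by norm_num),
    ← Real.rpow_natCast, ← Real.rpow_mul hZ, inv_mul_eq_div]
  norm_num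

end

theorem propositionP (g₁ g₂ : L2R) :
    -- all the functions below are well defined and lie in `L⁶(ℝ²)`
    IsExtension schrodingerWeight schrodingerPhase g₁ (schrodinger g₁) ∧
    IsExtension schrodingerWeight schrodingerPhase g₂ (schrodinger g₂) ∧
    (∀ N : ℝ, IsExtension weight35 phase35 (twoProfile g₁ g₂ N)
      (extension35 (twoProfile g₁ g₂ N))) ∧
    -- the limit exists, satisfies the bound, and equality is characterized
    ∃ L : ℝ,
      Tendsto (fun N : ℝ => normL6 (extension35 (twoProfile g₁ g₂ N))) atTop (𝓝 L) ∧
      L ≤ (4 : ℝ) ^ (-(1 / 6) : ℝ) *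
        (normL6 (schrodinger g₁) ^ 2 + normL6 (schrodinger g₂) ^ 2) ^ (1 / 2 : ℝ) ∧
      (L = (4 : ℝ) ^ (-(1 / 6) : ℝ) *
          (normL6 (schrodinger g₁) ^ 2 + normL6 (schrodinger g₂) ^ 2) ^ (1 / 2 : ℝ) ↔
        ∀ᵐ p : ℝ × ℝ, ‖schrodinger g₁ p‖ = ‖schrodinger g₂ (-p.1, p.2)‖) := by
  have hA := memLp_schrodinger g₁
  have hB := memLp_schrodingerBackward g₂
  have hmean := div_nonneg
    (integral_meanSix_nonneg (schrodinger g₁) (schrodingerBackward g₂)) (by norm_num : 0 ≤ (10 : ℝ))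
  rw [← normL6_schrodingerBackward g₂, four_rpow_mul_rpow_half_eq (by positivity)]
  refine ⟨isExtension_schrodinger g₁, isExtension_schrodinger g₂,
    fun N => isExtension_extension35 _, _, tendsto_normL6_extension35_twoProfile g₁ g₂,
    Real.rpow_le_rpow hmean (integral_meanSix_div_ten_le hA hB) (by norm_num), ?_⟩
  rw [Real.rpow_left_inj hmean (by positivity) (by norm_num)]
  exact integral_meanSix_div_ten_eq_iff hA hB
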